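/- **Theorem (Existence of a minimiser).** Let $n\ge 1$ and let $\Omega\subset\mathbb{R}^n$ be a bounded domain (open, connected, non-empty) with Lipschitz boundary $\Sigma:=\partial\Omega$, satisfying an interior sphere condition of some radius $R>0$: for every $x\in\Sigma$ there is a point $z$ with $|x-z|=R$ and $B_R(z)\subset\Omega$. Let $a>0$ and let $\beta\in L^\infty(\Sigma)$ satisfy $|\beta|\le 1-a$ almost everywhere on $\Sigma$. For $u \in L^1(\Omega)$ put $$\int_\Omega\sqrt{1+|Du|^2}:=\sup\int_\Omega \bigl(g_{n+1}+u\,\operatorname{div}(g_1,\dots,g_n)\bigr)\,dx,\qquad \int_\Omega\sqrt{u^2+|Du|^2}:=\sup\int_\Omega u\,\bigl(g_{n+1}+\operatorname{div}(g_1,\dots,g_n)\bigr)\,dx,$$ the suprema being over all $g_1,\dots,g_{n+1}\in C^1(\Omega)$ with compact support in $\Omega$ and $\sum_{i=1}^{n+1}g_i^2\le1$. Let $BV(\Omega)$ be the set of $u\in L^1(\Omega)$ with $\int_\Omega\sqrt{1+|Du|^2}<\infty$, and $BV^+(\Omega)$ the set of $u\in BV(\Omega)$ with $u\ge0$ almost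 everywhere in $\Omega$. For $v\in BV^+(\Omega)$ define $$\mathcal J_1(v)=\int_\Omega\sqrt{v^2+|Dv|^2}+\int_\Omega\int_1^{v}\ln h\,dh\,dx-\int_\Sigma\beta\,(1-v)\,ds,$$ where $ds$ is the $(n-1)$-dimensional surface (Hausdorff) measure on $\Sigma$ and, in the boundary integral, $v$ denotes the trace of $v$ on $\Sigma$, i.e. $v(x)=\lim_{r\to0^+}|\Omega\cap B_r(x)|^{-1}\int_{\Omega\cap B_r(x)}v\,dy$ for almost every $x\in\Sigma$. Then there exists $v\in BV^+(\Omega)$ with $\mathcal J_1(v)$ finite and $$\mathcal J_1(v)=\inf_{w\in BV^+(\Omega)}\mathcal J_1(w).$$ -/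

import Mathlib

open MeasureTheory Filter Topology Set
open scoped RealInnerProductSpace

noncomputable section

namespace Capillary

variable {n : ℕ}

/-- The divergence of a vector field on `ℝⁿ` (meaningful where `g` is differentiable). -/
def divergence (g : EuclideanSpace ℝ (Fin n) → EuclideanSpace ℝ (Fin n))
    (x : EuclideanSpace ℝ (Fin n)) : ℝ :=
  ∑ i, (fderiv ℝ g x (EuclideanSpace.single i 1)) i

/-- The test fields `(g₁, …, gₙ, gₙ₊₁) = (g, h)`: all components are `C¹` with compact support
in `Ω`, and the sum of the squares of the components is at most `1` everywhere. -/
structure IsTestField (Ω : Set (EuclideanSpace ℝ (Fin n)))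
    (g : EuclideanSpace ℝ (Fin n) → EuclideanSpace ℝ (Fin n))
    (h : EuclideanSpace ℝ (Fin n) → ℝ) : Prop where
  contDiff_fst : ContDiff ℝ 1 g
  contDiff_snd : ContDiff ℝ 1 h
  hasCompactSupport_fst : HasCompactSupport g
  hasCompactSupport_snd : HasCompactSupport h
  tsupport_fst_subset : tsupport g ⊆ Ω
  tsupport_snd_subset : tsupport h ⊆ Ω
  sq_add_sq_le_one : ∀ x, ‖g x‖ ^ 2 + h x ^ 2 ≤ 1

/-- The area functional `∫_Ω √(1 + |Du|²)`, in the sense of functions of bounded variation. -/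
def areaEnergy (Ω : Set (EuclideanSpace ℝ (Fin n))) (u : EuclideanSpace ℝ (Fin n) → ℝ) : EReal :=
  ⨆ (g : EuclideanSpace ℝ (Fin n) → EuclideanSpace ℝ (Fin n))
    (h : EuclideanSpace ℝ (Fin n) → ℝ) (_ : IsTestField Ω g h),
    ((∫ x in Ω, (h x + u x * divergence g x) : ℝ) : EReal)

/-- The surface energy `∫_Ω √(v² + |Dv|²)`, in the sense of functions of bounded variation. -/
def surfaceEnergy (Ω : Set (EuclideanSpace ℝ (Fin n))) (v : EuclideanSpace ℝ (Fin n) → ℝ) :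
    EReal :=
  ⨆ (g : EuclideanSpace ℝ (Fin n) → EuclideanSpace ℝ (Fin n))
    (h : EuclideanSpace ℝ (Fin n) → ℝ) (_ : IsTestField Ω g h),
    ((∫ x in Ω, v x * (h x + divergence g x) : ℝ) : EReal)

/-- `BV(Ω)`: the functions in `L¹(Ω)` with `∫_Ω √(1 + |Du|²) < ∞`. -/
def BV (Ω : Set (EuclideanSpace ℝ (Fin n))) : Set (EuclideanSpace ℝ (Fin n) → ℝ) :=
  {u | IntegrableOn u Ω ∧ areaEnergy Ω u < ⊤}

/-- `BV⁺(Ω)`: the functions in `BV(Ω)` that are nonnegative almost everywhere in `Ω`. -/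
def BVPlus (Ω : Set (EuclideanSpace ℝ (Fin n))) : Set (EuclideanSpace ℝ (Fin n) → ℝ) :=
  {u | u ∈ BV Ω ∧ ∀ᵐ x ∂(volume.restrict Ω), 0 ≤ u x}

/-- `∂Ω` is Lipschitz: near each boundary point there are a direction `e` ("up") and a Lipschitz
function `ψ` of the component orthogonal to `e` such that `Ω` is, locally, the set of points lying
strictly above the graph of `ψ`. -/
def HasLipschitzBoundary (Ω : Set (EuclideanSpace ℝ (Fin n))) : Prop :=
  ∀ x ∈ frontier Ω, ∃ (e : EuclideanSpace ℝ (Fin n)) (r : ℝ) (K : NNReal)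
    (ψ : EuclideanSpace ℝ (Fin n) → ℝ), ‖e‖ = 1 ∧ 0 < r ∧ LipschitzWith K ψ ∧
      ∀ y ∈ Metric.ball x r, (y ∈ Ω ↔ ψ (y - ⟪e, y⟫ • e) < ⟪e, y⟫)

/-- The interior sphere condition of radius `R`: every boundary point lies on the boundary of an
open ball of radius `R` that is contained in `Ω`. -/
def InteriorSphereCondition (Ω : Set (EuclideanSpace ℝ (Fin n))) (R : ℝ) : Prop :=
  ∀ x ∈ frontier Ω, ∃ z, dist x z = R ∧ Metric.ball z R ⊆ Ω

/-- The surface measure `ds` on `Σ = ∂Ω`: the `(n-1)`-dimensional Hausdorff measure, normalised so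
as to agree with Lebesgue measure on `ℝⁿ⁻¹`, restricted to `∂Ω`. -/
def surfaceMeasure (Ω : Set (EuclideanSpace ℝ (Fin n))) : Measure (EuclideanSpace ℝ (Fin n)) :=
  (Measure.euclideanHausdorffMeasure (n - 1)).restrict (frontier Ω)

/-- The trace of `v` on `∂Ω`: its value at `x ∈ ∂Ω` is the limit, as `r → 0⁺`, of the averages of
`v` over `Ω ∩ B_r(x)`.  For `v ∈ BV(Ω)` and `Ω` bounded with Lipschitz boundary this limit
exists at almost every boundary point (with respect to surface measure). -/
def trace (Ω : Set (EuclideanSpace ℝ (Fin n))) (v : EuclideanSpace ℝ (Fin n) → ℝ)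
    (x : EuclideanSpace ℝ (Fin n)) : ℝ :=
  limUnder (𝓝[>] (0 : ℝ)) fun r => ⨍ y in Ω ∩ Metric.ball x r, v y

/-- The potential energy `∫_Ω ∫_1^v ln h dh dx`, for `v ≥ 0` almost everywhere in `Ω`.  The inner
integral equals `v ln v - v + 1 ≥ 0`, so the outer one is well defined in `[0, ∞]`. -/
def potentialEnergy (Ω : Set (EuclideanSpace ℝ (Fin n))) (v : EuclideanSpace ℝ (Fin n) → ℝ) :
    ENNReal :=
  ∫⁻ x in Ω, ENNReal.ofReal (∫ h in (1 : ℝ)..(v x), Real.log h)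

/-- The term `∫_Σ β (1 - v) ds`, where `v` on `Σ` is understood as the trace. -/
def boundaryTerm (Ω : Set (EuclideanSpace ℝ (Fin n))) (β v : EuclideanSpace ℝ (Fin n) → ℝ) : ℝ :=
  ∫ x, β x * (1 - trace Ω v x) ∂(surfaceMeasure Ω)

/-- The energy `𝓙₁(v) = ∫_Ω √(v² + |Dv|²) + ∫_Ω ∫_1^v ln h dh dx - ∫_Σ β (1 - v) ds`.  The first
two terms lie in `[0, ∞]` and the last one is real, so no indeterminate sum occurs. -/
def energy (Ω : Set (EuclideanSpace ℝ (Fin n))) (β v : EuclideanSpace ℝ (Fin n) → ℝ) : EReal :=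
  surfaceEnergy Ω v + (potentialEnergy Ω v : EReal) - (boundaryTerm Ω β v : EReal)

end Capillary

end

open MeasureTheory Filter Topology Set
open scoped RealInnerProductSpace
noncomputable section
namespace Capillary

open scoped ENNReal NNReal Convolution MeasureTheory

variable {n : ℕ}

local notation "𝔼" n => EuclideanSpace ℝ (Fin n)

/-! The proof is the direct method, with convexity taking the place of a compactness theorem. The
surface energy is a supremum of linear functionals, the boundary term is affine, and the entropy
integrand `∫₁^v ln h dh` exceeds convexity at the midpoint of `a` and `b` by a multiple of `(√a -
√b)²` (`entropy_midpoint`). The midpoint of two almost minimal functions cannot go below the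
infimum, so the two functions are close in `L¹` (`exists_integral_abs_sub_lt`). A suitable
minimising sequence is therefore Cauchy in `L¹(Ω)`, and what remains is coercivity
(`IsSphereDomain.exists_coercive`) and lower semicontinuity in `L¹` (`HasFiniteEnergy.of_tendsto`).

The obstacle is the boundary term, since traces are not continuous in `L¹`. With only `|β| ≤ 1 - a`,
it can be absorbed by the surface energy if the trace inequality holds with a leading constant
arbitrarily close to one and with the variation taken only in a thin layer `U` at the boundary: `(1
- a) ∫_Σ |w| ≤ ∫_U |Dw| + C ∫ |w|` (`exists_sharp_trace_inequality`). For lower semicontinuity, a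
test field with compact support in `Ω` is fixed and `U` is taken disjoint from its support. The
surface energy of `u k` then contains the tested integral plus the variation of `u k` in `U`, and
the latter pays for the difference of the boundary terms; the limit function itself has little
variation in `U`.

The interior sphere condition enters in the sharp inequality. If `d` is the distance to the centres
of interior balls of radius `R`, then `f = (R² - d²) / (2R)` vanishes on the boundary, is semiconvex
with constant `1 / R`, and has slope close to one near the boundary. After mollification `f` becomes
a smooth `q` with Laplacian at least `-n / R`. A normalised, cut-off multiple of `θ(q / s) ∇q`, with
`θ` a ramp, has norm at most one; its divergence is almost `2 / s` on the band at heights between `s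
/ 2` and `s`, and is bounded below elsewhere independently of `s`. Testing `|w|` with it bounds the
mean of `|w|` over the band (`exists_band_estimate`). As `s → 0` these means dominate the trace: the
boundary is cut into nearly flat graphs on which the area distortion is close to one
(`exists_flatPieces`, `lintegral_trace_le`).

That traces exist almost everywhere is proved in Lipschitz charts. The `L¹` distance of two slices
parallel to the graph is at most the variation between them, so the slices converge to a vertical
trace; a Vitali covering argument shows that the variation in small cylinders is of lower order at
almost every point, where the averages then converge too (`ae_exists_hasTrace`). -/

/-! ### Unit fields, divergence and total variation. -/

/-- A `C¹` vector field with compact support in `U` and norm at most one. -/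
structure IsUnitField (U : Set (𝔼 n)) (g : (𝔼 n) → 𝔼 n) : Prop where
  contDiff : ContDiff ℝ 1 g
  hasCompactSupport : HasCompactSupport g
  tsupport_subset : tsupport g ⊆ U
  norm_le_one : ∀ x, ‖g x‖ ≤ 1

lemma isUnitField_iff_isTestField {U : Set (𝔼 n)} {g : (𝔼 n) → 𝔼 n} :
    IsUnitField U g ↔ IsTestField U g 0 := by
  constructor
  · intro h
    refine ⟨h.contDiff, contDiff_const, h.hasCompactSupport, HasCompactSupport.zero,
      h.tsupport_subset, by simp [tsupport], fun x => ?_⟩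
    have := h.norm_le_one x
    have h0 := norm_nonneg (g x)
    simp only [Pi.zero_apply]
    nlinarith
  · intro h
    refine ⟨h.contDiff_fst, h.hasCompactSupport_fst, h.tsupport_fst_subset, fun x => ?_⟩
    have := h.sq_add_sq_le_one x
    simp only [Pi.zero_apply] at this
    have h0 := norm_nonneg (g x)
    nlinarith

lemma isUnitField_zero (U : Set (𝔼 n)) : IsUnitField U (0 : (𝔼 n) → 𝔼 n) :=
  ⟨contDiff_const, HasCompactSupport.zero, by simp [tsupport], fun x => by simp⟩

lemma IsUnitField.mono {U V : Set (𝔼 n)} {g : (𝔼 n) → 𝔼 n} (h : IsUnitField U g) (hUV : U ⊆ V) :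
    IsUnitField V g :=
  ⟨h.contDiff, h.hasCompactSupport, h.tsupport_subset.trans hUV, h.norm_le_one⟩

lemma IsTestField.fst {U : Set (𝔼 n)} {g : (𝔼 n) → 𝔼 n} {h : (𝔼 n) → ℝ} (H : IsTestField U g h) :
    IsUnitField U g :=
  ⟨H.contDiff_fst, H.hasCompactSupport_fst, H.tsupport_fst_subset, fun x => by
    have := H.sq_add_sq_le_one x
    have h0 := norm_nonneg (g x)
    nlinarith [sq_nonneg (h x)]⟩

lemma divergence_zero : divergence (0 : (𝔼 n) → 𝔼 n) = 0 := by
  ext x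
  have : (0 : (𝔼 n) → 𝔼 n) = fun _ => 0 := rfl
  simp [divergence, this]

lemma divergence_add {g₁ g₂ : (𝔼 n) → 𝔼 n} {x : 𝔼 n} (h₁ : DifferentiableAt ℝ g₁ x)
    (h₂ : DifferentiableAt ℝ g₂ x) :
    divergence (g₁ + g₂) x = divergence g₁ x + divergence g₂ x := by
  simp [divergence, fderiv_add h₁ h₂, Finset.sum_add_distrib]

lemma divergence_neg {g : (𝔼 n) → 𝔼 n} (x : 𝔼 n) : divergence (-g) x = -divergence g x := by
  simp [divergence, fderiv_neg]

lemma continuous_divergence {g : (𝔼 n) → 𝔼 n} (hg : ContDiff ℝ 1 g) :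
    Continuous (divergence g) := by
  unfold divergence
  have := hg.continuous_fderiv one_ne_zero
  fun_prop

lemma tsupport_divergence_subset (g : (𝔼 n) → 𝔼 n) : tsupport (divergence g) ⊆ tsupport g := by
  refine closure_minimal (fun x hx => ?_) (isClosed_tsupport g)
  by_contra h
  apply hx
  simp [divergence, fderiv_of_notMem_tsupport ℝ h]

lemma hasCompactSupport_divergence {g : (𝔼 n) → 𝔼 n} (hg : HasCompactSupport g) :
    HasCompactSupport (divergence g) :=
  hg.mono' ((subset_tsupport _).trans (tsupport_divergence_subset g))

lemma divergence_eq_zero {U : Set (𝔼 n)} {g : (𝔼 n) → 𝔼 n} (hg : tsupport g ⊆ U) {x : 𝔼 n}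
    (hx : x ∉ U) : divergence g x = 0 := by
  by_contra h
  exact hx (hg (tsupport_divergence_subset g (subset_tsupport _ h)))

lemma integrable_mul_divergence {u : (𝔼 n) → ℝ} (hu : LocallyIntegrable u) {g : (𝔼 n) → 𝔼 n}
    (hg : ContDiff ℝ 1 g) (hc : HasCompactSupport g) :
    Integrable fun x => u x * divergence g x := by
  have := hu.integrable_smul_right_of_hasCompactSupport (continuous_divergence hg)
    (hasCompactSupport_divergence hc)
  simpa using this

/-- The total variation `∫_U |Du|`. -/
def variation (u : (𝔼 n) → ℝ) (U : Set (𝔼 n)) : ℝ≥0∞ :=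
  ⨆ (g : (𝔼 n) → 𝔼 n) (_ : IsUnitField U g), ENNReal.ofReal (∫ x, u x * divergence g x)

lemma ofReal_le_variation {u : (𝔼 n) → ℝ} {U : Set (𝔼 n)} {g : (𝔼 n) → 𝔼 n}
    (hg : IsUnitField U g) : ENNReal.ofReal (∫ x, u x * divergence g x) ≤ variation u U :=
  le_iSup₂_of_le g hg le_rfl

lemma variation_le_iff {u : (𝔼 n) → ℝ} {U : Set (𝔼 n)} {M : ℝ≥0∞} :
    variation u U ≤ M ↔ ∀ g, IsUnitField U g → ENNReal.ofReal (∫ x, u x * divergence g x) ≤ M := by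
  simp [variation]

lemma integral_le_variation {u : (𝔼 n) → ℝ} {U : Set (𝔼 n)} (h : variation u U ≠ ∞)
    {g : (𝔼 n) → 𝔼 n} (hg : IsUnitField U g) :
    ∫ x, u x * divergence g x ≤ (variation u U).toReal :=
  (ENNReal.ofReal_le_iff_le_toReal h).1 (ofReal_le_variation hg)

lemma variation_mono {u : (𝔼 n) → ℝ} {U V : Set (𝔼 n)} (h : U ⊆ V) :
    variation u U ≤ variation u V :=
  variation_le_iff.2 fun _ hg => ofReal_le_variation (hg.mono h)

lemma variation_congr {u v : (𝔼 n) → ℝ} {U : Set (𝔼 n)} (hU : MeasurableSet U)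
    (h : u =ᵐ[volume.restrict U] v) : variation u U = variation v U := by
  unfold variation
  congr! 4 with g hg
  apply integral_congr_ae
  filter_upwards [(ae_restrict_iff' hU).1 h] with x hx
  by_cases hxU : x ∈ U
  · rw [hx hxU]
  · simp [divergence_eq_zero hg.tsupport_subset hxU]

lemma variation_sub_le {u v : (𝔼 n) → ℝ} (hu : LocallyIntegrable u) (hv : LocallyIntegrable v)
    (U : Set (𝔼 n)) : variation (u - v) U ≤ variation u U + variation v U := by
  refine variation_le_iff.2 fun g hg => ?_
  have h1 := integrable_mul_divergence hu hg.contDiff hg.hasCompactSupport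
  have h2 := integrable_mul_divergence hv hg.contDiff hg.hasCompactSupport
  have hneg : IsUnitField U (-g) := ⟨hg.contDiff.neg, hg.hasCompactSupport.neg,
    by simpa [tsupport] using hg.tsupport_subset, fun x => by simpa using hg.norm_le_one x⟩
  have : ∫ x, (u - v) x * divergence g x
      = (∫ x, u x * divergence g x) + ∫ x, v x * divergence (-g) x := by
    simp_rw [divergence_neg, mul_neg, integral_neg, Pi.sub_apply, sub_mul]
    rw [integral_sub h1 h2, sub_eq_add_neg]
  rw [this]
  exact ENNReal.ofReal_add_le.trans
    (add_le_add (ofReal_le_variation hg) (ofReal_le_variation hneg))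

/-- At each point at most one of the two fields is non-zero, so the pointwise norm bound survives
addition. This is the source of the superadditivity of the variation. -/
lemma isUnitField_add {U V : Set (𝔼 n)} (h : Disjoint U V) {g₁ g₂ : (𝔼 n) → 𝔼 n}
    (h₁ : IsUnitField U g₁) (h₂ : IsUnitField V g₂) : IsUnitField (U ∪ V) (g₁ + g₂) := by
  refine ⟨h₁.contDiff.add h₂.contDiff, h₁.hasCompactSupport.add h₂.hasCompactSupport,
    (tsupport_add _ _).trans (union_subset_union h₁.tsupport_subset h₂.tsupport_subset),
    fun x => ?_⟩
  by_cases hx : x ∈ U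
  · have : g₂ x = 0 := by
      by_contra h0
      exact h.le_bot ⟨hx, h₂.tsupport_subset (subset_tsupport _ h0)⟩
    simpa [this] using h₁.norm_le_one x
  · have : g₁ x = 0 := by
      by_contra h0
      exact hx (h₁.tsupport_subset (subset_tsupport _ h0))
    simpa [this] using h₂.norm_le_one x

lemma variation_add_le {u : (𝔼 n) → ℝ} (hu : LocallyIntegrable u) {U V : Set (𝔼 n)}
    (h : Disjoint U V) : variation u U + variation u V ≤ variation u (U ∪ V) := by
  unfold variation
  refine ENNReal.biSup_add_biSup_le' (p := IsUnitField U) (q := IsUnitField V)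
    ⟨0, isUnitField_zero U⟩ ⟨0, isUnitField_zero V⟩ fun g₁ h₁ g₂ h₂ => ?_
  have i1 := integrable_mul_divergence hu h₁.contDiff h₁.hasCompactSupport
  have i2 := integrable_mul_divergence hu h₂.contDiff h₂.hasCompactSupport
  -- `ENNReal.ofReal` truncates negative integrals to zero; in that case the offending field is
  -- dropped instead of added.
  rcases le_total (∫ x, u x * divergence g₁ x) 0 with hn | hp
  · rw [ENNReal.ofReal_of_nonpos hn, zero_add]
    exact le_iSup₂_of_le g₂ (h₂.mono subset_union_right) le_rfl
  rcases le_total (∫ x, u x * divergence g₂ x) 0 with hn | hp2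
  · rw [ENNReal.ofReal_of_nonpos hn, add_zero]
    exact le_iSup₂_of_le g₁ (h₁.mono subset_union_left) le_rfl
  refine le_iSup₂_of_le (g₁ + g₂) (isUnitField_add h h₁ h₂) ?_
  rw [← ENNReal.ofReal_add hp hp2, ← integral_add i1 i2]
  apply le_of_eq
  congr 2
  ext x
  rw [divergence_add ((h₁.contDiff.differentiable one_ne_zero) x)
    ((h₂.contDiff.differentiable one_ne_zero) x)]
  ring

lemma sum_variation_le {ι : Type*} {u : (𝔼 n) → ℝ} (hu : LocallyIntegrable u) {U : ι → Set (𝔼 n)}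
    (s : Finset ι) (h : (s : Set ι).PairwiseDisjoint U) :
    ∑ i ∈ s, variation u (U i) ≤ variation u (⋃ i ∈ s, U i) := by
  classical
  induction s using Finset.induction_on with
  | empty => simp
  | insert a s ha ih =>
    rw [Finset.sum_insert ha, Finset.set_biUnion_insert]
    refine le_trans (add_le_add_right (ih (h.subset (by simp))) _) (variation_add_le hu ?_)
    rw [Set.disjoint_iUnion₂_right]
    intro i hi
    exact h (by simp) (by simp [hi]) (by rintro rfl; exact ha hi)

/-- The variation of a function of bounded variation concentrates on a compact set. -/
lemma exists_isCompact_variation_le {u : (𝔼 n) → ℝ} (hu : LocallyIntegrable u) {U : Set (𝔼 n)}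
    (hfin : variation u U ≠ ∞) {ε : ℝ≥0∞} (hε : ε ≠ 0) :
    ∃ K, IsCompact K ∧ K ⊆ U ∧ ∀ V, V ⊆ U → Disjoint V K → variation u V ≤ ε := by
  by_cases h0 : variation u U = 0
  · exact ⟨∅, isCompact_empty, empty_subset _, fun V hV _ => (variation_mono hV).trans (by simp [h0])⟩
  have hlt : variation u U - ε < variation u U := ENNReal.sub_lt_self hfin h0 hε
  -- A nearly optimal field has compact support, and that support already carries all but `ε` of the
  -- variation. By superadditivity at most `ε` is left for any set disjoint from it.
  obtain ⟨g, hg, hlt⟩ : ∃ g, ∃ _ : IsUnitField U g,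
      variation u U - ε < ENNReal.ofReal (∫ x, u x * divergence g x) := by
    have := hlt
    conv_rhs at this => unfold variation
    simpa only [lt_iSup_iff] using this
  refine ⟨tsupport g, hg.hasCompactSupport, hg.tsupport_subset, fun V hV hd => ?_⟩
  have hg' : IsUnitField (tsupport g) g := ⟨hg.contDiff, hg.hasCompactSupport, subset_rfl, hg.norm_le_one⟩
  have h1 : variation u U - ε ≤ variation u (tsupport g) := hlt.le.trans (ofReal_le_variation hg')
  have h2 := (variation_add_le hu hd).trans (variation_mono (union_subset hV hg.tsupport_subset))
  have hfin2 : variation u (tsupport g) ≠ ∞ :=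
    ne_top_of_le_ne_top hfin (variation_mono hg.tsupport_subset)
  have h3 : variation u V ≤ variation u U - variation u (tsupport g) :=
    ENNReal.le_sub_of_add_le_right hfin2 h2
  refine h3.trans ?_
  rw [tsub_le_iff_right] at h1 ⊢
  rwa [add_comm]

/-! ### Mollification. -/

/-- The convolution of `w` with a normalised smooth bump function. -/
def mollify (φ : ContDiffBump (0 : 𝔼 n)) (w : (𝔼 n) → ℝ) : (𝔼 n) → ℝ :=
  φ.normed volume ⋆[ContinuousLinearMap.lsmul ℝ ℝ, volume] w

lemma mollify_apply (φ : ContDiffBump (0 : 𝔼 n)) (w : (𝔼 n) → ℝ) (x : 𝔼 n) :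
    mollify φ w x = ∫ t, φ.normed volume t * w (x - t) := by
  simp [mollify, convolution]

lemma contDiff_mollify (φ : ContDiffBump (0 : 𝔼 n)) {w : (𝔼 n) → ℝ} (hw : LocallyIntegrable w)
    (m : ℕ∞) : ContDiff ℝ m (mollify φ w) :=
  φ.hasCompactSupport_normed.contDiff_convolution_left _ φ.contDiff_normed hw

lemma integrable_mollify (φ : ContDiffBump (0 : 𝔼 n)) {w : (𝔼 n) → ℝ} (hw : Integrable w) :
    Integrable (mollify φ w) :=
  φ.integrable_normed.integrable_convolution _ hw

lemma abs_mollify_le (φ : ContDiffBump (0 : 𝔼 n)) (w : (𝔼 n) → ℝ) (x : 𝔼 n) :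
    |mollify φ w x| ≤ mollify φ (fun y => |w y|) x := by
  rw [mollify_apply, mollify_apply]
  refine (abs_integral_le_integral_abs).trans (le_of_eq ?_)
  congr 1
  ext t
  rw [abs_mul, abs_of_nonneg (φ.nonneg_normed t)]

lemma integral_abs_mollify_le (φ : ContDiffBump (0 : 𝔼 n)) {w : (𝔼 n) → ℝ} (hw : Integrable w) :
    ∫ x, |mollify φ w x| ≤ ∫ x, |w x| := by
  have h1 : ∫ x, mollify φ (fun y => |w y|) x = ∫ x, |w x| := by
    unfold mollify
    rw [integral_convolution _ φ.integrable_normed hw.abs, φ.integral_normed]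
    simp
  rw [← h1]
  exact integral_mono (integrable_mollify φ hw).abs (integrable_mollify φ hw.abs)
    (abs_mollify_le φ w)

lemma divergence_comp_add (g : (𝔼 n) → 𝔼 n) (t x : 𝔼 n) :
    divergence (fun y => g (y + t)) x = divergence g (x + t) := by
  simp [divergence, fderiv_comp_add_right]

lemma IsUnitField.comp_add {U V : Set (𝔼 n)} {g : (𝔼 n) → 𝔼 n} (hg : IsUnitField U g) {t : 𝔼 n}
    (ht : ∀ x ∈ U, x - t ∈ V) : IsUnitField V (fun y => g (y + t)) := by
  have hs : tsupport (fun y => g (y + t)) = (Homeomorph.addRight t) ⁻¹' tsupport g :=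
    tsupport_comp_eq_preimage g (Homeomorph.addRight t)
  refine ⟨hg.contDiff.comp (contDiff_id.add contDiff_const),
    hg.hasCompactSupport.comp_homeomorph (Homeomorph.addRight t), ?_, fun x => hg.norm_le_one _⟩
  rw [hs]
  intro x hx
  have := ht _ (hg.tsupport_subset hx)
  simpa using this

/-- A mollification is an average of translates. Fubini moves each translation onto the test field,
which stays admissible on `V` because the translation is shorter than `φ.rOut`. -/
lemma variation_mollify_le (φ : ContDiffBump (0 : 𝔼 n)) {w : (𝔼 n) → ℝ} (hw : Integrable w)
    {U V : Set (𝔼 n)} (h : ∀ x ∈ U, Metric.closedBall x φ.rOut ⊆ V) :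
    variation (mollify φ w) U ≤ variation w V := by
  by_cases hfin : variation w V = ∞
  · simp [hfin]
  refine variation_le_iff.2 fun g hg => ?_
  rw [ENNReal.ofReal_le_iff_le_toReal hfin]
  set ρ := φ.normed (volume : Measure (𝔼 n))
  set M := (variation w V).toReal
  have hdc := continuous_divergence hg.contDiff
  obtain ⟨B, hB⟩ := hdc.bounded_above_of_compact_support (hasCompactSupport_divergence hg.hasCompactSupport)
  have hint : Integrable (Function.uncurry fun x t => ρ t * w (x - t) * divergence g x)
      ((volume : Measure (𝔼 n)).prod volume) := by
    have h1 := (φ.integrable_normed (μ := (volume : Measure (𝔼 n)))).convolution_integrand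
      (ContinuousLinearMap.lsmul ℝ ℝ) hw
    refine h1.mul_bdd (c := B) (hdc.comp continuous_fst).aestronglyMeasurable
      (Eventually.of_forall fun p => hB p.1)
  have e1 : ∫ x, mollify φ w x * divergence g x
      = ∫ t, ρ t * ∫ x, w x * divergence (fun y => g (y + t)) x := by
    calc _ = ∫ x, ∫ t, ρ t * w (x - t) * divergence g x := by
          congr 1; ext x; rw [mollify_apply, ← integral_mul_const]
      _ = ∫ t, ∫ x, ρ t * w (x - t) * divergence g x := integral_integral_swap hint
      _ = _ := by
          congr 1; ext t
          rw [← integral_const_mul]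
          rw [← integral_add_right_eq_self _ t]
          congr 1; ext x
          rw [divergence_comp_add, add_sub_cancel_right]; ring
  rw [e1]
  have e2 : M = ∫ t, ρ t * M := by
    rw [integral_mul_const, φ.integral_normed, one_mul]
  rw [e2]
  have hi1 : Integrable fun t => ρ t * ∫ x, w x * divergence (fun y => g (y + t)) x := by
    have := hint.integral_prod_right
    refine this.congr (Eventually.of_forall fun t => ?_)
    simp only [Function.uncurry]
    rw [← integral_const_mul, ← integral_add_right_eq_self _ t]
    congr 1; ext x
    rw [divergence_comp_add, add_sub_cancel_right]; ring
  refine integral_mono hi1 (φ.integrable_normed.mul_const _) fun t => ?_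
  by_cases ht : ρ t = 0
  · simp [ht]
  have ht' : t ∈ Metric.ball (0 : 𝔼 n) φ.rOut := by
    rw [← φ.support_normed_eq (μ := volume)]; exact ht
  refine mul_le_mul_of_nonneg_left ?_ (φ.nonneg_normed t)
  refine integral_le_variation hfin (hg.comp_add fun x hx => h x hx ?_)
  simp only [Metric.mem_ball, dist_zero_right] at ht'
  simp [ht'.le]

/-- A sequence of bump functions whose supports shrink to the origin. -/
def bumpSeq (n k : ℕ) : ContDiffBump (0 : 𝔼 n) where
  rIn := 1 / (2 * ((k : ℝ) + 1))
  rOut := 1 / ((k : ℝ) + 1)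
  rIn_pos := by positivity
  rIn_lt_rOut := by
    apply one_div_lt_one_div_of_lt <;> linarith [(Nat.cast_nonneg k : (0 : ℝ) ≤ k)]

lemma tendsto_rOut_bumpSeq : Tendsto (fun k => (bumpSeq n k).rOut) atTop (𝓝 0) :=
  tendsto_one_div_add_atTop_nhds_zero_nat

lemma ae_tendsto_mollify {w : (𝔼 n) → ℝ} (hw : LocallyIntegrable w) :
    ∀ᵐ x, Tendsto (fun k => mollify (bumpSeq n k) w x) atTop (𝓝 (w x)) := by
  refine ContDiffBump.ae_convolution_tendsto_right_of_locallyIntegrable (K := 2)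
    tendsto_rOut_bumpSeq (Eventually.of_forall fun k => ?_) hw
  simp only [bumpSeq]
  apply le_of_eq
  field_simp

lemma eventually_closedBall_bumpSeq_subset {K U : Set (𝔼 n)} (hK : IsCompact K) (hU : IsOpen U)
    (h : K ⊆ U) : ∀ᶠ k in atTop, ∀ x ∈ K, Metric.closedBall x (bumpSeq n k).rOut ⊆ U := by
  obtain ⟨δ, hδ, hsub⟩ := hK.exists_thickening_subset_open hU h
  filter_upwards [tendsto_rOut_bumpSeq.eventually_lt_const hδ] with k hk x hx y hy
  exact hsub (Metric.mem_thickening_iff.2 ⟨x, hx, lt_of_le_of_lt hy hk⟩)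

/-! ### Integration by parts and a smooth substitute for the sign. -/

lemma divergence_eq_sum {g : (𝔼 n) → 𝔼 n} {x : 𝔼 n} (hg : DifferentiableAt ℝ g x) :
    divergence g x = ∑ i, fderiv ℝ (fun y => g y i) x (EuclideanSpace.single i 1) := by
  unfold divergence
  congr 1; ext i
  have : (fun y => g y i) = (EuclideanSpace.proj i : (𝔼 n) →L[ℝ] ℝ) ∘ g := rfl
  rw [this, fderiv_comp x (EuclideanSpace.proj i : (𝔼 n) →L[ℝ] ℝ).differentiableAt hg,
    ContinuousLinearMap.fderiv]
  rfl

lemma divergence_smul {f : (𝔼 n) → ℝ} {g : (𝔼 n) → 𝔼 n} {x : 𝔼 n} (hf : DifferentiableAt ℝ f x)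
    (hg : DifferentiableAt ℝ g x) :
    divergence (fun y => f y • g y) x = f x * divergence g x + fderiv ℝ f x (g x) := by
  have h : fderiv ℝ (fun y => f y • g y) x
      = f x • fderiv ℝ g x + (fderiv ℝ f x).smulRight (g x) := fderiv_smul hf hg
  unfold divergence
  rw [h]
  simp only [add_apply, smul_apply,
    ContinuousLinearMap.smulRight_apply, PiLp.add_apply, PiLp.smul_apply, smul_eq_mul,
    Finset.sum_add_distrib, Finset.mul_sum]
  congr 1
  conv_rhs => rw [← (EuclideanSpace.basisFun (Fin n) ℝ).sum_repr (g x), map_sum]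
  congr 1; ext i
  simp [mul_comm]

lemma continuous_fderiv_apply_field {q : (𝔼 n) → ℝ} (hq : ContDiff ℝ 1 q) {g : (𝔼 n) → 𝔼 n}
    (hg : Continuous g) : Continuous fun x => fderiv ℝ q x (g x) :=
  (hq.continuous_fderiv one_ne_zero).clm_apply hg

/-- The integral of the divergence of a compactly supported `C¹` field vanishes. -/
lemma integral_divergence_eq_zero {g : (𝔼 n) → 𝔼 n} (hg : ContDiff ℝ 1 g)
    (hc : HasCompactSupport g) : ∫ x, divergence g x = 0 := by
  have hgi : ∀ i, ContDiff ℝ 1 fun y => g y i := fun i =>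
    (EuclideanSpace.proj i : (𝔼 n) →L[ℝ] ℝ).contDiff.comp hg
  have hci : ∀ i, HasCompactSupport fun y => g y i := fun i =>
    hc.comp_left (g := fun v : 𝔼 n => v i) rfl
  have hint : ∀ i, Integrable fun x => fderiv ℝ (fun y => g y i) x (EuclideanSpace.single i 1) := by
    intro i
    refine Continuous.integrable_of_hasCompactSupport
      (((hgi i).continuous_fderiv one_ne_zero).clm_apply continuous_const) ?_
    exact (hci i).fderiv_apply (𝕜 := ℝ) _
  have : ∀ x, divergence g x = ∑ i, fderiv ℝ (fun y => g y i) x (EuclideanSpace.single i 1) :=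
    fun x => divergence_eq_sum (hg.differentiable one_ne_zero x)
  simp_rw [this]
  rw [integral_finsetSum _ fun i _ => hint i]
  refine Finset.sum_eq_zero fun i _ => ?_
  have h := integral_mul_fderiv_eq_neg_fderiv_mul_of_integrable (μ := volume) (f := fun _ : 𝔼 n => (1 : ℝ))
    (g := fun y => g y i) (v := EuclideanSpace.single i 1) (by simp) (by simpa using hint i)
    (by simpa using ((hgi i).continuous.integrable_of_hasCompactSupport (hci i)))
    (fun x _ => differentiableAt_const _) (fun x _ => (hgi i).differentiable one_ne_zero x)
  simpa using h

lemma integral_mul_divergence_eq {q : (𝔼 n) → ℝ} (hq : ContDiff ℝ 1 q) {g : (𝔼 n) → 𝔼 n}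
    (hg : ContDiff ℝ 1 g) (hc : HasCompactSupport g) :
    ∫ x, q x * divergence g x = - ∫ x, fderiv ℝ q x (g x) := by
  have h0 := integral_divergence_eq_zero (hq.smul hg) (hc.smul_left (f := q))
  have e : ∀ x, divergence (q • g) x = q x * divergence g x + fderiv ℝ q x (g x) := fun x =>
    divergence_smul (hq.differentiable one_ne_zero x) (hg.differentiable one_ne_zero x)
  simp_rw [e] at h0
  rw [integral_add] at h0
  · linarith
  · exact integrable_mul_divergence hq.continuous.locallyIntegrable hg hc
  · refine (continuous_fderiv_apply_field hq hg.continuous).integrable_of_hasCompactSupport ?_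
    refine hc.mono fun x hx => ?_
    intro h
    apply hx
    simp [h]

/-- The derivative of `t ↦ √(t² + ζ²)`. -/
def smoothSign (ζ t : ℝ) : ℝ := t / √(t ^ 2 + ζ ^ 2)

lemma sqrt_pos_aux {ζ : ℝ} (hζ : 0 < ζ) (t : ℝ) : 0 < √(t ^ 2 + ζ ^ 2) := by positivity

lemma abs_smoothSign_le {ζ : ℝ} (hζ : 0 < ζ) (t : ℝ) : |smoothSign ζ t| ≤ 1 := by
  unfold smoothSign
  rw [abs_div, abs_of_pos (sqrt_pos_aux hζ t), div_le_one (sqrt_pos_aux hζ t)]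
  exact Real.abs_le_sqrt (by nlinarith)

/-- Replacing the sign of `t` by its smooth version loses at most `ζ` pointwise, an error that
disappears as `ζ → 0` on sets of finite measure. -/
lemma abs_sub_le_mul_smoothSign {ζ : ℝ} (hζ : 0 < ζ) (t : ℝ) : |t| - ζ ≤ t * smoothSign ζ t := by
  unfold smoothSign
  rw [← mul_div_assoc, le_div_iff₀ (sqrt_pos_aux hζ t)]
  have h1 : √(t ^ 2 + ζ ^ 2) ≤ |t| + ζ := by
    rw [Real.sqrt_le_left (by positivity)]
    nlinarith [abs_nonneg t, sq_abs t]
  rcases le_total (|t| - ζ) 0 with h | h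
  · nlinarith [sqrt_pos_aux hζ t, mul_self_nonneg t]
  · nlinarith [sq_abs t]

lemma mul_smoothSign_nonneg (ζ t : ℝ) : 0 ≤ t * smoothSign ζ t := by
  unfold smoothSign
  rw [← mul_div_assoc]
  exact div_nonneg (mul_self_nonneg t) (Real.sqrt_nonneg _)

lemma contDiff_smoothSign {ζ : ℝ} (hζ : 0 < ζ) : ContDiff ℝ 1 (smoothSign ζ) := by
  unfold smoothSign
  refine contDiff_id.div (ContDiff.sqrt (by fun_prop) fun t => by positivity)
    fun t => (sqrt_pos_aux hζ t).ne'

lemma hasDerivAt_sqrt_aux {ζ : ℝ} (hζ : 0 < ζ) (t : ℝ) :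
    HasDerivAt (fun t => √(t ^ 2 + ζ ^ 2)) (smoothSign ζ t) t := by
  have h : HasDerivAt (fun t : ℝ => t ^ 2 + ζ ^ 2) (2 * t) t := by
    simpa using (hasDerivAt_pow 2 t).add_const (ζ ^ 2)
  have := h.sqrt (by positivity)
  convert! this using 1
  unfold smoothSign
  rw [mul_div_mul_left _ _ two_ne_zero]

/-! ### Integrals bounded by the total variation. -/

/-- A smooth cutoff function for a compact subset of an open set. -/
lemma exists_cutoff {K U : Set (𝔼 n)} (hK : IsCompact K) (hU : IsOpen U) (h : K ⊆ U) :
    ∃ χ : (𝔼 n) → ℝ, ContDiff ℝ 1 χ ∧ HasCompactSupport χ ∧ tsupport χ ⊆ U ∧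
      (∀ x, 0 ≤ χ x ∧ χ x ≤ 1) ∧ ∀ x ∈ K, χ x = 1 := by
  obtain ⟨K', hK', hKK', hK'U⟩ := exists_compact_between hK hU h
  obtain ⟨f, hf, hr, h0, h1⟩ := exists_contMDiff_zero_iff_one_iff_of_isClosed
    (modelWithCornersSelf ℝ (𝔼 n)) (n := 1) (s := (interior K')ᶜ) (t := K) isOpen_interior.isClosed_compl
    hK.isClosed (disjoint_compl_left_iff_subset.2 hKK')
  have hsupp : tsupport f ⊆ K' := by
    refine closure_minimal (fun x hx => ?_) hK'.isClosed
    by_contra hxK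
    exact hx ((h0 x).1 fun hi => hxK (interior_subset hi))
  exact ⟨f, hf.contDiff, hK'.of_isClosed_subset (isClosed_tsupport f) hsupp, hsupp.trans hK'U,
    fun x => hr ⟨x, rfl⟩, fun x hx => (h1 x).1 hx⟩

/-- The field `-χ · smoothSign ζ (∂ₑ q) • e` almost realises the integral of `|∂ₑ q|` over `K`. Two
derivatives of `q` are needed for this field to be `C¹`. -/
lemma lintegral_abs_fderiv_le_variation {q : (𝔼 n) → ℝ} (hq : ContDiff ℝ 2 q) {K U : Set (𝔼 n)}
    (hK : IsCompact K) (hU : IsOpen U) (h : K ⊆ U) {e : 𝔼 n} (he : ‖e‖ = 1) :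
    ∫⁻ x in K, ENNReal.ofReal |fderiv ℝ q x e| ≤ variation q U := by
  by_cases hfin : variation q U = ∞
  · simp [hfin]
  obtain ⟨χ, hχ, hχc, hχU, hχ01, hχ1⟩ := exists_cutoff hK hU h
  have hq1 : ContDiff ℝ 1 q := hq.of_le (by norm_num)
  have hdq : ContDiff ℝ 1 fun x => fderiv ℝ q x e :=
    (hq.fderiv_right (m := 1) (by norm_num)).clm_apply contDiff_const
  have hint : IntegrableOn (fun x => |fderiv ℝ q x e|) K :=
    hdq.continuous.abs.continuousOn.integrableOn_compact hK
  rw [← ofReal_integral_eq_lintegral_ofReal hint (Eventually.of_forall fun x => abs_nonneg _),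
    ENNReal.ofReal_le_iff_le_toReal hfin]
  have key : ∀ ζ : ℝ, 0 < ζ → ∫ x in K, |fderiv ℝ q x e|
      ≤ (variation q U).toReal + ζ * (volume.real K) := by
    intro ζ hζ
    set F : (𝔼 n) → ℝ := fun x => -(χ x * smoothSign ζ (fderiv ℝ q x e)) with hF
    have hFd : ContDiff ℝ 1 F := (hχ.mul ((contDiff_smoothSign hζ).comp hdq)).neg
    have hts : tsupport (fun x => F x • e) ⊆ tsupport χ := by
      refine closure_mono fun x hx => ?_
      intro h0
      apply hx
      simp [hF, h0]
    have hg : IsUnitField U (fun x => F x • e) := by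
      refine ⟨hFd.smul contDiff_const, hχc.of_isClosed_subset (isClosed_tsupport _) hts, hts.trans hχU, fun x => ?_⟩
      rw [norm_smul, he, mul_one, Real.norm_eq_abs, hF, abs_neg, abs_mul, abs_of_nonneg (hχ01 x).1]
      exact mul_le_one₀ (hχ01 x).2 (abs_nonneg _) (abs_smoothSign_le hζ _)
    have h1 := integral_le_variation hfin hg
    rw [integral_mul_divergence_eq hq1 hg.contDiff hg.hasCompactSupport, ← integral_neg] at h1
    have h2 : ∀ x, -(fderiv ℝ q x (F x • e))
        = χ x * (fderiv ℝ q x e * smoothSign ζ (fderiv ℝ q x e)) := by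
      intro x; rw [map_smul, hF]; simp only [smul_eq_mul]; ring
    simp_rw [h2] at h1
    have hi2 : Integrable fun x => χ x * (fderiv ℝ q x e * smoothSign ζ (fderiv ℝ q x e)) :=
      ((hχ.continuous.mul (hdq.continuous.mul
        ((contDiff_smoothSign hζ).continuous.comp hdq.continuous)))).integrable_of_hasCompactSupport
        hχc.mul_right
    have h3 : ∫ x in K, (|fderiv ℝ q x e| - ζ)
        ≤ ∫ x in K, χ x * (fderiv ℝ q x e * smoothSign ζ (fderiv ℝ q x e)) := by
      refine setIntegral_mono_on (hint.sub (integrableOn_const hK.measure_lt_top.ne)) hi2.integrableOn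
        hK.measurableSet fun x hx => ?_
      rw [hχ1 x hx, one_mul]
      exact abs_sub_le_mul_smoothSign hζ _
    have h4 := setIntegral_le_integral (s := K) hi2
      (Eventually.of_forall fun x => mul_nonneg (hχ01 x).1 (mul_smoothSign_nonneg ζ _))
    rw [integral_sub hint (integrableOn_const hK.measure_lt_top.ne), setIntegral_const, smul_eq_mul] at h3
    linarith
  refine le_of_forall_pos_le_add fun ε hε => ?_
  have hv : 0 ≤ volume.real K := measureReal_nonneg
  have := key (ε / (volume.real K + 1)) (by positivity)
  refine this.trans (add_le_add_right ?_ _)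
  rw [div_mul_eq_mul_div, div_le_iff₀ (by positivity)]
  nlinarith

/-- Since `∇√(q² + ζ²) = smoothSign ζ q · ∇q`, testing `√(q² + ζ²)` with `g` is the same as testing
`q` with the field `smoothSign ζ q • g`, which is again admissible. Then `ζ → 0`. -/
lemma ofReal_integral_abs_mul_divergence_le {q : (𝔼 n) → ℝ} (hq : ContDiff ℝ 1 q)
    {U : Set (𝔼 n)} {g : (𝔼 n) → 𝔼 n} (hg : IsUnitField U g) :
    ENNReal.ofReal (∫ x, |q x| * divergence g x) ≤ variation q U := by
  by_cases hfin : variation q U = ∞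
  · simp [hfin]
  rw [ENNReal.ofReal_le_iff_le_toReal hfin]
  have hdi : Integrable fun x => |divergence g x| :=
    ((continuous_divergence hg.contDiff).integrable_of_hasCompactSupport
      (hasCompactSupport_divergence hg.hasCompactSupport)).abs
  have key : ∀ ζ : ℝ, 0 < ζ → ∫ x, |q x| * divergence g x
      ≤ (variation q U).toReal + ζ * ∫ x, |divergence g x| := by
    intro ζ hζ
    have hG : ContDiff ℝ 1 fun x => √(q x ^ 2 + ζ ^ 2) :=
      ContDiff.sqrt (by fun_prop) fun x => by positivity
    have hs : ContDiff ℝ 1 fun x => smoothSign ζ (q x) := (contDiff_smoothSign hζ).comp hq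
    have hgs : IsUnitField U fun x => smoothSign ζ (q x) • g x := by
      have hts : tsupport (fun x => smoothSign ζ (q x) • g x) ⊆ tsupport g := by
        refine closure_mono fun x hx => ?_
        intro h0
        apply hx
        simp only [h0, smul_zero]
      refine ⟨hs.smul hg.contDiff, hg.hasCompactSupport.of_isClosed_subset (isClosed_tsupport _) hts,
        hts.trans hg.tsupport_subset, fun x => ?_⟩
      rw [norm_smul, Real.norm_eq_abs]
      exact mul_le_one₀ (abs_smoothSign_le hζ _) (norm_nonneg _) (hg.norm_le_one x)
    have h1 := integral_le_variation hfin hgs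
    rw [integral_mul_divergence_eq hq hgs.contDiff hgs.hasCompactSupport] at h1
    have e : ∀ x, fderiv ℝ q x (smoothSign ζ (q x) • g x)
        = fderiv ℝ (fun x => √(q x ^ 2 + ζ ^ 2)) x (g x) := by
      intro x
      have := (hasDerivAt_sqrt_aux hζ (q x)).comp_hasFDerivAt x
        (hq.differentiable one_ne_zero x).hasFDerivAt
      have h' : fderiv ℝ (fun x => √(q x ^ 2 + ζ ^ 2)) x = smoothSign ζ (q x) • fderiv ℝ q x :=
        this.fderiv
      rw [h', map_smul]
      simp
    simp_rw [e] at h1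
    rw [← integral_mul_divergence_eq hG hg.contDiff hg.hasCompactSupport] at h1
    have i1 := integrable_mul_divergence hG.continuous.locallyIntegrable hg.contDiff
      hg.hasCompactSupport
    have i2 := integrable_mul_divergence hq.continuous.abs.locallyIntegrable hg.contDiff
      hg.hasCompactSupport
    have h2 : ∫ x, |q x| * divergence g x
        ≤ ∫ x, (√(q x ^ 2 + ζ ^ 2) * divergence g x + ζ * |divergence g x|) := by
      refine integral_mono i2 (i1.add (hdi.const_mul ζ)) fun x => ?_
      have l1 : |q x| ≤ √(q x ^ 2 + ζ ^ 2) := Real.abs_le_sqrt (by nlinarith)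
      have l2 : √(q x ^ 2 + ζ ^ 2) ≤ |q x| + ζ := by
        rw [Real.sqrt_le_left (by positivity)]
        nlinarith [abs_nonneg (q x), sq_abs (q x)]
      simp only
      rcases abs_cases (divergence g x) with ⟨h, h'⟩ | ⟨h, h'⟩ <;> rw [h] <;> nlinarith
    rw [integral_add i1 (hdi.const_mul ζ), integral_const_mul] at h2
    linarith
  refine le_of_forall_pos_le_add fun ε hε => ?_
  have hv : 0 ≤ ∫ x, |divergence g x| := integral_nonneg fun x => abs_nonneg _
  have := key (ε / ((∫ x, |divergence g x|) + 1)) (by positivity)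
  refine this.trans (add_le_add_right ?_ _)
  rw [div_mul_eq_mul_div, div_le_iff₀ (by positivity)]
  nlinarith

/-- If `f ≤ div g + C` for an admissible field `g`, then `∫ f |w| ≤ ∫_U |Dw| + C ∫ |w|`. -/
lemma lintegral_mul_abs_le_variation {w : (𝔼 n) → ℝ} (hw : Integrable w) {U : Set (𝔼 n)}
    (hU : IsOpen U) {g : (𝔼 n) → 𝔼 n} (hg : IsUnitField U g) {f : (𝔼 n) → ℝ} (hf : Measurable f)
    (hf0 : ∀ x, 0 ≤ f x) {C : ℝ} (hC : 0 ≤ C) (h : ∀ x, f x ≤ divergence g x + C) :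
    ∫⁻ x, ENNReal.ofReal (f x * |w x|) ≤ variation w U + ENNReal.ofReal (C * ∫ x, |w x|) := by
  set q : ℕ → (𝔼 n) → ℝ := fun k => mollify (bumpSeq n k) w
  have hqd : ∀ k, ContDiff ℝ 1 (q k) := fun k => contDiff_mollify _ hw.locallyIntegrable 1
  have hqi : ∀ k, Integrable (q k) := fun k => integrable_mollify _ hw
  have hbound : ∀ᶠ k in atTop, ∫⁻ x, ENNReal.ofReal (f x * |q k x|)
      ≤ variation w U + ENNReal.ofReal (C * ∫ x, |w x|) := by
    filter_upwards [eventually_closedBall_bumpSeq_subset hg.hasCompactSupport hU hg.tsupport_subset]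
      with k hk
    have i1 := integrable_mul_divergence (hqd k).continuous.abs.locallyIntegrable hg.contDiff
      hg.hasCompactSupport
    have i2 : Integrable fun x => |q k x| * divergence g x + C * |q k x| :=
      i1.add ((hqi k).abs.const_mul C)
    have hle : ∀ x, f x * |q k x| ≤ |q k x| * divergence g x + C * |q k x| := fun x => by
      nlinarith [h x, abs_nonneg (q k x)]
    calc ∫⁻ x, ENNReal.ofReal (f x * |q k x|)
        ≤ ∫⁻ x, ENNReal.ofReal (|q k x| * divergence g x + C * |q k x|) :=
          lintegral_mono fun x => ENNReal.ofReal_le_ofReal (hle x)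
      _ = ENNReal.ofReal (∫ x, (|q k x| * divergence g x + C * |q k x|)) :=
          (ofReal_integral_eq_lintegral_ofReal i2 (Eventually.of_forall fun x =>
            (mul_nonneg (hf0 x) (abs_nonneg _)).trans (hle x))).symm
      _ = ENNReal.ofReal ((∫ x, |q k x| * divergence g x) + C * ∫ x, |q k x|) := by
          rw [integral_add i1 ((hqi k).abs.const_mul C), integral_const_mul]
      _ ≤ ENNReal.ofReal (∫ x, |q k x| * divergence g x) + ENNReal.ofReal (C * ∫ x, |q k x|) :=
          ENNReal.ofReal_add_le
      _ ≤ _ := by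
          refine add_le_add ?_ (ENNReal.ofReal_le_ofReal
            (mul_le_mul_of_nonneg_left (integral_abs_mollify_le _ hw) hC))
          -- The variation of the mollified function is only needed on the compact set `tsupport g`.
          -- This leaves room inside `U` for the mollification radius.
          refine (ofReal_integral_abs_mul_divergence_le (hqd k) (U := tsupport g)
            ⟨hg.contDiff, hg.hasCompactSupport, subset_rfl, hg.norm_le_one⟩).trans ?_
          exact variation_mollify_le _ hw hk
  have hlim : ∀ᵐ x, ENNReal.ofReal (f x * |w x|)
      = liminf (fun k => ENNReal.ofReal (f x * |q k x|)) atTop := by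
    filter_upwards [ae_tendsto_mollify hw.locallyIntegrable] with x hx
    exact ((ENNReal.tendsto_ofReal ((hx.abs).const_mul (f x))).liminf_eq).symm
  rw [lintegral_congr_ae hlim]
  refine (lintegral_liminf_le fun k => ?_).trans ?_
  · exact (hf.mul (hqd k).continuous.abs.measurable).ennreal_ofReal
  · refine liminf_le_of_frequently_le' hbound.frequently

/-! ### Graph coordinates over a hyperplane. -/

/-- The hyperplane orthogonal to `e`. -/
abbrev Hyper (e : 𝔼 n) : Submodule ℝ (𝔼 n) := (Submodule.span ℝ {e})ᗮ

lemma inner_hyper (e : 𝔼 n) (y : Hyper e) : ⟪e, (y : 𝔼 n)⟫ = 0 :=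
  Submodule.mem_orthogonal_singleton_iff_inner_right.1 y.2

lemma sub_inner_smul_mem_hyper {e : 𝔼 n} (he : ‖e‖ = 1) (x : 𝔼 n) : x - ⟪e, x⟫ • e ∈ Hyper e := by
  rw [Submodule.mem_orthogonal_singleton_iff_inner_right, inner_sub_right, inner_smul_right,
    real_inner_self_eq_norm_sq, he]
  ring

/-- The orthogonal projection onto the hyperplane orthogonal to the unit vector `e`. -/
def hyperProj {e : 𝔼 n} (he : ‖e‖ = 1) (x : 𝔼 n) : Hyper e :=
  ⟨x - ⟪e, x⟫ • e, sub_inner_smul_mem_hyper he x⟩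

lemma norm_sub_inner_smul_le {e : 𝔼 n} (he : ‖e‖ = 1) (x : 𝔼 n) : ‖x - ⟪e, x⟫ • e‖ ≤ ‖x‖ := by
  have h : ‖x - ⟪e, x⟫ • e‖ ^ 2 = ‖x‖ ^ 2 - ⟪e, x⟫ ^ 2 := by
    rw [norm_sub_sq_real, inner_smul_right, norm_smul, he, real_inner_comm, Real.norm_eq_abs,
      mul_one, sq_abs]
    ring
  have := sq_nonneg (⟪e, x⟫)
  exact (sq_le_sq₀ (norm_nonneg _) (norm_nonneg _)).1 (by linarith)

lemma dist_hyperProj_le {e : 𝔼 n} (he : ‖e‖ = 1) (x y : 𝔼 n) :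
    dist (hyperProj he x) (hyperProj he y) ≤ dist x y := by
  rw [Subtype.dist_eq, dist_eq_norm, dist_eq_norm]
  refine le_trans (le_of_eq ?_) (norm_sub_inner_smul_le he (x - y))
  congr 1
  simp only [hyperProj, inner_sub_right, sub_smul]
  abel

lemma continuous_hyperProj {e : 𝔼 n} (he : ‖e‖ = 1) : Continuous (hyperProj he) :=
  (LipschitzWith.of_dist_le_mul (K := 1) fun x y => by
    simpa using dist_hyperProj_le he x y).continuous

lemma hyperProj_add_smul {e : 𝔼 n} (he : ‖e‖ = 1) (y : Hyper e) (t : ℝ) :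
    hyperProj he ((y : 𝔼 n) + t • e) = y := by
  apply Subtype.ext
  simp [hyperProj, inner_add_right, inner_hyper, inner_smul_right, he]

/-- Coordinates adapted to the graph of `ψ` in direction `e`. -/
def graphHomeo {e : 𝔼 n} (he : ‖e‖ = 1) {ψ : Hyper e → ℝ} (hψ : Continuous ψ) :
    (Hyper e × ℝ) ≃ₜ 𝔼 n where
  toFun p := (p.1 : 𝔼 n) + (ψ p.1 + p.2) • e
  invFun x := (hyperProj he x, ⟪e, x⟫ - ψ (hyperProj he x))
  left_inv p := by
    simp only [hyperProj_add_smul]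
    simp [inner_add_right, inner_hyper, inner_smul_right, he]
  right_inv x := by
    simp [hyperProj]
  continuous_toFun := by fun_prop
  continuous_invFun := by
    have := continuous_hyperProj he
    fun_prop

section graph

variable {e : 𝔼 n} {ψ : Hyper e → ℝ}

lemma graphHomeo_apply (he : ‖e‖ = 1) (hψ : Continuous ψ) (p : Hyper e × ℝ) :
    graphHomeo he hψ p = (p.1 : 𝔼 n) + (ψ p.1 + p.2) • e := rfl

lemma graphHomeo_eq_add (he : ‖e‖ = 1) (hψ : Continuous ψ) (y : Hyper e) (t : ℝ) :
    graphHomeo he hψ (y, t) = graphHomeo he hψ (y, 0) + t • e := by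
  simp only [graphHomeo_apply]
  module

lemma finrank_hyper (he : ‖e‖ = 1) : Module.finrank ℝ (Hyper e) = n - 1 := by
  have h := Submodule.finrank_add_finrank_orthogonal (Submodule.span ℝ {e})
  rw [finrank_span_singleton (by rintro rfl; simp at he), finrank_euclideanSpace_fin] at h
  change Module.finrank ℝ ↥(Submodule.span ℝ {e})ᗮ = n - 1
  omega

/-- Lebesgue measure splits along the orthogonal decomposition into the line of `e` and its
complement; the line is identified isometrically with `ℝ` because `e` is a unit vector. -/
lemma measurePreserving_hyper (he : ‖e‖ = 1) :
    MeasurePreserving (fun p : Hyper e × ℝ => (p.1 : 𝔼 n) + p.2 • e)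
      (volume.prod volume) volume := by
  have h1 := (Submodule.measurePreserving_measurableEquivProd (V := 𝔼 n) (P := 𝔼 n)
    (Submodule.span ℝ {e}) 0).symm
  rw [InnerProductSpace.euclideanHausdorffMeasure_eq_volume] at h1
  have h2 : MeasurePreserving (LinearIsometryEquiv.toSpanUnitSingleton (𝕜 := ℝ) e he) :=
    (LinearIsometryEquiv.toSpanUnitSingleton (𝕜 := ℝ) e he).measurePreserving
  have h3 : MeasurePreserving (Prod.map (LinearIsometryEquiv.toSpanUnitSingleton (𝕜 := ℝ) e he)
      (id : Hyper e → Hyper e)) (volume.prod volume) (volume.prod volume) :=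
    h2.prod (MeasurePreserving.id _)
  have h4 := (h1.comp h3).comp (Measure.measurePreserving_swap (μ := (volume : Measure (Hyper e)))
    (ν := (volume : Measure ℝ)))
  suffices h : (fun p : Hyper e × ℝ => (p.1 : 𝔼 n) + p.2 • e)
      = (((Submodule.span ℝ {e}).measurableEquivProd (0 : 𝔼 n)).symm ∘
        Prod.map (LinearIsometryEquiv.toSpanUnitSingleton (𝕜 := ℝ) e he) id) ∘ Prod.swap by
    rw [h]; exact h4
  ext1 p
  rw [Function.comp_apply, Function.comp_apply, Submodule.measurableEquivProd_symm_apply]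
  simp [add_comm]

/-- The graph coordinates are a shear: each fibre is merely translated by `ψ y`. Hence no Jacobian
appears and continuity of `ψ` suffices. -/
lemma measurePreserving_graphHomeo (he : ‖e‖ = 1) (hψ : Continuous ψ) :
    MeasurePreserving (graphHomeo he hψ) (volume.prod volume) volume := by
  have h1 : MeasurePreserving (fun p : Hyper e × ℝ => (p.1, ψ p.1 + p.2))
      (volume.prod volume) (volume.prod volume) := by
    refine MeasurePreserving.skew_product (f := id) (g := fun y t => ψ y + t)
      (MeasurePreserving.id _) ?_ ?_
    · exact (hψ.measurable.comp measurable_fst).add measurable_snd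
    · exact Eventually.of_forall fun y => map_add_left_eq_self _ _
  exact (measurePreserving_hyper he).comp h1

lemma measurableEmbedding_graphHomeo (he : ‖e‖ = 1) (hψ : Continuous ψ) : MeasurableEmbedding (graphHomeo he hψ) :=
  (graphHomeo he hψ).measurableEmbedding

lemma lipschitzWith_graph (he : ‖e‖ = 1) (hψ : Continuous ψ) {L : ℝ≥0} (hL : LipschitzWith L ψ) :
    LipschitzWith (1 + L) (fun y : Hyper e => graphHomeo he hψ (y, 0)) := by
  refine LipschitzWith.of_dist_le_mul fun y z => ?_
  simp only [graphHomeo_apply, add_zero]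
  have h1 : dist ((y : 𝔼 n) + ψ y • e) ((z : 𝔼 n) + ψ z • e)
      ≤ dist (y : 𝔼 n) z + dist (ψ y • e) (ψ z • e) := dist_add_add_le _ _ _ _
  have h2 : dist (ψ y • e) (ψ z • e) ≤ L * dist y z := by
    rw [dist_eq_norm, ← sub_smul, norm_smul, he, mul_one, ← dist_eq_norm]
    exact hL.dist_le_mul y z
  rw [Subtype.dist_eq] at *
  push_cast
  linarith

lemma euclideanHausdorffMeasure_image_le_of_lipschitzWith {X Y : Type*} [MetricSpace X]
    [MeasurableSpace X] [BorelSpace X] [MetricSpace Y] [MeasurableSpace Y] [BorelSpace Y]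
    {K : ℝ≥0} {f : X → Y} (hf : LipschitzWith K f) (d : ℕ) (s : Set X) :
    μHE[d] (f '' s) ≤ (K : ℝ≥0∞) ^ d * μHE[d] s := by
  have := hf.hausdorffMeasure_image_le (d := d) (by positivity) s
  rw [Measure.euclideanHausdorffMeasure_def, Measure.euclideanHausdorffMeasure_def,
    Measure.smul_apply, Measure.smul_apply, ENNReal.smul_def, ENNReal.smul_def, smul_eq_mul,
    smul_eq_mul, mul_left_comm]
  gcongr
  simpa using this

/-- The surface measure of a piece of a Lipschitz graph is controlled by the measure of its
projection. -/
lemma euclideanHausdorffMeasure_graph_le (he : ‖e‖ = 1) (hψ : Continuous ψ) {L : ℝ≥0} (hL : LipschitzWith L ψ) (s : Set (Hyper e)) :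
    μHE[n - 1] ((fun y : Hyper e => graphHomeo he hψ (y, 0)) '' s)
      ≤ ((1 + L : ℝ≥0) : ℝ≥0∞) ^ (n - 1) * volume s := by
  have h := euclideanHausdorffMeasure_image_le_of_lipschitzWith (lipschitzWith_graph he hψ hL)
    (n - 1) s
  -- The hyperplane has dimension `n - 1`, so its normalised Hausdorff measure is Lebesgue measure,
  -- with no extra constant.
  have e1 : (μHE[n - 1] : Measure (Hyper e)) = volume := by
    rw [← finrank_hyper he, InnerProductSpace.euclideanHausdorffMeasure_eq_volume]
  rwa [e1] at h

end graph

/-! ### Slices parallel to a graph. -/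

section slices

variable {e : 𝔼 n} {ψ : Hyper e → ℝ}

/-- Heights `t` at which the slice of `w` over the hyperplane is integrable and is the a.e. limit of
the slices of its mollifications. -/
def IsGoodHeight (he : ‖e‖ = 1) (hψ : Continuous ψ) (w : (𝔼 n) → ℝ) (t : ℝ) : Prop :=
  Integrable (fun y => w (graphHomeo he hψ (y, t))) ∧
  ∀ᵐ y, Tendsto (fun k => mollify (bumpSeq n k) w (graphHomeo he hψ (y, t))) atTop
    (𝓝 (w (graphHomeo he hψ (y, t))))

/-- Fubini in graph coordinates, with the factors swapped so that the statement holds for almost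
every height. -/
lemma ae_isGoodHeight (he : ‖e‖ = 1) (hψ : Continuous ψ) {w : (𝔼 n) → ℝ} (hw : Integrable w) :
    ∀ᵐ t, IsGoodHeight he hψ w t := by
  have hΦ := (measurePreserving_graphHomeo he hψ).comp
    (Measure.measurePreserving_swap (μ := (volume : Measure ℝ)) (ν := (volume : Measure (Hyper e))))
  have h1 := Measure.ae_ae_of_ae_prod
    (hΦ.quasiMeasurePreserving.ae (ae_tendsto_mollify hw.locallyIntegrable))
  have h2 : Integrable (fun p : ℝ × Hyper e => w (graphHomeo he hψ (p.2, p.1)))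
      (volume.prod volume) := hΦ.integrable_comp_of_integrable hw
  filter_upwards [h1, h2.prod_right_ae] with t ht1 ht2
  exact ⟨ht2, ht1⟩

lemma isOpen_image_graphHomeo (he : ‖e‖ = 1) (hψ : Continuous ψ) {O : Set (Hyper e)}
    (hO : IsOpen O) (s : ℝ) : IsOpen (graphHomeo he hψ '' (O ×ˢ Ioo 0 s)) :=
  (graphHomeo he hψ).isOpenMap _ (hO.prod isOpen_Ioo)

lemma enorm_sub_le_lintegral_fderiv {q : (𝔼 n) → ℝ} (hq : ContDiff ℝ 1 q) (x e : 𝔼 n) {a b : ℝ}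
    (hab : a ≤ b) : ‖q (x + a • e) - q (x + b • e)‖ₑ
      ≤ ∫⁻ τ in Ioc a b, ENNReal.ofReal |fderiv ℝ q (x + τ • e) e| := by
  have hd : ∀ τ ∈ uIcc a b, HasDerivAt (fun τ : ℝ => q (x + τ • e)) (fderiv ℝ q (x + τ • e) e) τ := by
    intro τ _
    have h1 : HasDerivAt (fun τ : ℝ => x + τ • e) e τ := by
      simpa using ((hasDerivAt_id τ).smul_const e).const_add x
    exact (hq.differentiable one_ne_zero _).hasFDerivAt.comp_hasDerivAt τ h1
  have hc : Continuous fun τ : ℝ => fderiv ℝ q (x + τ • e) e :=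
    ((hq.continuous_fderiv one_ne_zero).comp (by fun_prop)).clm_apply continuous_const
  have h := intervalIntegral.integral_eq_sub_of_hasDerivAt hd (hc.intervalIntegrable _ _)
  rw [← enorm_neg, neg_sub, ← h, intervalIntegral.integral_of_le hab]
  refine (enorm_integral_le_lintegral_enorm _).trans (le_of_eq ?_)
  congr 1; ext τ
  rw [← ofReal_norm, Real.norm_eq_abs]

/-- For smooth functions the difference of two slices is the integral of the derivative in direction
`e`, and Tonelli turns its `L¹` norm into an integral of `|∂ₑ q|` over the region in between. Good
heights are those at which Fatou carries this over from the mollifications to `w`. Compactness of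
`C` keeps the region at positive distance from the complement of the cylinder. -/
lemma lintegral_slice_sub_le_of_isCompact (he : ‖e‖ = 1) (hψ : Continuous ψ) {w : (𝔼 n) → ℝ}
    (hw : Integrable w) {O : Set (Hyper e)} (hO : IsOpen O) {C : Set (Hyper e)} (hC : IsCompact C)
    (hCO : C ⊆ O) {s t t' : ℝ} (ht0 : 0 < t) (htt : t ≤ t') (hts : t' < s)
    (hgt : IsGoodHeight he hψ w t) (hgt' : IsGoodHeight he hψ w t') :
    ∫⁻ y in C, ‖w (graphHomeo he hψ (y, t)) - w (graphHomeo he hψ (y, t'))‖ₑ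
      ≤ variation w (graphHomeo he hψ '' (O ×ˢ Ioo 0 s)) := by
  set Φ := graphHomeo he hψ
  set W := Φ '' (O ×ˢ Ioo 0 s)
  set q : ℕ → (𝔼 n) → ℝ := fun k => mollify (bumpSeq n k) w
  have hK : IsCompact (Φ '' (C ×ˢ Icc t t')) := (hC.prod isCompact_Icc).image Φ.continuous
  have hKW : Φ '' (C ×ˢ Icc t t') ⊆ W :=
    image_mono (prod_mono hCO fun τ hτ => ⟨ht0.trans_le hτ.1, hτ.2.trans_lt hts⟩)
  have hW : IsOpen W := isOpen_image_graphHomeo he hψ hO s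
  -- `K'` serves two purposes: its interior is the open neighbourhood required by the derivative
  -- estimate, and its compactness gives a uniform mollification radius within `W`.
  obtain ⟨K', hK', hKK', hK'W⟩ := exists_compact_between hK hW hKW
  have hbound : ∀ᶠ k in atTop, ∫⁻ y in C, ‖q k (Φ (y, t)) - q k (Φ (y, t'))‖ₑ ≤ variation w W := by
    filter_upwards [eventually_closedBall_bumpSeq_subset hK' hW hK'W] with k hk
    have hq2 : ContDiff ℝ 2 (q k) := contDiff_mollify _ hw.locallyIntegrable 2
    have hq1 : ContDiff ℝ 1 (q k) := hq2.of_le (by norm_num)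
    have hm : Measurable fun x => ENNReal.ofReal |fderiv ℝ (q k) x e| :=
      (((hq1.continuous_fderiv one_ne_zero).clm_apply continuous_const).abs.measurable).ennreal_ofReal
    calc ∫⁻ y in C, ‖q k (Φ (y, t)) - q k (Φ (y, t'))‖ₑ
        ≤ ∫⁻ y in C, ∫⁻ τ in Ioc t t', ENNReal.ofReal |fderiv ℝ (q k) (Φ (y, τ)) e| := by
          refine lintegral_mono fun y => ?_
          have := enorm_sub_le_lintegral_fderiv hq1 (Φ (y, 0)) e htt
          simpa only [Φ, ← graphHomeo_eq_add] using this
      _ = ∫⁻ p in C ×ˢ Ioc t t', ENNReal.ofReal |fderiv ℝ (q k) (Φ p) e| ∂(volume.prod volume) := by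
          rw [← Measure.prod_restrict]
          exact (lintegral_prod (fun p => ENNReal.ofReal |fderiv ℝ (q k) (Φ p) e|)
            (hm.comp Φ.measurable).aemeasurable).symm
      _ ≤ ∫⁻ p in C ×ˢ Icc t t', ENNReal.ofReal |fderiv ℝ (q k) (Φ p) e| ∂(volume.prod volume) :=
          lintegral_mono_set (prod_mono subset_rfl Ioc_subset_Icc_self)
      _ = ∫⁻ x in Φ '' (C ×ˢ Icc t t'), ENNReal.ofReal |fderiv ℝ (q k) x e| := by
          exact (measurePreserving_graphHomeo he hψ).setLIntegral_comp_emb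
            (measurableEmbedding_graphHomeo he hψ) (fun x => ENNReal.ofReal |fderiv ℝ (q k) x e|) _
      _ ≤ variation (q k) (interior K') :=
          lintegral_abs_fderiv_le_variation hq2 hK isOpen_interior hKK' he
      _ ≤ variation w W :=
          variation_mollify_le _ hw fun x hx => hk x (interior_subset hx)
  have hlim : ∀ᵐ y ∂(volume.restrict C), ‖w (Φ (y, t)) - w (Φ (y, t'))‖ₑ
      = liminf (fun k => ‖q k (Φ (y, t)) - q k (Φ (y, t'))‖ₑ) atTop := by
    filter_upwards [ae_restrict_of_ae hgt.2, ae_restrict_of_ae hgt'.2] with y h1 h2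
    exact ((h1.sub h2).enorm.liminf_eq).symm
  rw [lintegral_congr_ae hlim]
  refine (lintegral_liminf_le fun k => ?_).trans (liminf_le_of_frequently_le' hbound.frequently)
  have hc : Continuous (q k) := (contDiff_mollify _ hw.locallyIntegrable 0).continuous
  have hc1 : Continuous fun y : Hyper e => q k (Φ (y, t)) := hc.comp (Φ.continuous.comp (by fun_prop))
  have hc2 : Continuous fun y : Hyper e => q k (Φ (y, t')) := hc.comp (Φ.continuous.comp (by fun_prop))
  exact (hc1.sub hc2).enorm.measurable

/-- The `L¹` distance of two slices is controlled by the variation in between. -/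
lemma lintegral_slice_sub_le (he : ‖e‖ = 1) (hψ : Continuous ψ) {w : (𝔼 n) → ℝ}
    (hw : Integrable w) {O : Set (Hyper e)} (hO : IsOpen O) {s t t' : ℝ} (ht : t ∈ Ioo 0 s)
    (ht' : t' ∈ Ioo 0 s) (hgt : IsGoodHeight he hψ w t) (hgt' : IsGoodHeight he hψ w t') :
    ∫⁻ y in O, ‖w (graphHomeo he hψ (y, t)) - w (graphHomeo he hψ (y, t'))‖ₑ
      ≤ variation w (graphHomeo he hψ '' (O ×ˢ Ioo 0 s)) := by
  wlog htt : t ≤ t' generalizing t t'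
  · have := this ht' ht hgt' hgt (le_of_not_ge htt)
    simpa only [← enorm_neg (w (graphHomeo he hψ (_, t)) - _), neg_sub] using this
  have : LocallyCompactSpace O := IsOpen.locallyCompactSpace hO
  obtain ⟨K, hK, hKO⟩ : IsSigmaCompact O := isSigmaCompact_iff_sigmaCompactSpace.2 inferInstance
  have hKO' : ⋃ k, accumulate K k = O := iUnion_accumulate.trans hKO
  have main : ∀ k, ∫⁻ y in accumulate K k, ‖w (graphHomeo he hψ (y, t)) - w (graphHomeo he hψ (y, t'))‖ₑ
      ≤ variation w (graphHomeo he hψ '' (O ×ˢ Ioo 0 s)) := fun k =>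
    lintegral_slice_sub_le_of_isCompact he hψ hw hO (isCompact_accumulate hK k)
      ((subset_iUnion _ k).trans hKO'.subset) ht.1 htt ht'.2 hgt hgt'
  have h := setLIntegral_iUnion_of_directed (μ := volume)
    (fun y => ‖w (graphHomeo he hψ (y, t)) - w (graphHomeo he hψ (y, t'))‖ₑ)
    (monotone_accumulate (s := K)).directed_le
  rw [hKO'] at h
  rw [h]
  exact iSup_le main

end slices

/-! ### The vertical trace on a graph. -/

section verticalTrace

variable {e : 𝔼 n} {ψ : Hyper e → ℝ}

/-- The variation in a thin layer above the graph is small. -/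
lemma exists_variation_layer_le (he : ‖e‖ = 1) (hψ : Continuous ψ) {w : (𝔼 n) → ℝ}
    (hw : Integrable w) {O : Set (Hyper e)} {s : ℝ} (hs : 0 < s)
    (hfin : variation w (graphHomeo he hψ '' (O ×ˢ Ioo 0 s)) ≠ ∞) {ε : ℝ≥0∞} (hε : ε ≠ 0) :
    ∃ τ, 0 < τ ∧ τ ≤ s ∧ variation w (graphHomeo he hψ '' (O ×ˢ Ioo 0 τ)) ≤ ε := by
  obtain ⟨K, hK, hKs, hV⟩ := exists_isCompact_variation_le hw.locallyIntegrable hfin hε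
  set Φ := graphHomeo he hψ
  -- The heights over the graph of the points of `K` form a compact set of positive numbers, hence
  -- are bounded below by some `τ > 0`.
  set K' := (fun x => (Φ.symm x).2) '' K
  have hK' : IsCompact K' := hK.image (continuous_snd.comp Φ.symm.continuous)
  have hpos : ∀ t ∈ K', 0 < t := by
    rintro _ ⟨x, hx, rfl⟩
    obtain ⟨p, hp, rfl⟩ := hKs hx
    simpa using hp.2.1
  obtain ⟨τ, hτ0, hτ⟩ : ∃ τ, 0 < τ ∧ ∀ t ∈ K', τ ≤ t := by
    rcases K'.eq_empty_or_nonempty with h | h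
    · exact ⟨1, one_pos, by simp [h]⟩
    · obtain ⟨t, ht, hmin⟩ := hK'.exists_isLeast h
      exact ⟨t, hpos t ht, fun u hu => hmin hu⟩
  refine ⟨min τ s, lt_min hτ0 hs, min_le_right _ _, hV _ ?_ ?_⟩
  · exact image_mono (prod_mono subset_rfl (Ioo_subset_Ioo_right (min_le_right _ _)))
  · rw [Set.disjoint_left]
    rintro _ ⟨p, hp, rfl⟩ hpK
    have h1 : τ ≤ p.2 := hτ _ ⟨Φ p, hpK, by simp⟩
    have h2 := hp.2.2
    exact absurd (h2.trans_le (min_le_left _ _)) (not_lt.2 h1)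

/-- Existence of the vertical trace on a graph. -/
lemma exists_vertical_trace (he : ‖e‖ = 1) (hψ : Continuous ψ) {w : (𝔼 n) → ℝ}
    (hw : Integrable w) {O : Set (Hyper e)} (hO : IsOpen O) {s : ℝ} (hs : 0 < s)
    (hfin : variation w (graphHomeo he hψ '' (O ×ˢ Ioo 0 s)) ≠ ∞) :
    ∃ T : Hyper e → ℝ, IntegrableOn T O ∧ ∀ O' ⊆ O, IsOpen O' → ∀ τ, 0 < τ →
      ∀ t ∈ Ioo 0 τ, IsGoodHeight he hψ w t →
        ∫⁻ y in O', ‖w (graphHomeo he hψ (y, t)) - T y‖ₑ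
          ≤ variation w (graphHomeo he hψ '' (O' ×ˢ Ioo 0 τ)) := by
  set Φ := graphHomeo he hψ with hΦ
  set B : ℕ → ℝ≥0∞ := fun k => (2⁻¹ : ℝ≥0∞) ^ k with hB
  have hB0 : ∀ k, B k ≠ 0 := fun k => by simp [hB]
  -- Good heights are chosen in layers whose variation is less than `2⁻ᵏ`, so the corresponding
  -- slices form a Cauchy sequence in `L¹(O)` at a summable rate.
  have hex : ∀ k : ℕ, ∃ t : ℝ, ∃ r : ℝ, t ∈ Ioo 0 r ∧ r ≤ 1 / ((k : ℝ) + 1) ∧ IsGoodHeight he hψ w t ∧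
      variation w (Φ '' (O ×ˢ Ioo 0 r)) < B k := by
    intro k
    obtain ⟨r, hr0, hrs, hr⟩ := exists_variation_layer_le he hψ hw hs hfin
      (ε := B k / 2) (by simp [hB0 k])
    have hr1 : 0 < min r (1 / ((k : ℝ) + 1)) := lt_min hr0 (by positivity)
    obtain ⟨t, htm, htg⟩ : ∃ t ∈ Ioo 0 (min r (1 / ((k : ℝ) + 1))), IsGoodHeight he hψ w t := by
      have h1 : ∃ᵐ t ∂volume, t ∈ Ioo 0 (min r (1 / ((k : ℝ) + 1))) := by
        rw [frequently_ae_mem_iff, Real.volume_Ioo]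
        simpa using hr1
      obtain ⟨t, ht⟩ := (h1.and_eventually (ae_isGoodHeight he hψ hw)).exists
      exact ⟨t, ht⟩
    refine ⟨t, _, htm, min_le_right _ _, htg, ?_⟩
    refine lt_of_le_of_lt ((variation_mono (image_mono (prod_mono subset_rfl
      (Ioo_subset_Ioo_right (min_le_left _ _))))).trans hr) ?_
    exact ENNReal.half_lt_self (hB0 k) (by simp [hB])
  choose t r htr hr htg htV using hex
  have hmem : ∀ k, MemLp (fun y => w (Φ (y, t k))) 1 (volume.restrict O) := fun k =>
    (memLp_one_iff_integrable.2 (htg k).1).restrict O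
  have hsum : ∑' k, B k ≠ ∞ := by
    simp only [hB]
    rw [ENNReal.tsum_geometric]
    simp
  have hdist : ∀ N k m, N ≤ k → N ≤ m → eLpNorm ((fun y => w (Φ (y, t k))) - fun y => w (Φ (y, t m))) 1
      (volume.restrict O) < B N := by
    intro N k m hk hm
    rw [eLpNorm_one_eq_lintegral_enorm]
    have hBm : ∀ {k}, N ≤ k → B k ≤ B N := fun {k} h =>
      pow_le_pow_right_of_le_one' (by simp) h
    rcases le_total (r k) (r m) with h | h
    · exact (lintegral_slice_sub_le he hψ hw hO ⟨(htr k).1, (htr k).2.trans_le h⟩ (htr m)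
        (htg k) (htg m)).trans_lt ((htV m).trans_le (hBm hm))
    · exact (lintegral_slice_sub_le he hψ hw hO (htr k) ⟨(htr m).1, (htr m).2.trans_le h⟩
        (htg k) (htg m)).trans_lt ((htV k).trans_le (hBm hk))
  obtain ⟨T, hT, hlim⟩ := Lp.cauchy_complete_eLpNorm (μ := volume.restrict O) le_rfl hmem hsum hdist
  refine ⟨T, memLp_one_iff_integrable.1 hT, fun O' hO'O hO' τ hτ u hu hug => ?_⟩
  have htt : Tendsto t atTop (𝓝 0) :=
    squeeze_zero (fun k => (htr k).1.le) (fun k => ((htr k).2.trans_le (hr k)).le)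
      tendsto_one_div_add_atTop_nhds_zero_nat
  -- The comparison between the slices at `u` and `t k` uses only the variation over `O'`; the
  -- distance from slice `t k` to `T` is measured over all of `O` but tends to zero. Thus the
  -- limiting bound is local in `O'`.
  have hev : ∀ᶠ k in atTop, ∫⁻ y in O', ‖w (Φ (y, u)) - T y‖ₑ
      ≤ variation w (Φ '' (O' ×ˢ Ioo 0 τ)) + eLpNorm ((fun y => w (Φ (y, t k))) - T) 1 (volume.restrict O) := by
    filter_upwards [htt.eventually_lt_const hτ] with k hk
    have h1 := lintegral_slice_sub_le he hψ hw hO' hu ⟨(htr k).1, hk⟩ hug (htg k)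
    have h2 : ∫⁻ y in O', ‖w (Φ (y, t k)) - T y‖ₑ
        ≤ eLpNorm ((fun y => w (Φ (y, t k))) - T) 1 (volume.restrict O) := by
      rw [eLpNorm_one_eq_lintegral_enorm]
      exact lintegral_mono_set hO'O
    refine le_trans ?_ (add_le_add h1 h2)
    rw [← lintegral_add_left']
    · refine lintegral_mono fun y => ?_
      simp only
      calc ‖w (Φ (y, u)) - T y‖ₑ = ‖(w (Φ (y, u)) - w (Φ (y, t k))) + (w (Φ (y, t k)) - T y)‖ₑ := by
            congr 1; ring
        _ ≤ _ := enorm_add_le _ _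
    · exact ((hug.1.aestronglyMeasurable.sub (htg k).1.aestronglyMeasurable).enorm).restrict
  have hl : Tendsto (fun k => variation w (Φ '' (O' ×ˢ Ioo 0 τ))
      + eLpNorm ((fun y => w (Φ (y, t k))) - T) 1 (volume.restrict O)) atTop
      (𝓝 (variation w (Φ '' (O' ×ˢ Ioo 0 τ)) + 0)) := hlim.const_add _
  rw [add_zero] at hl
  exact ge_of_tendsto hl hev

/-- At almost every point the variation over small cylinders is of lower order. -/
lemma ae_eventually_variation_cylinder_le (he : ‖e‖ = 1) (hψ : Continuous ψ) {w : (𝔼 n) → ℝ}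
    (hw : Integrable w) {O : Set (Hyper e)} (hO : IsOpen O) {s : ℝ} (hs : 0 < s)
    (hfin : variation w (graphHomeo he hψ '' (O ×ˢ Ioo 0 s)) ≠ ∞) {Λ : ℝ} (hΛ : 0 < Λ) {a : ℝ}
    (ha : 0 < a) :
    ∀ᵐ y, y ∈ O → ∀ᶠ ρ in 𝓝[>] (0 : ℝ),
      variation w (graphHomeo he hψ '' (Metric.ball y ρ ×ˢ Ioo 0 (Λ * ρ)))
        ≤ ENNReal.ofReal (a * ρ ^ (n - 1)) := by
  set Φ := graphHomeo he hψ with hΦ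
  set m : Hyper e → ℝ → ℝ≥0∞ := fun y ρ => variation w (Φ '' (Metric.ball y ρ ×ˢ Ioo 0 (Λ * ρ))) with hm
  set Z := {y | ¬ (y ∈ O → ∀ᶠ ρ in 𝓝[>] (0 : ℝ), m y ρ ≤ ENNReal.ofReal (a * ρ ^ (n - 1)))} with hZ
  change volume Z = 0
  set c : ℝ≥0∞ := volume (Metric.ball (0 : Hyper e) 1) with hc
  have hctop : c ≠ ∞ := measure_ball_lt_top.ne
  -- Each bad point has arbitrarily small cylinders with variation greater than `a ρ ^ (n - 1)`. If
  -- they are chosen in a layer of variation at most `ε`, disjoint ones have bases of total measure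
  -- `O(ε)`.
  have key : ∀ ε : ℝ≥0∞, ε ≠ 0 → volume Z ≤ (ENNReal.ofReal (5 ^ (n - 1) / a) * c) * ε := by
    intro ε hε
    obtain ⟨τ, hτ0, hτs, hτ⟩ := exists_variation_layer_le he hψ hw hs hfin hε
    set I : Set (Hyper e × ℝ) := {p | p.1 ∈ Z ∧ 0 < p.2 ∧ Λ * p.2 ≤ τ ∧ Metric.closedBall p.1 p.2 ⊆ O ∧
      ENNReal.ofReal (a * p.2 ^ (n - 1)) < m p.1 p.2} with hI
    have hZI : ∀ y ∈ Z, ∃ ρ, (y, ρ) ∈ I := by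
      intro y hy
      have hy' := hy
      simp only [hZ, mem_ofPred_eq, Classical.not_imp, not_eventually, not_le] at hy'
      obtain ⟨δ, hδ, hδO⟩ := Metric.nhds_basis_closedBall.mem_iff.1 (hO.mem_nhds hy'.1)
      have h1 : ∀ᶠ ρ in 𝓝[>] (0 : ℝ), 0 < ρ ∧ ρ < min δ (τ / Λ) :=
        Ioo_mem_nhdsGT (lt_min hδ (by positivity))
      obtain ⟨ρ, h2, h3, h4⟩ := (hy'.2.and_eventually h1).exists
      refine ⟨ρ, hy, h3, ?_, (Metric.closedBall_subset_closedBall (h4.le.trans (min_le_left _ _))).trans hδO, h2⟩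
      have := h4.le.trans (min_le_right _ _)
      rw [le_div_iff₀ hΛ] at this
      linarith
    -- Vitali's lemma with enlargement factor five produces the `5 ^ (n - 1)` in the bound.
    obtain ⟨u, huI, hdisj, hcov⟩ := Vitali.exists_disjoint_subfamily_covering_enlargement_closedBall
      I (fun p => p.1) (fun p => p.2) (τ / Λ) (fun p hp => by
        rw [le_div_iff₀ hΛ, mul_comm]; exact hp.2.2.1) 5 (by norm_num)
    have hucount : u.Countable := by
      refine hdisj.countable_of_nonempty_interior fun p hp => ?_
      exact ⟨p.1, Metric.ball_subset_interior_closedBall (Metric.mem_ball_self (huI hp).2.1)⟩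
    have hsub : Z ⊆ ⋃ p ∈ u, Metric.closedBall p.1 (5 * p.2) := by
      intro y hy
      obtain ⟨ρ, hρ⟩ := hZI y hy
      obtain ⟨b, hb, hsubb⟩ := hcov _ hρ
      exact mem_iUnion₂.2 ⟨b, hb, hsubb (Metric.mem_closedBall_self hρ.2.1.le)⟩
    have hfr := finrank_hyper he
    calc volume Z ≤ volume (⋃ p ∈ u, Metric.closedBall p.1 (5 * p.2)) := measure_mono hsub
      _ ≤ ∑' p : u, volume (Metric.closedBall p.1.1 (5 * p.1.2)) := measure_biUnion_le _ hucount _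
      _ ≤ ∑' p : u, (ENNReal.ofReal (5 ^ (n - 1) / a) * c) * m p.1.1 p.1.2 := by
          refine ENNReal.tsum_le_tsum fun p => ?_
          have hp := huI p.2
          rw [Measure.addHaar_closedBall _ _ (by linarith [hp.2.1]), hfr, mul_right_comm]
          gcongr
          calc ENNReal.ofReal ((5 * p.1.2) ^ (n - 1))
              = ENNReal.ofReal (5 ^ (n - 1) / a) * ENNReal.ofReal (a * p.1.2 ^ (n - 1)) := by
                rw [← ENNReal.ofReal_mul (by positivity)]
                congr 1
                rw [mul_pow]
                field_simp
            _ ≤ _ := by gcongr; exact hp.2.2.2.2.le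
      _ = (ENNReal.ofReal (5 ^ (n - 1) / a) * c) * ∑' p : u, m p.1.1 p.1.2 := ENNReal.tsum_mul_left
      _ ≤ _ := by
          gcongr
          rw [ENNReal.tsum_eq_iSup_sum]
          refine iSup_le fun S => ?_
          -- Cylinders over disjoint balls are disjoint, so superadditivity bounds every finite
          -- partial sum by the variation in the layer.
          refine (sum_variation_le hw.locallyIntegrable S (U := fun p : u =>
            Φ '' (Metric.ball p.1.1 p.1.2 ×ˢ Ioo 0 (Λ * p.1.2))) ?_).trans ?_
          · intro p _ q _ hpq
            have hd := hdisj p.2 q.2 (fun h => hpq (Subtype.ext h))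
            refine (disjoint_image_iff Φ.injective).2 (Disjoint.set_prod_left ?_ _ _)
            exact hd.mono Metric.ball_subset_closedBall Metric.ball_subset_closedBall
          · refine (variation_mono ?_).trans hτ
            refine iUnion₂_subset fun p _ => image_mono (prod_mono ?_ ?_)
            · exact Metric.ball_subset_closedBall.trans (huI p.2).2.2.2.1
            · exact Ioo_subset_Ioo_right (huI p.2).2.2.1
  by_contra hne
  set D := ENNReal.ofReal (5 ^ (n - 1) / a) * c with hD
  have hDtop : D ≠ ∞ := ENNReal.mul_ne_top ENNReal.ofReal_ne_top hctop
  by_cases hZtop : volume Z = ∞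
  · have := key 1 one_ne_zero
    rw [hZtop, mul_one, top_le_iff] at this
    exact hDtop this
  obtain ⟨ε, hε, hlt⟩ : ∃ ε : ℝ≥0∞, ε ≠ 0 ∧ D * ε < volume Z := by
    have : Tendsto (fun ε : ℝ≥0∞ => D * ε) (𝓝 0) (𝓝 (D * 0)) :=
      ENNReal.Tendsto.const_mul tendsto_id (Or.inr hDtop)
    rw [mul_zero] at this
    have h1 := this.eventually_lt_const (pos_iff_ne_zero.2 hne)
    obtain ⟨ε, h2, h3⟩ := ((h1.filter_mono nhdsWithin_le_nhds).and
      (self_mem_nhdsWithin : ∀ᶠ ε in 𝓝[≠] (0 : ℝ≥0∞), ε ∈ ({0}ᶜ : Set ℝ≥0∞))).exists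
    exact ⟨ε, h3, h2⟩
  exact absurd (key ε hε) (not_le.2 hlt)

end verticalTrace

/-! ### Existence of traces at almost every boundary point. -/

/-- `c` is the value at `x` of the trace of `w`: the mean oscillation of `w` around `c` over
`Ω ∩ B_ρ(x)` tends to zero. -/
def HasTrace (Ω : Set (𝔼 n)) (w : (𝔼 n) → ℝ) (x : 𝔼 n) (c : ℝ) : Prop :=
  ∀ a : ℝ, 0 < a → ∀ᶠ ρ in 𝓝[>] (0 : ℝ),
    ∫⁻ y in Ω ∩ Metric.ball x ρ, ‖w y - c‖ₑ ≤ ENNReal.ofReal (a * ρ ^ n)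

section chart

variable {e : 𝔼 n} {ψ : Hyper e → ℝ}

lemma pos_of_norm_eq_one (he : ‖e‖ = 1) : 0 < n := by
  rcases Nat.eq_zero_or_pos n with rfl | h
  · have : e = 0 := Subsingleton.elim _ _
    simp [this] at he
  · exact h

/-- The value is the vertical trace `T y`. At each good height the deviation splits into `w - T`,
controlled by the variation in the cylinder, and `T - T y`, small at Lebesgue points of `T`. Both
are `o(ρ ^ (n - 1))`, and the heights fill an interval of length `Λ ρ`. -/
lemma ae_exists_cylinder_trace (he : ‖e‖ = 1) (hψ : Continuous ψ) {w : (𝔼 n) → ℝ}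
    (hw : Integrable w) {O : Set (Hyper e)} (hO : IsOpen O) {s : ℝ} (hs : 0 < s)
    (hfin : variation w (graphHomeo he hψ '' (O ×ˢ Ioo 0 s)) ≠ ∞) {Λ : ℝ} (hΛ : 0 < Λ) :
    ∀ᵐ y, y ∈ O → ∃ c : ℝ, ∀ a : ℝ, 0 < a → ∀ᶠ ρ in 𝓝[>] (0 : ℝ),
      ∫⁻ x in graphHomeo he hψ '' (Metric.ball y ρ ×ˢ Ioo 0 (Λ * ρ)), ‖w x - c‖ₑ
        ≤ ENNReal.ofReal (a * ρ ^ n) := by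
  set Φ := graphHomeo he hψ with hΦ
  have hmp : MeasurePreserving Φ (volume.prod volume) volume := measurePreserving_graphHomeo he hψ
  obtain ⟨T₀, hT₀, hT₀V⟩ := exists_vertical_trace he hψ hw hO hs hfin
  -- Extension by zero makes the trace integrable on the whole hyperplane, as the differentiation
  -- theorem requires; nothing changes over `O`.
  set T : Hyper e → ℝ := O.indicator T₀ with hT
  have hTi : Integrable T := (integrable_indicator_iff hO.measurableSet).2 hT₀
  have hTV : ∀ O' ⊆ O, IsOpen O' → ∀ τ, 0 < τ → ∀ t ∈ Ioo 0 τ, IsGoodHeight he hψ w t →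
      ∫⁻ y in O', ‖w (Φ (y, t)) - T y‖ₑ ≤ variation w (Φ '' (O' ×ˢ Ioo 0 τ)) := by
    intro O' hO'O hO' τ hτ t ht hgt
    refine le_trans (le_of_eq ?_) (hT₀V O' hO'O hO' τ hτ t ht hgt)
    refine setLIntegral_congr_fun hO'.measurableSet fun y hy => ?_
    simp only [hT, indicator_of_mem (hO'O hy), hΦ]
  have hleb := (Besicovitch.vitaliFamily (volume : Measure (Hyper e))).ae_tendsto_lintegral_enorm_sub_div
    hTi.locallyIntegrable
  have hvar : ∀ᵐ y, ∀ k : ℕ, y ∈ O → ∀ᶠ ρ in 𝓝[>] (0 : ℝ),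
      variation w (Φ '' (Metric.ball y ρ ×ˢ Ioo 0 (Λ * ρ)))
        ≤ ENNReal.ofReal (1 / ((k : ℝ) + 1) * ρ ^ (n - 1)) :=
    ae_all_iff.2 fun k => ae_eventually_variation_cylinder_le he hψ hw hO hs hfin hΛ (by positivity)
  filter_upwards [hleb, hvar] with y hy1 hy2 hyO
  refine ⟨T y, fun a ha => ?_⟩
  -- Each of the two contributions is at most `b ρ ^ (n - 1)` times the height `Λ ρ`, so together
  -- they give `a ρ ^ n`.
  set b : ℝ := a / (2 * Λ) with hb
  have hb0 : 0 < b := by positivity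
  obtain ⟨k, hk⟩ := exists_nat_one_div_lt hb0
  set v : ℝ≥0∞ := volume (Metric.ball (0 : Hyper e) 1) with hv
  have hv0 : v ≠ 0 := (Metric.measure_ball_pos _ _ one_pos).ne'
  have hvt : v ≠ ∞ := measure_ball_lt_top.ne
  have hl := (hy1.comp (Besicovitch.tendsto_filterAt volume y)).eventually_lt_const
    (show (0 : ℝ≥0∞) < ENNReal.ofReal b / v from
      ENNReal.div_pos (by simpa using hb0) hvt)
  obtain ⟨δ, hδ, hδO⟩ := Metric.nhds_basis_ball.mem_iff.1 (hO.mem_nhds hyO)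
  filter_upwards [hl, hy2 k hyO, (Ioo_mem_nhdsGT hδ : Ioo 0 δ ∈ 𝓝[>] (0 : ℝ))] with ρ h1 h2 h3
  have hρ : 0 < ρ := h3.1
  have hΛρ : 0 < Λ * ρ := by positivity
  have hfr := finrank_hyper he
  have hB : ∫⁻ z in Metric.ball y ρ, ‖T z - T y‖ₑ ≤ ENNReal.ofReal (b * ρ ^ (n - 1)) := by
    have hcb : volume (Metric.closedBall y ρ) = ENNReal.ofReal (ρ ^ (n - 1)) * v := by
      rw [Measure.addHaar_closedBall _ _ hρ.le, hfr]
    have hcb0 : volume (Metric.closedBall y ρ) ≠ 0 := (Metric.measure_closedBall_pos _ _ hρ).ne'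
    have hcbt : volume (Metric.closedBall y ρ) ≠ ∞ := measure_closedBall_lt_top.ne
    have h4 : ∫⁻ z in Metric.closedBall y ρ, ‖T z - T y‖ₑ
        ≤ ENNReal.ofReal b / v * volume (Metric.closedBall y ρ) :=
      (ENNReal.div_le_iff hcb0 hcbt).1 (le_of_lt h1)
    refine (lintegral_mono_set Metric.ball_subset_closedBall).trans (h4.trans (le_of_eq ?_))
    rw [hcb, mul_comm (ENNReal.ofReal (ρ ^ (n - 1))), ← mul_assoc, ENNReal.div_mul_cancel hv0 hvt,
      ENNReal.ofReal_mul hb0.le]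
  have hV : variation w (Φ '' (Metric.ball y ρ ×ˢ Ioo 0 (Λ * ρ))) ≤ ENNReal.ofReal (b * ρ ^ (n - 1)) :=
    h2.trans (ENNReal.ofReal_le_ofReal (mul_le_mul_of_nonneg_right hk.le (by positivity)))
  have hsubO : Metric.ball y ρ ⊆ O := (Metric.ball_subset_ball h3.2.le).trans hδO
  have hwΦ : AEStronglyMeasurable (fun p : Hyper e × ℝ => w (Φ p)) (volume.prod volume) :=
    (hmp.integrable_comp_of_integrable hw).aestronglyMeasurable
  have hTm : AEStronglyMeasurable (fun p : Hyper e × ℝ => T p.1) (volume.prod volume) :=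
    hTi.aestronglyMeasurable.comp_fst
  have m1 : AEMeasurable (fun p : Hyper e × ℝ => ‖w (Φ p) - T p.1‖ₑ)
      ((volume.restrict (Metric.ball y ρ)).prod (volume.restrict (Ioo 0 (Λ * ρ)))) := by
    rw [Measure.prod_restrict]
    exact (hwΦ.sub hTm).enorm.restrict
  have m2 : AEMeasurable (fun p : Hyper e × ℝ => ‖T p.1 - T y‖ₑ)
      ((volume.restrict (Metric.ball y ρ)).prod (volume.restrict (Ioo 0 (Λ * ρ)))) := by
    rw [Measure.prod_restrict]
    exact (hTm.sub aestronglyMeasurable_const).enorm.restrict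
  calc ∫⁻ x in Φ '' (Metric.ball y ρ ×ˢ Ioo 0 (Λ * ρ)), ‖w x - T y‖ₑ
      = ∫⁻ p in Metric.ball y ρ ×ˢ Ioo 0 (Λ * ρ), ‖w (Φ p) - T y‖ₑ ∂(volume.prod volume) :=
        (hmp.setLIntegral_comp_emb (measurableEmbedding_graphHomeo he hψ) (fun x => ‖w x - T y‖ₑ) _).symm
    _ ≤ ∫⁻ p in Metric.ball y ρ ×ˢ Ioo 0 (Λ * ρ), (‖w (Φ p) - T p.1‖ₑ + ‖T p.1 - T y‖ₑ)
          ∂(volume.prod volume) := by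
        refine lintegral_mono fun p => ?_
        calc ‖w (Φ p) - T y‖ₑ = ‖(w (Φ p) - T p.1) + (T p.1 - T y)‖ₑ := by congr 1; ring
          _ ≤ _ := enorm_add_le _ _
    _ = (∫⁻ t in Ioo 0 (Λ * ρ), ∫⁻ z in Metric.ball y ρ, ‖w (Φ (z, t)) - T z‖ₑ)
          + ∫⁻ t in Ioo 0 (Λ * ρ), ∫⁻ z in Metric.ball y ρ, ‖T z - T y‖ₑ := by
        rw [← Measure.prod_restrict, lintegral_add_left' m1, lintegral_prod_symm _ m1,
          lintegral_prod_symm _ m2]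
    _ ≤ (∫⁻ t in Ioo 0 (Λ * ρ), ENNReal.ofReal (b * ρ ^ (n - 1)))
          + ∫⁻ t in Ioo 0 (Λ * ρ), ENNReal.ofReal (b * ρ ^ (n - 1)) := by
        refine add_le_add ?_ (lintegral_mono fun _ => hB)
        refine setLIntegral_mono_ae aemeasurable_const ?_
        filter_upwards [ae_isGoodHeight he hψ hw] with t ht htI
        exact (hTV _ hsubO Metric.isOpen_ball _ hΛρ t htI ht).trans hV
    _ = ENNReal.ofReal (a * ρ ^ n) := by
        rw [setLIntegral_const, Real.volume_Ioo, sub_zero, ← ENNReal.ofReal_mul (by positivity),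
          ← ENNReal.ofReal_add (by positivity) (by positivity)]
        congr 1
        have hn : ρ ^ n = ρ ^ (n - 1) * ρ := by
          rw [← pow_succ, Nat.sub_add_cancel (pos_of_norm_eq_one he)]
        rw [hn, hb]
        field_simp
        ring

/-- The height above the graph grows with slope at most `1 + L`. Hence, within a chart, `Ω ∩ B_ρ(x)`
lies in the cylinder of radius `ρ` and height `(1 + L) ρ`. -/
lemma lipschitz_height (he : ‖e‖ = 1) {L : ℝ≥0} (hL : LipschitzWith L ψ) (x z : 𝔼 n) :
    (⟪e, z⟫ - ψ (hyperProj he z)) - (⟪e, x⟫ - ψ (hyperProj he x)) ≤ (1 + L) * dist z x := by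
  have h1 : ⟪e, z⟫ - ⟪e, x⟫ ≤ dist z x := by
    rw [← inner_sub_right, dist_eq_norm]
    simpa [he] using real_inner_le_norm e (z - x)
  have h2 : ψ (hyperProj he x) - ψ (hyperProj he z) ≤ L * dist z x := by
    refine (le_abs_self _).trans ?_
    rw [← Real.dist_eq, dist_comm z x]
    exact (hL.dist_le_mul _ _).trans (by gcongr; exact dist_hyperProj_le he x z)
  linarith

end chart

/-- Almost every point near a Lipschitz boundary point carries a trace. -/
lemma ae_exists_hasTrace {Ω : Set (𝔼 n)} (hΩ : IsOpen Ω) (hlip : HasLipschitzBoundary Ω)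
    {w : (𝔼 n) → ℝ} (hw : Integrable w) (hfin : variation w Ω ≠ ∞) :
    ∀ᵐ x ∂(surfaceMeasure Ω), ∃ c, HasTrace Ω w x c := by
  unfold surfaceMeasure
  rw [ae_restrict_iff' isClosed_frontier.measurableSet, ae_iff]
  refine measure_null_of_locally_null _ fun x₀ hx₀ => ?_
  simp only [Classical.not_imp, mem_ofPred_eq] at hx₀
  obtain ⟨e, r, K, ψ₀, he, hr, hψ₀, hchart⟩ := hlip x₀ hx₀.1
  set ψ : Hyper e → ℝ := fun y => ψ₀ y with hψdef
  have hψL : LipschitzWith K ψ := by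
    exact fun y z => hψ₀ y z
  have hψ : Continuous ψ := hψL.continuous
  set Φ := graphHomeo he hψ with hΦ
  set f : (𝔼 n) → ℝ := fun x => ⟪e, x⟫ - ψ (hyperProj he x) with hf
  have hfc : Continuous f := by
    have := continuous_hyperProj he
    fun_prop
  have hchart' : ∀ y ∈ Metric.ball x₀ r, (y ∈ Ω ↔ 0 < f y) := fun y hy => by
    rw [hchart y hy, sub_pos]; rfl
  have hΦf : ∀ x, Φ (hyperProj he x, f x) = x := fun x => (graphHomeo he hψ).right_inv x
  have hfΦ : ∀ p, f (Φ p) = p.2 := fun p => congrArg Prod.snd ((graphHomeo he hψ).left_inv p)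
  -- A boundary point is not in the open set `Ω`, so its height is not positive. A negative height
  -- would persist nearby and contradict the presence of points of `Ω`.
  have hf0 : ∀ x ∈ frontier Ω, x ∈ Metric.ball x₀ r → f x = 0 := by
    intro x hx hxb
    have hxΩ : x ∉ Ω := fun h => (hΩ.frontier_eq ▸ hx).2 h
    refine le_antisymm (not_lt.1 fun h => hxΩ ((hchart' x hxb).2 h)) (not_lt.1 fun h => ?_)
    have hev : ∀ᶠ y in 𝓝 x, f y < 0 ∧ y ∈ Metric.ball x₀ r :=
      (hfc.continuousAt.eventually_lt_const h).and (Metric.isOpen_ball.mem_nhds hxb)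
    obtain ⟨y, hyΩ, hy1, hy2⟩ := (mem_closure_iff_frequently.1 hx.1).and_eventually hev |>.exists
    exact absurd ((hchart' y hy2).1 hyΩ) (not_lt.2 hy1.le)
  have hx₀b : x₀ ∈ Metric.ball x₀ r := Metric.mem_ball_self hr
  have hΦ0 : Φ (hyperProj he x₀, 0) = x₀ := by rw [← hf0 x₀ hx₀.1 hx₀b, hΦf]
  obtain ⟨δ, hδ, hδr⟩ : ∃ δ > 0, Φ '' (Metric.ball (hyperProj he x₀) δ ×ˢ Ioo 0 δ) ⊆ Metric.ball x₀ r := by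
    have h1 : Φ ⁻¹' Metric.ball x₀ r ∈ 𝓝 (hyperProj he x₀, (0 : ℝ)) :=
      Φ.continuous.continuousAt.preimage_mem_nhds (by rw [hΦ0]; exact Metric.ball_mem_nhds _ hr)
    obtain ⟨δ, hδ, h2⟩ := Metric.mem_nhds_iff.1 h1
    refine ⟨δ, hδ, ?_⟩
    rintro _ ⟨p, hp, rfl⟩
    refine h2 ?_
    rw [← ball_prod_same]
    refine ⟨hp.1, ?_⟩
    simp only [Metric.mem_ball, dist_zero_right, Real.norm_eq_abs, abs_of_pos hp.2.1]
    exact hp.2.2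
  set O := Metric.ball (hyperProj he x₀) δ with hO
  have hsub : Φ '' (O ×ˢ Ioo 0 δ) ⊆ Ω := by
    intro x hx
    rw [hchart' x (hδr hx)]
    obtain ⟨p, hp, rfl⟩ := hx
    rw [hfΦ]
    exact hp.2.1
  have hΛ : (0 : ℝ) < 1 + K := by positivity
  have hae := ae_exists_cylinder_trace he hψ hw (O := O) Metric.isOpen_ball hδ
    (ne_top_of_le_ne_top hfin (variation_mono hsub)) hΛ
  set N := {y | ¬ (y ∈ O → ∃ c : ℝ, ∀ a : ℝ, 0 < a → ∀ᶠ ρ in 𝓝[>] (0 : ℝ),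
      ∫⁻ x in Φ '' (Metric.ball y ρ ×ˢ Ioo 0 ((1 + K) * ρ)), ‖w x - c‖ₑ
        ≤ ENNReal.ofReal (a * ρ ^ n)) } with hN
  have hN0 : volume N = 0 := hae
  refine ⟨_, inter_mem_nhdsWithin _ (Metric.ball_mem_nhds x₀ (lt_min hr hδ)), ?_⟩
  -- Near `x₀` the boundary points without a trace lie in the image of the null set `N` under the
  -- Lipschitz graph map.
  refine measure_mono_null (t := (fun y => Φ (y, 0)) '' N) ?_ ?_
  · rintro x ⟨hx, hxb⟩
    simp only [Classical.not_imp, mem_ofPred_eq] at hx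
    have hxr : x ∈ Metric.ball x₀ r := Metric.ball_subset_ball (min_le_left _ _) hxb
    have hfx : f x = 0 := hf0 x hx.1 hxr
    refine ⟨hyperProj he x, ?_, by simp only; rw [← hfx, hΦf]⟩
    simp only [hN, Classical.not_imp, mem_ofPred_eq]
    refine ⟨?_, ?_⟩
    · exact lt_of_le_of_lt (dist_hyperProj_le he _ _) (lt_of_lt_of_le hxb (min_le_right _ _))
    · rintro ⟨c, hc⟩
      refine hx.2 ⟨c, fun a ha => ?_⟩
      obtain ⟨η, hη, hηr⟩ := Metric.isOpen_iff.1 Metric.isOpen_ball x hxr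
      filter_upwards [hc a ha, (Ioo_mem_nhdsGT hη : Ioo 0 η ∈ 𝓝[>] (0 : ℝ))] with ρ h1 h2
      refine (lintegral_mono_set ?_).trans h1
      rintro z ⟨hzΩ, hzb⟩
      have hzr : z ∈ Metric.ball x₀ r := hηr (Metric.ball_subset_ball h2.2.le hzb)
      refine ⟨(hyperProj he z, f z), ⟨lt_of_le_of_lt (dist_hyperProj_le he _ _) hzb,
        (hchart' z hzr).1 hzΩ, ?_⟩, hΦf z⟩
      have h3 : f z - f x ≤ (1 + K) * dist z x := lipschitz_height he hψL x z
      rw [hfx, sub_zero] at h3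
      exact h3.trans_lt (mul_lt_mul_of_pos_left hzb hΛ)
  · have := euclideanHausdorffMeasure_graph_le he hψ hψL N
    rw [hN0, mul_zero] at this
    exact nonpos_iff_eq_zero.1 this

/-! ### Semiconvex functions. -/

/-- `f` is semiconvex with constant `κ`. -/
def IsSemiconvex (κ : ℝ) (f : (𝔼 n) → ℝ) : Prop :=
  ConvexOn ℝ univ fun y => f y + κ / 2 * ‖y‖ ^ 2

section semiconvex

variable {κ : ℝ} {f : (𝔼 n) → ℝ} {e : 𝔼 n}

lemma IsSemiconvex.convexOn_line (hf : IsSemiconvex κ f) (y e : 𝔼 n) :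
    ConvexOn ℝ univ fun τ : ℝ => f (y + τ • e) + κ / 2 * ‖y + τ • e‖ ^ 2 := by
  have h := ConvexOn.comp_affineMap (AffineMap.lineMap (k := ℝ) y (y + e)) hf
  simp only [preimage_univ] at h
  have hfun : (fun τ : ℝ => f (y + τ • e) + κ / 2 * ‖y + τ • e‖ ^ 2)
      = (fun y => f y + κ / 2 * ‖y‖ ^ 2) ∘ AffineMap.lineMap (k := ℝ) y (y + e) := by
    ext τ
    simp [AffineMap.lineMap_apply, add_comm]
  rw [hfun]
  exact h

lemma hasDerivAt_line (hf : ContDiff ℝ 1 f) (y e : 𝔼 n) (τ : ℝ) :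
    HasDerivAt (fun τ : ℝ => f (y + τ • e) + κ / 2 * ‖y + τ • e‖ ^ 2)
      (fderiv ℝ f (y + τ • e) e + κ * ⟪y + τ • e, e⟫) τ := by
  have h1 : HasDerivAt (fun τ : ℝ => y + τ • e) e τ := by
    simpa using ((hasDerivAt_id τ).smul_const e).const_add y
  have h2 := (hf.differentiable one_ne_zero (y + τ • e)).hasFDerivAt.comp_hasDerivAt τ h1
  have h3 := h1.norm_sq.const_mul (κ / 2)
  refine (h2.add h3).congr_deriv ?_
  ring

/-- Along a line a convex function has its backward difference quotients below the derivative; the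
quadratic correction costs `κ t / 2`. This turns a bound on height differences into a lower bound
for the gradient. -/
lemma IsSemiconvex.le_fderiv (hf : IsSemiconvex κ f) (hd : ContDiff ℝ 1 f) (he : ‖e‖ = 1) (y : 𝔼 n)
    {t : ℝ} (ht : 0 < t) : (f y - f (y - t • e)) / t - κ * t / 2 ≤ fderiv ℝ f y e := by
  have h := (hf.convexOn_line y e).slope_le_of_hasDerivAt (x := -t) (y := 0) (mem_univ _) (mem_univ _)
    (by linarith) (hasDerivAt_line hd y e 0)
  simp only [slope_def_field, zero_smul, add_zero, neg_smul, zero_sub, neg_neg, ← sub_eq_add_neg] at h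
  rw [div_le_iff₀ ht, norm_sub_sq_real, inner_smul_right, norm_smul, he, Real.norm_of_nonneg ht.le] at h
  rw [sub_le_iff_le_add, div_le_iff₀ ht]
  nlinarith

lemma IsSemiconvex.le_fderiv_fderiv (hf : IsSemiconvex κ f) (hd : ContDiff ℝ 2 f) (he : ‖e‖ = 1)
    (y : 𝔼 n) : -κ ≤ fderiv ℝ (fun z => fderiv ℝ f z e) y e := by
  have hd1 : ContDiff ℝ 1 f := hd.of_le (by norm_num)
  have hder : ∀ τ, HasDerivAt (fun τ : ℝ => f (y + τ • e) + κ / 2 * ‖y + τ • e‖ ^ 2)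
    (fderiv ℝ f (y + τ • e) e + κ * ⟪y + τ • e, e⟫) τ := hasDerivAt_line hd1 y e
  have hmono := (hf.convexOn_line y e).monotoneOn_deriv fun τ _ => (hder τ).differentiableAt
  have heq : deriv (fun τ : ℝ => f (y + τ • e) + κ / 2 * ‖y + τ • e‖ ^ 2)
      = fun τ => fderiv ℝ f (y + τ • e) e + κ * ⟪y + τ • e, e⟫ := funext fun τ => (hder τ).deriv
  rw [heq, monotoneOn_univ] at hmono
  have h1 : HasDerivAt (fun τ : ℝ => y + τ • e) e 0 := by
    simpa using ((hasDerivAt_id (0 : ℝ)).smul_const e).const_add y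
  have hd2 : ContDiff ℝ 1 fun z => fderiv ℝ f z e :=
    (hd.fderiv_right (m := 1) (by norm_num)).clm_apply contDiff_const
  have h2 : HasDerivAt (fun τ : ℝ => fderiv ℝ f (y + τ • e) e)
      (fderiv ℝ (fun z => fderiv ℝ f z e) (y + (0 : ℝ) • e) e) 0 :=
    (hd2.differentiable one_ne_zero _).hasFDerivAt.comp_hasDerivAt 0 h1
  have h3 : HasDerivAt (fun τ : ℝ => κ * ⟪y + τ • e, e⟫) (κ * ⟪e, e⟫) 0 := by
    have := (h1.inner ℝ (hasDerivAt_const (0 : ℝ) e)).const_mul κ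
    simpa using this
  have h4 := (h2.add h3).nonneg_of_monotone hmono
  rw [real_inner_self_eq_norm_sq, he, zero_smul, add_zero] at h4
  linarith

/-- The convexity defect of the quadratic term, `a‖x‖² + b‖y‖² - ‖a x + b y‖²`, does not change when
`x` and `y` are translated together. Averaging over translations therefore keeps the same constant
`κ`. -/
lemma IsSemiconvex.mollify (hf : IsSemiconvex κ f) (hc : Continuous f) (φ : ContDiffBump (0 : 𝔼 n)) :
    IsSemiconvex κ (mollify φ f) := by
  have hint : ∀ x, Integrable fun t => φ.normed volume t * f (x - t) := fun x =>
    (φ.continuous_normed.mul (by fun_prop)).integrable_of_hasCompactSupport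
      φ.hasCompactSupport_normed.mul_right
  refine ⟨convex_univ, fun x _ y _ a b ha hb hab => ?_⟩
  have key : ∀ t, f (a • x + b • y - t) ≤ a * f (x - t) + b * f (y - t)
      + κ / 2 * (a * ‖x‖ ^ 2 + b * ‖y‖ ^ 2 - ‖a • x + b • y‖ ^ 2) := by
    intro t
    have h := hf.2 (mem_univ (x - t)) (mem_univ (y - t)) ha hb hab
    have e1 : a • (x - t) + b • (y - t) = a • x + b • y - t := by
      obtain rfl : b = 1 - a := by linarith
      module
    rw [e1] at h
    have hb' : b = 1 - a := by linarith
    have e2 : a * ‖x - t‖ ^ 2 + b * ‖y - t‖ ^ 2 - ‖a • x + b • y - t‖ ^ 2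
        = a * ‖x‖ ^ 2 + b * ‖y‖ ^ 2 - ‖a • x + b • y‖ ^ 2 := by
      rw [norm_sub_sq_real, norm_sub_sq_real, norm_sub_sq_real, inner_add_left, inner_smul_left,
        inner_smul_left, hb']
      simp only [conj_trivial]
      ring
    simp only [smul_eq_mul] at h
    rw [← e2]
    linarith
  simp only [smul_eq_mul]
  set D := κ / 2 * (a * ‖x‖ ^ 2 + b * ‖y‖ ^ 2 - ‖a • x + b • y‖ ^ 2) with hD
  have h1 : Capillary.mollify φ f (a • x + b • y)
      ≤ a * Capillary.mollify φ f x + b * Capillary.mollify φ f y + D := by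
    rw [mollify_apply, mollify_apply, mollify_apply]
    have e3 : a * (∫ t, φ.normed volume t * f (x - t)) + b * (∫ t, φ.normed volume t * f (y - t)) + D
        = ∫ t, (a * (φ.normed volume t * f (x - t)) + b * (φ.normed volume t * f (y - t))
          + φ.normed volume t * D) := by
      rw [integral_add, integral_add, integral_const_mul, integral_const_mul, integral_mul_const,
        φ.integral_normed, one_mul]
      · exact (hint x).const_mul a
      · exact (hint y).const_mul b
      · exact ((hint x).const_mul a).add ((hint y).const_mul b)
      · exact φ.integrable_normed.mul_const D
    rw [e3]
    refine integral_mono (hint _) ((((hint x).const_mul a).add ((hint y).const_mul b)).add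
      (φ.integrable_normed.mul_const D)) fun t => ?_
    have := mul_le_mul_of_nonneg_left (key t) (φ.nonneg_normed (μ := volume) t)
    simp only
    linarith
  linarith

end semiconvex

/-! ### The inner height function. -/

/-- The centres of the balls of radius `R` contained in `Ω`. -/
def centers (Ω : Set (𝔼 n)) (R : ℝ) : Set (𝔼 n) := {z | Metric.ball z R ⊆ Ω}

lemma isClosed_centers (Ω : Set (𝔼 n)) (R : ℝ) : IsClosed (centers Ω R) := by
  have : centers Ω R = ⋂ y ∈ Ωᶜ, {z | R ≤ dist y z} := by
    ext z
    simp only [centers, mem_ofPred_eq, mem_iInter, mem_compl_iff]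
    constructor
    · intro h y hy
      by_contra hlt
      exact hy (h (not_le.1 hlt))
    · intro h y hy
      by_contra hyΩ
      exact absurd hy (not_lt.2 (h y hyΩ))
  rw [this]
  exact isClosed_biInter fun y _ => isClosed_le continuous_const (by fun_prop)

/-- A semiconvex function vanishing on `∂Ω` whose gradient is, near `∂Ω`, close to the inner
normal. -/
def innerHeight (Ω : Set (𝔼 n)) (R : ℝ) (y : 𝔼 n) : ℝ :=
  (R ^ 2 - Metric.infDist y (centers Ω R) ^ 2) / (2 * R)

section innerHeight

variable {Ω : Set (𝔼 n)} {R : ℝ}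

lemma continuous_innerHeight : Continuous (innerHeight Ω R) := by
  unfold innerHeight
  have := Metric.continuous_infDist_pt (centers Ω R)
  fun_prop

/-- Adding `‖y‖² / (2R)` turns the function into the supremum, over centres `z`, of the affine
functions `(R² + 2⟪y, z⟫ - ‖z‖²) / (2R)`, which is convex. The supremum is attained at a nearest
centre. -/
lemma isSemiconvex_innerHeight (hR : 0 < R) (hne : (centers Ω R).Nonempty) :
    IsSemiconvex (1 / R) (innerHeight Ω R) := by
  refine ⟨convex_univ, fun x _ y _ a b ha hb hab => ?_⟩
  have hbound : ∀ z ∈ centers Ω R, ∀ y, (R ^ 2 + 2 * ⟪y, z⟫ - ‖z‖ ^ 2) / (2 * R)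
      ≤ innerHeight Ω R y + 1 / R / 2 * ‖y‖ ^ 2 := by
    intro z hz y
    have h1 : Metric.infDist y (centers Ω R) ≤ dist y z := Metric.infDist_le_dist_of_mem hz
    have h2 : Metric.infDist y (centers Ω R) ^ 2 ≤ ‖y - z‖ ^ 2 := by
      rw [← dist_eq_norm]
      exact pow_le_pow_left₀ Metric.infDist_nonneg h1 2
    rw [norm_sub_sq_real] at h2
    unfold innerHeight
    have e : (R ^ 2 - Metric.infDist y (centers Ω R) ^ 2) / (2 * R) + 1 / R / 2 * ‖y‖ ^ 2
        = (R ^ 2 - Metric.infDist y (centers Ω R) ^ 2 + ‖y‖ ^ 2) / (2 * R) := by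
      field_simp
    rw [e]
    gcongr
    linarith
  obtain ⟨z, hz, hdz⟩ := (isClosed_centers Ω R).exists_infDist_eq_dist hne (a • x + b • y)
  have heq : innerHeight Ω R (a • x + b • y) + 1 / R / 2 * ‖a • x + b • y‖ ^ 2
      = (R ^ 2 + 2 * ⟪a • x + b • y, z⟫ - ‖z‖ ^ 2) / (2 * R) := by
    unfold innerHeight
    rw [hdz, dist_eq_norm, norm_sub_sq_real]
    field_simp
    ring
  have hx := mul_le_mul_of_nonneg_left (hbound z hz x) ha
  have hy := mul_le_mul_of_nonneg_left (hbound z hz y) hb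
  simp only [smul_eq_mul]
  rw [heq]
  refine le_trans (le_of_eq ?_) (add_le_add hx hy)
  rw [inner_add_left, inner_smul_left, inner_smul_left]
  obtain rfl : b = 1 - a := by linarith
  simp only [conj_trivial]
  field_simp
  ring

/-- The touching ball supplies a centre at distance `R`. No centre is closer, since an open ball of
radius `R` around it would contain the boundary point, which is not in the open set `Ω`. -/
lemma infDist_centers_eq (hΩ : IsOpen Ω) (hsph : InteriorSphereCondition Ω R) {x : 𝔼 n}
    (hx : x ∈ frontier Ω) : Metric.infDist x (centers Ω R) = R := by
  obtain ⟨z, hz, hzΩ⟩ := hsph x hx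
  have hzc : z ∈ centers Ω R := hzΩ
  refine le_antisymm ((Metric.infDist_le_dist_of_mem hzc).trans hz.le) ?_
  refine (Metric.le_infDist ⟨z, hzc⟩).2 fun y hy => ?_
  by_contra h
  exact (hΩ.frontier_eq ▸ hx).2 (hy (not_le.1 h))

lemma innerHeight_eq_zero (hΩ : IsOpen Ω) (hsph : InteriorSphereCondition Ω R) {x : 𝔼 n}
    (hx : x ∈ frontier Ω) : innerHeight Ω R x = 0 := by
  simp [innerHeight, infDist_centers_eq hΩ hsph hx]

lemma mem_of_innerHeight_pos (hR : 0 < R) (hne : (centers Ω R).Nonempty) {y : 𝔼 n}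
    (hy : 0 < innerHeight Ω R y) : y ∈ Ω := by
  obtain ⟨z, hz, hdz⟩ := (isClosed_centers Ω R).exists_infDist_eq_dist hne y
  refine hz ?_
  unfold innerHeight at hy
  rw [hdz] at hy
  have h1 : 0 < R ^ 2 - dist y z ^ 2 := by
    by_contra h
    exact absurd hy (not_lt.2 (div_nonpos_of_nonpos_of_nonneg (not_lt.1 h) (by positivity)))
  exact lt_of_pow_lt_pow_left₀ 2 hR.le (by linarith)

lemma abs_innerHeight_sub_le (hR : 0 < R) {D : ℝ} {y y' : 𝔼 n}
    (hy : Metric.infDist y (centers Ω R) ≤ D) (hy' : Metric.infDist y' (centers Ω R) ≤ D) :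
    |innerHeight Ω R y - innerHeight Ω R y'| ≤ D / R * dist y y' := by
  set d := Metric.infDist y (centers Ω R)
  set d' := Metric.infDist y' (centers Ω R)
  have hd : 0 ≤ d := Metric.infDist_nonneg
  have hd' : 0 ≤ d' := Metric.infDist_nonneg
  have h1 : |d' - d| ≤ dist y y' := by
    rw [abs_sub_le_iff]
    have a1 := Metric.infDist_le_infDist_add_dist (s := centers Ω R) (x := y) (y := y')
    have a2 := Metric.infDist_le_infDist_add_dist (s := centers Ω R) (x := y') (y := y)
    rw [dist_comm y' y] at a2
    exact ⟨by linarith, by linarith⟩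
  have e : innerHeight Ω R y - innerHeight Ω R y' = (d' - d) * ((d + d') / (2 * R)) := by
    simp only [innerHeight, d, d']
    field_simp
    ring
  rw [e, abs_mul, abs_of_nonneg (a := (d + d') / (2 * R)) (by positivity), mul_comm]
  have h2 : (d + d') / (2 * R) ≤ D / R := by
    rw [div_le_div_iff₀ (by positivity) hR]
    nlinarith
  exact mul_le_mul h2 h1 (abs_nonneg _) (by have := hd.trans hy; positivity)

/-- One touching ball suffices: the distance to its centre bounds the distance to all centres from
above, so the height is bounded from below. -/
lemma le_innerHeight_ray (hR : 0 < R) {x ν : 𝔼 n} (hν : ‖ν‖ = 1) (hz : x + R • ν ∈ centers Ω R)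
    (e : 𝔼 n) (he : ‖e‖ = 1) (t : ℝ) :
    t * ⟪e, ν⟫ - t ^ 2 / (2 * R) ≤ innerHeight Ω R (x + t • e) := by
  have h1 : Metric.infDist (x + t • e) (centers Ω R) ≤ dist (x + t • e) (x + R • ν) :=
    Metric.infDist_le_dist_of_mem hz
  have h2 : Metric.infDist (x + t • e) (centers Ω R) ^ 2 ≤ ‖t • e - R • ν‖ ^ 2 := by
    refine (pow_le_pow_left₀ Metric.infDist_nonneg h1 2).trans (le_of_eq ?_)
    rw [dist_eq_norm]
    congr 2
    abel
  rw [norm_sub_sq_real, inner_smul_left, inner_smul_right, norm_smul, norm_smul, he, hν] at h2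
  simp only [conj_trivial, mul_one, Real.norm_eq_abs, sq_abs] at h2
  unfold innerHeight
  rw [le_div_iff₀ (by positivity), sub_mul, div_mul_cancel₀ _ (by positivity)]
  linarith

end innerHeight

/-! ### The ramp, gradient fields and further mollification bounds. -/

/-- A `C¹` ramp of slope two on a neighbourhood of `[1/2, 1]`. -/
lemma exists_ramp {c : ℝ} (hc : 0 < c) (hc' : c ≤ 1 / 100) :
    ∃ θ : ℝ → ℝ, ContDiff ℝ 1 θ ∧ (∀ u, 0 ≤ θ u ∧ θ u ≤ 1 + 48 * c) ∧ (∀ u ≤ 1 / 4, θ u = 0) ∧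
      (∀ u, 0 ≤ deriv θ u) ∧ ∀ u ∈ Icc (1 / 2 - 6 * c) (1 + 6 * c), deriv θ u = 2 := by
  -- `B - A = 1 / 2 + 24 c`, so a slope of at most two on `[A, B]` gives total height at most `1 +
  -- 48 c`; and `c ≤ 1 / 100` keeps `A` above `1 / 4`.
  set A := 1 / 2 - 12 * c with hA
  set B := 1 + 12 * c with hB
  -- The prescribed derivative: a trapezoid of height two, with flanks of length `6 c` on either
  -- side of the required plateau.
  set b : ℝ → ℝ := fun u => 2 * max 0 (min 1 (min ((u - A) / (6 * c)) ((B - u) / (6 * c)))) with hb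
  have hbc : Continuous b := by fun_prop
  have hb0 : ∀ u, 0 ≤ b u := fun u => by positivity
  have hb2 : ∀ u, b u ≤ 2 := fun u => by
    have : max 0 (min 1 (min ((u - A) / (6 * c)) ((B - u) / (6 * c)))) ≤ 1 :=
      max_le zero_le_one (min_le_left _ _)
    simp only [hb]
    linarith
  have hbA : ∀ u ≤ A, b u = 0 := fun u hu => by
    have : (u - A) / (6 * c) ≤ 0 := div_nonpos_of_nonpos_of_nonneg (by linarith) (by positivity)
    simp only [hb]
    rw [max_eq_left ((min_le_right _ _).trans ((min_le_left _ _).trans this)), mul_zero]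
  have hbB : ∀ u, B ≤ u → b u = 0 := fun u hu => by
    have : (B - u) / (6 * c) ≤ 0 := div_nonpos_of_nonpos_of_nonneg (by linarith) (by positivity)
    simp only [hb]
    rw [max_eq_left ((min_le_right _ _).trans ((min_le_right _ _).trans this)), mul_zero]
  have hbmid : ∀ u ∈ Icc (1 / 2 - 6 * c) (1 + 6 * c), b u = 2 := fun u hu => by
    have h1 : 1 ≤ (u - A) / (6 * c) := by rw [le_div_iff₀ (by positivity)]; linarith [hu.1]
    have h2 : 1 ≤ (B - u) / (6 * c) := by rw [le_div_iff₀ (by positivity)]; linarith [hu.2]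
    simp only [hb]
    rw [min_eq_left (le_min h1 h2), max_eq_right zero_le_one, mul_one]
  have hint : ∀ x y, IntervalIntegrable b volume x y := fun x y => hbc.intervalIntegrable x y
  set θ : ℝ → ℝ := fun u => ∫ x in A..u, b x with hθ
  have hder : ∀ u, HasDerivAt θ (b u) u := fun u => hbc.integral_hasStrictDerivAt A u |>.hasDerivAt
  have hderiv : deriv θ = b := funext fun u => (hder u).deriv
  have hmono : Monotone θ := monotone_of_deriv_nonneg (fun u => (hder u).differentiableAt)
    fun u => by rw [hderiv]; exact hb0 u
  have hzero : ∀ u ≤ A, θ u = 0 := fun u hu => by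
    simp only [hθ]
    rw [intervalIntegral.integral_congr (g := fun _ => 0)]
    · simp
    · intro x hx
      rw [uIcc_of_ge hu] at hx
      exact hbA x hx.2
  have hAB : A ≤ B := by linarith
  have hθB : θ B ≤ 1 + 48 * c := by
    have h1 : θ B ≤ ∫ x in A..B, (2 : ℝ) :=
      intervalIntegral.integral_mono_on hAB (hint _ _) (by simp) fun x _ => hb2 x
    rw [intervalIntegral.integral_const, smul_eq_mul] at h1
    linarith
  refine ⟨θ, contDiff_one_iff_deriv.2 ⟨fun u => (hder u).differentiableAt, hderiv ▸ hbc⟩,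
    fun u => ⟨?_, ?_⟩, fun u hu => hzero u (by linarith), fun u => by rw [hderiv]; exact hb0 u,
    fun u hu => by rw [hderiv]; exact hbmid u hu⟩
  · rcases le_total u A with h | h
    · exact (hzero u h).ge
    · exact (hzero A le_rfl).ge.trans (hmono h)
  · rcases le_total u B with h | h
    · exact (hmono h).trans hθB
    · have : θ u = θ B := by
        simp only [hθ]
        rw [← intervalIntegral.integral_add_adjacent_intervals (hint A B) (hint B u),
          intervalIntegral.integral_congr (g := fun _ => 0) (a := B)]
        · simp
        · intro x hx
          rw [uIcc_of_le h] at hx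
          exact hbB x hx.1
      rw [this]
      exact hθB

/-- The gradient of a function, in coordinates. -/
def gradField (q : (𝔼 n) → ℝ) (y : 𝔼 n) : 𝔼 n :=
  ∑ i, fderiv ℝ q y (EuclideanSpace.single i 1) • EuclideanSpace.single i (1 : ℝ)

lemma gradField_apply (q : (𝔼 n) → ℝ) (y : 𝔼 n) (i : Fin n) :
    gradField q y i = fderiv ℝ q y (EuclideanSpace.single i 1) := by
  simp [gradField, Finset.sum_apply, Pi.single_apply]

lemma inner_gradField (q : (𝔼 n) → ℝ) (y v : 𝔼 n) : ⟪gradField q y, v⟫ = fderiv ℝ q y v := by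
  conv_rhs => rw [← (EuclideanSpace.basisFun (Fin n) ℝ).sum_repr v, map_sum]
  simp [gradField, sum_inner, inner_smul_left, EuclideanSpace.inner_single_left, mul_comm]

lemma contDiff_gradField {q : (𝔼 n) → ℝ} (hq : ContDiff ℝ 2 q) : ContDiff ℝ 1 (gradField q) := by
  unfold gradField
  refine ContDiff.sum fun i _ => ?_
  have h : ContDiff ℝ 1 fun y => fderiv ℝ q y (EuclideanSpace.single i 1) :=
    (hq.fderiv_right (m := 1) (by norm_num)).clm_apply contDiff_const
  exact h.smul contDiff_const

lemma fderiv_apply_gradField (q : (𝔼 n) → ℝ) (y : 𝔼 n) :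
    fderiv ℝ q y (gradField q y) = ‖gradField q y‖ ^ 2 := by
  rw [← inner_gradField, real_inner_self_eq_norm_sq]

lemma norm_gradField_le (q : (𝔼 n) → ℝ) (y : 𝔼 n) : ‖gradField q y‖ ≤ ‖fderiv ℝ q y‖ := by
  have h := (le_abs_self _).trans ((fderiv ℝ q y).le_opNorm (gradField q y))
  rw [fderiv_apply_gradField] at h
  rcases (norm_nonneg (gradField q y)).eq_or_lt with h0 | h0
  · rw [← h0]; exact norm_nonneg _
  · nlinarith

/-- The divergence of the gradient is the trace of the Hessian, and semiconvexity bounds each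
diagonal entry below by `-κ`. -/
lemma divergence_gradField_ge {κ : ℝ} {q : (𝔼 n) → ℝ} (hq : ContDiff ℝ 2 q) (hs : IsSemiconvex κ q)
    (y : 𝔼 n) : -(n * κ) ≤ divergence (gradField q) y := by
  rw [divergence_eq_sum ((contDiff_gradField hq).differentiable one_ne_zero y)]
  simp_rw [gradField_apply]
  calc -(n * κ) = ∑ _i : Fin n, -κ := by simp
    _ ≤ _ := Finset.sum_le_sum fun i _ => hs.le_fderiv_fderiv hq (by simp) y

lemma abs_mollify_sub_le (φ : ContDiffBump (0 : 𝔼 n)) {f : (𝔼 n) → ℝ} (hf : Continuous f)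
    {y y' : 𝔼 n} {M : ℝ}
    (h : ∀ t, ‖t‖ < φ.rOut → |f (y - t) - f (y' - t)| ≤ M) :
    |mollify φ f y - mollify φ f y'| ≤ M := by
  have hint : ∀ x, Integrable fun t => φ.normed volume t * f (x - t) := fun x =>
    (φ.continuous_normed.mul (by fun_prop)).integrable_of_hasCompactSupport
      φ.hasCompactSupport_normed.mul_right
  rw [mollify_apply, mollify_apply, ← integral_sub (hint y) (hint y')]
  have hM : M = ∫ t, φ.normed volume t * M := by
    rw [integral_mul_const, φ.integral_normed, one_mul]
  rw [hM]
  refine (abs_integral_le_integral_abs).trans (integral_mono ((hint y).sub (hint y')).abs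
    (φ.integrable_normed.mul_const _) fun t => ?_)
  simp only
  rw [← mul_sub, abs_mul, abs_of_nonneg (φ.nonneg_normed t)]
  by_cases ht : φ.normed volume t = 0
  · simp [ht]
  · refine mul_le_mul_of_nonneg_left (h t ?_) (φ.nonneg_normed t)
    have : t ∈ Metric.ball (0 : 𝔼 n) φ.rOut := by
      rw [← φ.support_normed_eq (μ := volume)]; exact ht
    simpa using this

lemma abs_mollify_sub_self_le (φ : ContDiffBump (0 : 𝔼 n)) {f : (𝔼 n) → ℝ} (hf : Continuous f)
    {y : 𝔼 n} {M : ℝ} (h : ∀ z, dist z y < φ.rOut → |f z - f y| ≤ M) : |mollify φ f y - f y| ≤ M :=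
  ContDiffBump.dist_normed_convolution_le hf.aestronglyMeasurable fun z hz => h z hz

/-! ### Height and gradient in a boundary layer. -/

section boundaryLayer

variable {Ω : Set (𝔼 n)} {R : ℝ}

lemma infDist_centers_le (hΩ : IsOpen Ω) (hsph : InteriorSphereCondition Ω R) {x y : 𝔼 n}
    (hx : x ∈ frontier Ω) : Metric.infDist y (centers Ω R) ≤ R + dist y x := by
  have := Metric.infDist_le_infDist_add_dist (s := centers Ω R) (x := y) (y := x)
  rwa [infDist_centers_eq hΩ hsph hx] at this

lemma centers_nonempty (hsph : InteriorSphereCondition Ω R) (hne : (frontier Ω).Nonempty) :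
    (centers Ω R).Nonempty := by
  obtain ⟨x, hx⟩ := hne
  obtain ⟨z, _, hz⟩ := hsph x hx
  exact ⟨z, hz⟩

/-- Local Lipschitz bound for the inner height near the boundary. -/
lemma abs_innerHeight_sub_le_near (hΩ : IsOpen Ω) (hR : 0 < R) (hsph : InteriorSphereCondition Ω R)
    {c : ℝ} {x x' y y' : 𝔼 n} (hx : x ∈ frontier Ω) (hx' : x' ∈ frontier Ω)
    (hy : dist y x ≤ 2 * c * R) (hy' : dist y' x' ≤ 2 * c * R) :
    |innerHeight Ω R y - innerHeight Ω R y'| ≤ (1 + 2 * c) * dist y y' := by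
  have h1 : Metric.infDist y (centers Ω R) ≤ R * (1 + 2 * c) :=
    (infDist_centers_le hΩ hsph hx).trans (by linarith)
  have h2 : Metric.infDist y' (centers Ω R) ≤ R * (1 + 2 * c) :=
    (infDist_centers_le hΩ hsph hx').trans (by linarith)
  refine (abs_innerHeight_sub_le hR h1 h2).trans (le_of_eq ?_)
  field_simp

/-- A boundary point together with an admissible direction at scale `s`. -/
structure IsLayerPoint (Ω : Set (𝔼 n)) (R c s : ℝ) (x e : 𝔼 n) (t : ℝ) (h : 𝔼 n) : Prop where
  mem_frontier : x ∈ frontier Ω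
  norm_eq_one : ‖e‖ = 1
  exists_normal : ∃ ν : 𝔼 n, ‖ν‖ = 1 ∧ ‖ν - e‖ ≤ c ∧ x + R • ν ∈ centers Ω R
  half_lt : s / 2 < t
  lt : t < s
  norm_lt : ‖h‖ < c * s

/-- Two losses occur: tilting `e` away from the normal costs at most `c s`, and the curvature term
`t² / (2R)` at most `c s / 2`, because `t < s ≤ c R`. -/
lemma IsLayerPoint.ray_le (hR : 0 < R) {c s : ℝ} (hsR : s ≤ c * R) {x e : 𝔼 n} {t : ℝ} {h : 𝔼 n}
    (H : IsLayerPoint Ω R c s x e t h) :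
    t - 3 / 2 * c * s ≤ innerHeight Ω R (x + t • e) := by
  obtain ⟨ν, hν, hνe, hz⟩ := H.exists_normal
  have h0 : 0 < ‖h‖ + s := by
    have := H.half_lt; have := H.lt; have := norm_nonneg h; linarith
  have hs : 0 < s := by have := H.half_lt; have := H.lt; linarith
  have ht : 0 < t := by have := H.half_lt; linarith
  have h1 := le_innerHeight_ray hR hν hz e H.norm_eq_one t
  have h2 : 1 - c ≤ ⟪e, ν⟫ := by
    have h3 : ⟪e, ν⟫ = 1 + ⟪e, ν - e⟫ := by
      rw [inner_sub_right, real_inner_self_eq_norm_sq, H.norm_eq_one]; ring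
    have h4 := abs_le.1 (abs_real_inner_le_norm e (ν - e))
    rw [H.norm_eq_one, one_mul] at h4
    linarith [h4.1]
  have hc0 : 0 ≤ c := (norm_nonneg _).trans hνe
  have h5 : t ^ 2 / (2 * R) ≤ c * s / 2 := by
    rw [div_le_iff₀ (by positivity)]
    have hts := H.lt.le
    nlinarith [mul_le_mul hts hts ht.le hs.le]
  have h6 : t * (1 - c) ≤ t * ⟪e, ν⟫ := mul_le_mul_of_nonneg_left h2 ht.le
  have h7 : t * c ≤ s * c := mul_le_mul_of_nonneg_right H.lt.le hc0
  nlinarith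

lemma IsLayerPoint.dist_lt {c s : ℝ} (hc' : c ≤ 1 / 100) {x e : 𝔼 n} {t : ℝ}
    {h : 𝔼 n} (H : IsLayerPoint Ω R c s x e t h) : dist (x + t • e + h) x < 2 * s := by
  have hs : 0 < s := by have := H.half_lt; have := H.lt; linarith
  have ht : 0 < t := by have := H.half_lt; linarith
  rw [dist_eq_norm]
  have : x + t • e + h - x = t • e + h := by abel
  rw [this]
  refine (norm_add_le _ _).trans_lt ?_
  rw [norm_smul, H.norm_eq_one, Real.norm_of_nonneg ht.le]
  have := H.lt; have := H.norm_lt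
  nlinarith

/-- The height at `x + t • e` is more than `s / 2 - (3 / 2) c s`, and the shift by `h` changes it by
little more than `c s`; for `c ≤ 1 / 100` it stays positive. -/
lemma IsLayerPoint.mem (hΩ : IsOpen Ω) (hR : 0 < R) (hsph : InteriorSphereCondition Ω R)
    {c s : ℝ} (hc' : c ≤ 1 / 100) (hsR : s ≤ c * R) {x e : 𝔼 n} {t : ℝ}
    {h : 𝔼 n} (H : IsLayerPoint Ω R c s x e t h) : x + t • e + h ∈ Ω := by
  have hs : 0 < s := by have := H.half_lt; have := H.lt; linarith
  have ht : 0 < t := by have := H.half_lt; linarith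
  refine mem_of_innerHeight_pos hR (centers_nonempty hsph ⟨x, H.mem_frontier⟩) ?_
  have h1 := H.ray_le hR hsR
  have hd := H.dist_lt hc'
  have hd' : dist (x + t • e) x ≤ 2 * c * R := by
    rw [dist_eq_norm, add_sub_cancel_left, norm_smul, H.norm_eq_one, Real.norm_of_nonneg ht.le]
    have := H.lt
    linarith
  have h2 := abs_le.1 (abs_innerHeight_sub_le_near hΩ hR hsph (c := c) H.mem_frontier H.mem_frontier
    (by linarith : dist (x + t • e + h) x ≤ 2 * c * R) hd')
  have h3 : dist (x + t • e + h) (x + t • e) = ‖h‖ := by simp [dist_eq_norm]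
  rw [h3] at h2
  have := H.norm_lt; have := H.half_lt
  have hc0 : 0 < c := by
    have := norm_nonneg h
    by_contra hneg
    nlinarith
  have h4 : (1 + 2 * c) * ‖h‖ ≤ (1 + 2 * c) * (c * s) :=
    mul_le_mul_of_nonneg_left H.norm_lt.le (by linarith)
  nlinarith [h2.1, mul_pos hc0 hs]

/-- Bounds for the mollified inner height on a boundary layer. -/
lemma IsLayerPoint.mollify_bounds (hΩ : IsOpen Ω) (hR : 0 < R) (hsph : InteriorSphereCondition Ω R)
    {c s : ℝ} (hc : 0 < c) (hc' : c ≤ 1 / 100) (hsR : 4 * s ≤ c * R) (φ : ContDiffBump (0 : 𝔼 n))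
    (hφ : φ.rOut = c * s) {x e : 𝔼 n} {t : ℝ} {h : 𝔼 n} (H : IsLayerPoint Ω R c s x e t h) :
    mollify φ (innerHeight Ω R) (x + t • e + h) ∈ Icc ((1 / 2 - 6 * c) * s) ((1 + 6 * c) * s) ∧
    1 - 20 * c ≤ ‖gradField (mollify φ (innerHeight Ω R)) (x + t • e + h)‖ := by
  set f := innerHeight Ω R with hf
  set q := mollify φ f with hq
  set y := x + t • e + h with hy
  have hs : 0 < s := by have := H.half_lt; have := H.lt; linarith
  have ht : 0 < t := by have := H.half_lt; linarith
  have hts := H.lt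
  have hts2 := H.half_lt
  have hh := H.norm_lt
  have hcs : c * s ≤ s / 100 := by nlinarith
  have hfc : Continuous f := continuous_innerHeight
  have hfx : f x = 0 := innerHeight_eq_zero hΩ hsph H.mem_frontier
  have hLip : ∀ z z', dist z x ≤ 4 * s → dist z' x ≤ 4 * s → |f z - f z'| ≤ (1 + 2 * c) * dist z z' :=
    fun z z' hz hz' => abs_innerHeight_sub_le_near hΩ hR hsph H.mem_frontier H.mem_frontier
      (by nlinarith) (by nlinarith)
  have hyx : dist y x < 2 * s := H.dist_lt hc'
  -- Mollification at radius `c s` displaces a function of slope `1 + 2 c` by at most `(1 + 2 c) c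
  -- s`.
  have hqf : ∀ z, dist z x ≤ 2 * s → |q z - f z| ≤ (1 + 2 * c) * (c * s) := by
    intro z hz
    refine abs_mollify_sub_self_le φ hfc fun z' hz' => ?_
    rw [hφ] at hz'
    refine (hLip z' z ?_ (by linarith)).trans (mul_le_mul_of_nonneg_left hz'.le (by linarith))
    have := dist_triangle z' z x
    linarith
  have hc2 : (1 + 2 * c) * (c * s) ≤ 1.02 * (c * s) :=
    mul_le_mul_of_nonneg_right (by norm_num; linarith) (by positivity)
  have hxx : dist x x ≤ 4 * s := by rw [dist_self]; linarith
  have hte : dist (x + t • e) x = t := by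
    rw [dist_eq_norm, add_sub_cancel_left, norm_smul, H.norm_eq_one, Real.norm_of_nonneg ht.le, mul_one]
  have hyte : dist y (x + t • e) = ‖h‖ := by rw [dist_eq_norm, hy]; simp
  have hray : t - 3 / 2 * c * s ≤ f (x + t • e) := H.ray_le hR (by linarith)
  have hlow : t - 4 * (c * s) ≤ q y := by
    have h1 := (abs_le.1 (hqf y hyx.le)).1
    have h2 := (abs_le.1 (hLip y (x + t • e) (by linarith) (by linarith))).1
    rw [hyte] at h2
    have h3 : (1 + 2 * c) * ‖h‖ ≤ (1 + 2 * c) * (c * s) :=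
      mul_le_mul_of_nonneg_left hh.le (by linarith)
    nlinarith [mul_pos hc hs, mul_nonneg hc.le (mul_pos hc hs).le]
  have hup : q y ≤ t + 5 * (c * s) := by
    have h1 := (abs_le.1 (hqf y hyx.le)).2
    have h2 := (abs_le.1 (hLip y x (by linarith) hxx)).2
    have h3 : dist y x ≤ t + c * s := by
      have := dist_triangle y (x + t • e) x
      linarith
    have h4 : (1 + 2 * c) * dist y x ≤ (1 + 2 * c) * (t + c * s) :=
      mul_le_mul_of_nonneg_left h3 (by linarith)
    have h5 : c * t ≤ c * s := mul_le_mul_of_nonneg_left hts.le hc.le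
    rw [hfx] at h2
    nlinarith
  refine ⟨⟨by linarith [mul_pos hc hs], by linarith [mul_pos hc hs]⟩, ?_⟩
  have hyt : y - t • e = x + h := by rw [hy]; abel
  -- Going back by `t` along `e` leads to `x + h`, within `c s` of a boundary point, where the
  -- height vanishes.
  have hback : q (y - t • e) ≤ 3 * (c * s) := by
    rw [hyt]
    have hd : dist (x + h) x = ‖h‖ := by simp [dist_eq_norm]
    have h1 := (abs_le.1 (hqf (x + h) (by linarith))).2
    have h2 := (abs_le.1 (hLip (x + h) x (by linarith) hxx)).2
    rw [hd, hfx] at h2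
    have h3 : (1 + 2 * c) * ‖h‖ ≤ (1 + 2 * c) * (c * s) :=
      mul_le_mul_of_nonneg_left hh.le (by linarith)
    linarith [mul_pos hc hs]
  have hqs : IsSemiconvex (1 / R) q := (isSemiconvex_innerHeight hR
    (centers_nonempty hsph ⟨x, H.mem_frontier⟩)).mollify hfc φ
  have hq1 : ContDiff ℝ 1 q := contDiff_mollify φ hfc.locallyIntegrable 1
  have hder := hqs.le_fderiv hq1 H.norm_eq_one y ht
  -- The height increases by at least `t - 7 c s` over the length `t`, and `t > s / 2` gives the
  -- factor 14.
  have h1 : 1 - 14 * c ≤ (q y - q (y - t • e)) / t := by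
    rw [le_div_iff₀ ht]
    nlinarith
  have h2 : 1 / R * t / 2 ≤ c := by
    rw [one_div, inv_mul_eq_div, div_div, div_le_iff₀ (by positivity)]
    nlinarith
  calc 1 - 20 * c ≤ fderiv ℝ q y e := by linarith
    _ = ⟪gradField q y, e⟫ := (inner_gradField q y e).symm
    _ ≤ ‖gradField q y‖ * ‖e‖ := real_inner_le_norm _ _
    _ = ‖gradField q y‖ := by rw [H.norm_eq_one, mul_one]

end boundaryLayer

/-! ### The layer field and the estimate on bands. -/

section band

variable {Ω : Set (𝔼 n)} {R : ℝ}

/-- The layer field: a cut-off ramp of the mollified inner height times its gradient. -/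
def layerField (A s : ℝ) (χ : (𝔼 n) → ℝ) (θ : ℝ → ℝ) (q : (𝔼 n) → ℝ) (y : 𝔼 n) : 𝔼 n :=
  (A⁻¹ * (χ y * θ (q y / s))) • gradField q y

/-- Only the last term is of order `1 / s`, and it has a favourable sign when the ramp is
increasing. The first is bounded below by semiconvexity; the second involves the derivative of a
cutoff that does not depend on `s`. -/
lemma divergence_layerField {A s : ℝ} {χ : (𝔼 n) → ℝ} {θ : ℝ → ℝ} {q : (𝔼 n) → ℝ}
    (hχ : ContDiff ℝ 1 χ) (hθ : ContDiff ℝ 1 θ) (hq : ContDiff ℝ 2 q) (y : 𝔼 n) :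
    divergence (layerField A s χ θ q) y = A⁻¹ * (χ y * θ (q y / s) * divergence (gradField q) y
      + θ (q y / s) * fderiv ℝ χ y (gradField q y)
      + χ y * deriv θ (q y / s) / s * ‖gradField q y‖ ^ 2) := by
  have hχ' := hχ.differentiable one_ne_zero y
  have hq' : DifferentiableAt ℝ q y := hq.differentiable two_ne_zero y
  have hθq : HasFDerivAt (fun y => θ (q y / s)) (deriv θ (q y / s) • (s⁻¹ • fderiv ℝ q y)) y := by
    have h1 : HasFDerivAt (fun y => q y / s) (s⁻¹ • fderiv ℝ q y) y := by
      simpa [div_eq_inv_mul] using hq'.hasFDerivAt.const_mul s⁻¹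
    exact (hθ.differentiable one_ne_zero (q y / s)).hasDerivAt.comp_hasFDerivAt y h1
  have hF : HasFDerivAt (fun y => A⁻¹ * (χ y * θ (q y / s))) (A⁻¹ • (χ y • (deriv θ (q y / s) •
      (s⁻¹ • fderiv ℝ q y)) + θ (q y / s) • fderiv ℝ χ y)) y :=
    (hχ'.hasFDerivAt.mul hθq).const_mul A⁻¹
  have hg := (contDiff_gradField hq).differentiable one_ne_zero y
  unfold layerField
  rw [divergence_smul hF.differentiableAt hg, hF.fderiv]
  simp only [smul_apply, add_apply, smul_eq_mul,
    fderiv_apply_gradField]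
  ring

/-- Weighted estimate on boundary layers. -/
lemma exists_band_estimate (hΩ : IsOpen Ω) (hb : Bornology.IsBounded Ω) (hR : 0 < R)
    (hsph : InteriorSphereCondition Ω R) (hne : (frontier Ω).Nonempty)
    {c δ : ℝ} (hc : 0 < c) (hc' : c ≤ 1 / 100) (hδ : 0 < δ) :
    ∃ C s₀ : ℝ, 0 ≤ C ∧ 0 < s₀ ∧ s₀ ≤ c * R ∧ ∀ s, 0 < s → s < s₀ → ∀ S : Set (𝔼 n), MeasurableSet S →
      (∀ y ∈ S, ∃ x e t h, IsLayerPoint Ω R c s x e t h ∧ y = x + t • e + h) →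
      ∀ w : (𝔼 n) → ℝ, Integrable w →
        ENNReal.ofReal ((1 - 40 * c) * (2 / s) / ((1 + 48 * c) * (1 + 2 * c))) * ∫⁻ y in S, ‖w y‖ₑ
          ≤ variation w (Ω ∩ Metric.thickening δ (frontier Ω)) + ENNReal.ofReal (C * ∫ x, |w x|) := by
  have hfr : IsCompact (frontier Ω) := Metric.isCompact_of_isClosed_isBounded isClosed_frontier
    (hb.closure.subset frontier_subset_closure)
  -- The cutoff lives at the scale `δ₁`, fixed before `s`, so that the constant `C` does not depend
  -- on `s`.
  set δ₁ := min δ (c * R) with hδ₁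
  have hδ₁pos : 0 < δ₁ := lt_min hδ (mul_pos hc hR)
  have hcne := centers_nonempty hsph hne
  obtain ⟨χ, hχd, hχc, hχs, hχ01, hχ1⟩ := exists_cutoff
    (hfr.cthickening (r := δ₁ / 2)) (Metric.isOpen_thickening (δ := δ₁) (E := frontier Ω))
    (Metric.cthickening_subset_thickening' hδ₁pos (by linarith) _)
  obtain ⟨θ, hθd, hθ, hθ0, hθ', hθ2⟩ := exists_ramp hc hc'
  obtain ⟨M, hM⟩ := (hχd.continuous_fderiv one_ne_zero).bounded_above_of_compact_support
    (hχc.fderiv (𝕜 := ℝ))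
  have hM0 : 0 ≤ M := (norm_nonneg _).trans (hM 0)
  -- The normalisation: `1 + 48 c` bounds the ramp and `1 + 2 c` bounds `‖∇q‖` on the support of the
  -- cutoff.
  set A := (1 + 48 * c) * (1 + 2 * c) with hA
  have hA0 : 0 < A := by positivity
  set C := A⁻¹ * ((1 + 48 * c) * (n * (1 / R) + M * (1 + 2 * c))) with hC
  refine ⟨C, min (δ₁ / 4) (c * R / 4), by positivity, lt_min (by positivity) (by positivity),
    (min_le_right _ _).trans (by nlinarith [mul_pos hc hR]), ?_⟩
  intro s hs hss S hS hSl w hw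
  have hs1 : s < δ₁ / 4 := hss.trans_le (min_le_left _ _)
  have hs2 : 4 * s ≤ c * R := by linarith [hss.trans_le (min_le_right _ _)]
  have hcs : c * s ≤ s / 100 := by nlinarith
  set f := innerHeight Ω R with hf
  have hfc : Continuous f := continuous_innerHeight
  let φ : ContDiffBump (0 : 𝔼 n) := ⟨c * s / 2, c * s, by positivity, by linarith [mul_pos hc hs]⟩
  have hφ : φ.rOut = c * s := rfl
  set q := mollify φ f with hq
  have hqd : ContDiff ℝ 2 q := contDiff_mollify φ hfc.locallyIntegrable 2
  have hqs : IsSemiconvex (1 / R) q := (isSemiconvex_innerHeight hR hcne).mollify hfc φ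
  have hLip : ∀ x ∈ frontier Ω, ∀ x' ∈ frontier Ω, ∀ y y', dist y x ≤ 2 * c * R →
      dist y' x' ≤ 2 * c * R → |f y - f y'| ≤ (1 + 2 * c) * dist y y' :=
    fun x hx x' hx' y y' hy hy' => abs_innerHeight_sub_le_near hΩ hR hsph hx hx' hy hy'
  have hnear : ∀ y ∈ Metric.thickening δ₁ (frontier Ω), ∃ x ∈ frontier Ω, dist y x < c * R := by
    intro y hy
    obtain ⟨x, hx, hyx⟩ := Metric.mem_thickening_iff.1 hy
    exact ⟨x, hx, hyx.trans_le (min_le_right _ _)⟩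
  have hgrad : ∀ y ∈ Metric.thickening δ₁ (frontier Ω), ‖gradField q y‖ ≤ 1 + 2 * c := by
    intro y hy
    refine (norm_gradField_le q y).trans (norm_fderiv_le_of_lip' ℝ (by positivity) ?_)
    filter_upwards [Metric.isOpen_thickening.mem_nhds hy] with y' hy'
    obtain ⟨x, hx, hyx⟩ := hnear y hy
    obtain ⟨x', hx', hyx'⟩ := hnear y' hy'
    rw [Real.norm_eq_abs, ← dist_eq_norm]
    refine abs_mollify_sub_le φ hfc fun t ht => ?_
    rw [hφ] at ht
    have e1 : ∀ z p : 𝔼 n, dist z p < c * R → dist (z - t) p ≤ 2 * c * R := by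
      intro z p hz
      have h1 := dist_triangle (z - t) z p
      have h2 : dist (z - t) z = ‖t‖ := by simp
      linarith
    have := hLip x' hx' x hx (y' - t) (y - t) (e1 _ _ hyx') (e1 _ _ hyx)
    rwa [dist_sub_right] at this
  have hqf : ∀ y ∈ Metric.thickening δ₁ (frontier Ω), |q y - f y| ≤ (1 + 2 * c) * (c * s) := by
    intro y hy
    obtain ⟨x, hx, hyx⟩ := hnear y hy
    refine abs_mollify_sub_self_le φ hfc fun z hz => ?_
    rw [hφ] at hz
    refine (hLip x hx x hx z y ?_ (by linarith)).trans
      (mul_le_mul_of_nonneg_left hz.le (by positivity))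
    have := dist_triangle z y x
    linarith
  set Y := layerField A s χ θ q with hY
  have hχ0 : ∀ y, y ∉ Metric.thickening δ₁ (frontier Ω) → χ y = 0 ∧ fderiv ℝ χ y = 0 := by
    intro y hy
    have hy' : y ∉ tsupport χ := fun h => hy (hχs h)
    exact ⟨image_eq_zero_of_notMem_tsupport hy', fderiv_of_notMem_tsupport (𝕜 := ℝ) hy'⟩
  have hYsupp : tsupport Y ⊆ tsupport χ ∩ {y | s / 4 ≤ q y} := by
    refine closure_minimal (fun y hy => ?_) ((isClosed_tsupport _).inter
      (isClosed_le continuous_const hqd.continuous))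
    have h1 : A⁻¹ * (χ y * θ (q y / s)) ≠ 0 := fun h => hy (by simp [hY, layerField, h])
    refine ⟨subset_tsupport _ fun h => h1 (by simp [h]), ?_⟩
    by_contra h
    refine h1 ?_
    rw [hθ0 (q y / s) (by rw [div_le_iff₀ hs]; linarith [not_le.1 (show ¬ s / 4 ≤ q y from h)])]
    simp
  have hunit : IsUnitField (Ω ∩ Metric.thickening δ (frontier Ω)) Y := by
    refine ⟨?_, ?_, ?_, ?_⟩
    · have h1 : ContDiff ℝ 1 fun y => A⁻¹ * (χ y * θ (q y / s)) :=
        contDiff_const.mul (hχd.mul (hθd.comp ((hqd.of_le (by norm_num)).div_const s)))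
      exact h1.smul (contDiff_gradField hqd)
    · exact hχc.of_isClosed_subset (isClosed_tsupport _) (hYsupp.trans inter_subset_left)
    · intro y hy
      have hyT := hχs (hYsupp hy).1
      -- The ramp vanishes where `q < s / 4`. Since `q` and the inner height differ by at most `2 c
      -- s`, the inner height is positive on the support, which therefore lies in `Ω`.
      refine ⟨mem_of_innerHeight_pos hR hcne ?_,
        Metric.thickening_mono (min_le_left _ _) _ hyT⟩
      have h1 := (abs_le.1 (hqf y hyT)).2
      have h2 : s / 4 ≤ q y := (hYsupp hy).2
      have h3 : (1 + 2 * c) * (c * s) ≤ 2 * (c * s) :=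
        mul_le_mul_of_nonneg_right (by linarith) (by positivity)
      change 0 < f y
      linarith
    · intro y
      by_cases hy : y ∈ Metric.thickening δ₁ (frontier Ω)
      · rw [hY, layerField, norm_smul, Real.norm_eq_abs, abs_mul, abs_mul, abs_of_pos (inv_pos.2 hA0),
          abs_of_nonneg (hχ01 y).1, abs_of_nonneg (hθ _).1, inv_mul_eq_div, div_mul_eq_mul_div,
          div_le_one hA0, hA]
        refine mul_le_mul ?_ (hgrad y hy) (norm_nonneg _) (by positivity)
        exact (mul_le_mul (hχ01 y).2 (hθ _).2 (hθ _).1 zero_le_one).trans (by rw [one_mul])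
      · simp [hY, layerField, (hχ0 y hy).1]
  have hlow : ∀ y, A⁻¹ * (χ y * deriv θ (q y / s) / s * ‖gradField q y‖ ^ 2)
      ≤ divergence Y y + C := by
    intro y
    rw [hY, divergence_layerField hχd hθd hqd, hC, ← mul_add]
    refine mul_le_mul_of_nonneg_left ?_ (inv_pos.2 hA0).le
    have hdiv := divergence_gradField_ge hqd hqs y
    have hp0 : 0 ≤ χ y * θ (q y / s) := mul_nonneg (hχ01 y).1 (hθ _).1
    have hp1 : χ y * θ (q y / s) ≤ 1 + 48 * c :=
      (mul_le_mul (hχ01 y).2 (hθ _).2 (hθ _).1 zero_le_one).trans (by rw [one_mul])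
    have h1 : -((1 + 48 * c) * (n * (1 / R))) ≤ χ y * θ (q y / s) * divergence (gradField q) y := by
      have a1 := mul_le_mul_of_nonneg_left hdiv hp0
      have a2 := mul_le_mul_of_nonneg_right hp1 (by positivity : 0 ≤ (n : ℝ) * (1 / R))
      linarith
    have h2 : -((1 + 48 * c) * (M * (1 + 2 * c)))
        ≤ θ (q y / s) * fderiv ℝ χ y (gradField q y) := by
      by_cases hy : y ∈ Metric.thickening δ₁ (frontier Ω)
      · have a1 : |fderiv ℝ χ y (gradField q y)| ≤ M * (1 + 2 * c) :=
          ((fderiv ℝ χ y).le_opNorm _).trans (mul_le_mul (hM y) (hgrad y hy) (norm_nonneg _) hM0)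
        have a2 : |θ (q y / s) * fderiv ℝ χ y (gradField q y)|
            ≤ (1 + 48 * c) * (M * (1 + 2 * c)) := by
          rw [abs_mul, abs_of_nonneg (hθ _).1]
          exact mul_le_mul (hθ _).2 a1 (abs_nonneg _) (by positivity)
        exact (abs_le.1 a2).1
      · rw [(hχ0 y hy).2, zero_apply, mul_zero]
        exact neg_nonpos.2 (by positivity)
    linarith
  have hnn : ∀ y, 0 ≤ A⁻¹ * (χ y * deriv θ (q y / s) / s * ‖gradField q y‖ ^ 2) := fun y => by
    have := (hχ01 y).1; have := hθ' (q y / s); positivity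
  -- On the band the cutoff is one and the ramp has slope two, while `‖∇q‖² ≥ (1 - 20 c)² ≥ 1 - 40
  -- c`.
  set m := (1 - 40 * c) * (2 / s) / A with hm
  have hm0 : 0 ≤ m := by
    have : 0 ≤ 1 - 40 * c := by linarith
    positivity
  have hfS : ∀ y, S.indicator (fun _ => m) y ≤ divergence Y y + C := by
    intro y
    by_cases hy : y ∈ S
    · rw [indicator_of_mem hy]
      refine le_trans ?_ (hlow y)
      obtain ⟨x, e, t, h, H, rfl⟩ := hSl y hy
      obtain ⟨hqb, hgb⟩ := H.mollify_bounds hΩ hR hsph hc hc' hs2 φ hφ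
      have hd := H.dist_lt hc'
      set y := x + t • e + h
      have hχy : χ y = 1 := hχ1 y (Metric.mem_cthickening_of_dist_le y x _ _ H.mem_frontier
        (by linarith))
      have hθy : deriv θ (q y / s) = 2 := by
        refine hθ2 _ ⟨?_, ?_⟩
        · rw [le_div_iff₀ hs]; exact hqb.1
        · rw [div_le_iff₀ hs]; exact hqb.2
      rw [hχy, hθy, one_mul, hm, inv_mul_eq_div, mul_comm]
      gcongr
      change 1 - 20 * c ≤ ‖gradField q y‖ at hgb
      nlinarith
    · rw [indicator_of_notMem hy]
      exact (hnn y).trans (hlow y)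
  have key := lintegral_mul_abs_le_variation hw
    (hΩ.inter Metric.isOpen_thickening) hunit (measurable_const.indicator hS)
    (fun y => indicator_nonneg (fun _ _ => hm0) y) (by positivity : 0 ≤ C) hfS
  refine le_trans (le_of_eq ?_) key
  rw [← lintegral_const_mul'' _ hw.1.enorm.restrict, ← lintegral_indicator hS]
  refine lintegral_congr fun y => ?_
  by_cases hy : y ∈ S
  · rw [indicator_of_mem hy, indicator_of_mem hy, ENNReal.ofReal_mul hm0, Real.enorm_eq_ofReal_abs]
  · rw [indicator_of_notMem hy, indicator_of_notMem hy]; simp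

end band

/-! ### Decomposition of the boundary into flat pieces. -/

section pieces

variable {Ω : Set (𝔼 n)} {R : ℝ}

/-- A compact piece of the boundary that is a nearly flat graph in the direction `e`, and whose
inner normals are close to `e`. -/
structure IsFlatPiece (Ω : Set (𝔼 n)) (R c : ℝ) (A : Set (𝔼 n)) (e : 𝔼 n) : Prop where
  isCompact : IsCompact A
  subset_frontier : A ⊆ frontier Ω
  norm_eq_one : ‖e‖ = 1
  exists_normal : ∀ x ∈ A, ∃ ν : 𝔼 n, ‖ν‖ = 1 ∧ ‖ν - e‖ ≤ c ∧ x + R • ν ∈ centers Ω R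
  exists_graph : ∃ ψ : Hyper e → ℝ, LipschitzWith (4 * c).toNNReal ψ ∧
    ∀ x ∈ A, ψ (hyperProj norm_eq_one x) = ⟪e, x⟫

/-- A boundary point lies outside the open ball touching at `x`; expanding `‖x' - x - R ν‖² ≥ R²`
gives the estimate. -/
lemma inner_sub_le_of_mem_centers (hΩ : IsOpen Ω) (hR : 0 < R) {x x' ν : 𝔼 n} (hν : ‖ν‖ = 1)
    (hx : x + R • ν ∈ centers Ω R) (hx' : x' ∈ frontier Ω) :
    ⟪x' - x, ν⟫ ≤ ‖x' - x‖ ^ 2 / (2 * R) := by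
  have h1 : R ≤ ‖(x' - x) - R • ν‖ := by
    by_contra h
    refine (hΩ.frontier_eq ▸ hx').2 (hx ?_)
    rw [Metric.mem_ball, dist_eq_norm, ← sub_sub]
    exact not_le.1 h
  have h2 := pow_le_pow_left₀ hR.le h1 2
  rw [norm_sub_sq_real, norm_smul, hν, inner_smul_right, Real.norm_of_nonneg hR.le] at h2
  rw [le_div_iff₀ (by positivity)]
  linarith

lemma norm_sub_le_of_inner_le {e : 𝔼 n} (he : ‖e‖ = 1) {c : ℝ} (hc : 0 < c) (hc' : c ≤ 1 / 100)
    {u : 𝔼 n} (h : |⟪e, u⟫| ≤ 2 * c * ‖u‖) : |⟪e, u⟫| ≤ 4 * c * ‖u - ⟪e, u⟫ • e‖ := by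
  have h1 : ‖u‖ ≤ ‖u - ⟪e, u⟫ • e‖ + |⟪e, u⟫| := by
    have := norm_le_norm_sub_add u (⟪e, u⟫ • e)
    rwa [norm_smul, he, mul_one, Real.norm_eq_abs] at this
  have h2 := abs_nonneg ⟪e, u⟫
  nlinarith [norm_nonneg (u - ⟪e, u⟫ • e)]

/-- The pairs of a boundary point and a unit vector pointing to a touching centre form a compact
set, which finitely many small balls cover. For two points from one ball, each touching ball
excludes the other point. The two resulting one-sided bounds say that the piece is a graph of slope
at most `4 c` in the common direction. -/
lemma exists_flatPieces (hΩ : IsOpen Ω) (hb : Bornology.IsBounded Ω) (hR : 0 < R)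
    (hsph : InteriorSphereCondition Ω R) {c : ℝ} (hc : 0 < c) (hc' : c ≤ 1 / 100) :
    ∃ (N : ℕ) (A : ℕ → Set (𝔼 n)) (e : ℕ → 𝔼 n), (∀ i < N, IsFlatPiece Ω R c (A i) (e i)) ∧
      frontier Ω = ⋃ i < N, A i := by
  have hfr : IsCompact (frontier Ω) := Metric.isCompact_of_isClosed_isBounded isClosed_frontier
    (hb.closure.subset frontier_subset_closure)
  have hsphere : IsCompact (Metric.sphere (0 : 𝔼 n) 1) := isCompact_sphere _ _
  set Z : Set ((𝔼 n) × (𝔼 n)) :=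
    (frontier Ω ×ˢ Metric.sphere 0 1) ∩ {p | p.1 + R • p.2 ∈ centers Ω R} with hZ
  have hZc : IsCompact Z := (hfr.prod hsphere).inter_right
    ((isClosed_centers Ω R).preimage (by fun_prop : Continuous fun p : (𝔼 n) × (𝔼 n) => p.1 + R • p.2))
  -- The bound `c` keeps the normals close to `e`; the bound `c R` makes the quadratic error `‖x' -
  -- x‖² / (2R)` at most `c ‖x' - x‖`.
  set r := min c (c * R) with hr
  have hr0 : 0 < r := lt_min hc (mul_pos hc hR)
  obtain ⟨t, htZ, htfin, ht⟩ := hZc.finite_cover_balls hr0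
  obtain ⟨l, hl⟩ : ∃ l : List ((𝔼 n) × (𝔼 n)), ∀ p, p ∈ l ↔ p ∈ t :=
    ⟨htfin.toFinset.toList, by simp⟩
  set P : (𝔼 n) × (𝔼 n) → Set (𝔼 n) := fun p => Prod.fst '' (Z ∩ Metric.closedBall p r) with hP
  have hpiece : ∀ p ∈ Z, IsFlatPiece Ω R c (P p) p.2 := by
    intro p hp
    have hpe : ‖p.2‖ = 1 := by simpa using hp.1.2
    have hnormal : ∀ x ∈ P p, dist x p.1 ≤ r ∧ x ∈ frontier Ω ∧
        ∃ ν : 𝔼 n, ‖ν‖ = 1 ∧ ‖ν - p.2‖ ≤ c ∧ x + R • ν ∈ centers Ω R := by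
      rintro _ ⟨⟨x, ν⟩, ⟨hxν, hd⟩, rfl⟩
      rw [Metric.mem_closedBall, Prod.dist_eq, max_le_iff] at hd
      exact ⟨hd.1, hxν.1.1, ν, by simpa using hxν.1.2,
        (dist_eq_norm ν p.2 ▸ hd.2).trans (min_le_left _ _), hxν.2⟩
    have hone : ∀ x ∈ P p, ∀ x' ∈ P p, ⟪p.2, x' - x⟫ ≤ 2 * c * ‖x' - x‖ := by
      intro x hx x' hx'
      obtain ⟨hxp, -, ν, hν, hνc, hνZ⟩ := hnormal x hx
      obtain ⟨hxp', hxf', -⟩ := hnormal x' hx'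
      have h1 := inner_sub_le_of_mem_centers hΩ hR hν hνZ hxf'
      have h2 : ‖x' - x‖ ≤ 2 * (c * R) := by
        rw [← dist_eq_norm]
        have := dist_triangle_right x' x p.1
        have := min_le_right c (c * R)
        linarith
      have h3 : ‖x' - x‖ ^ 2 / (2 * R) ≤ c * ‖x' - x‖ := by
        rw [div_le_iff₀ (by positivity)]
        nlinarith [norm_nonneg (x' - x)]
      have h4 : ⟪p.2, x' - x⟫ = ⟪x' - x, ν⟫ - ⟪x' - x, ν - p.2⟫ := by
        rw [inner_sub_right (x' - x), sub_sub_cancel]; exact real_inner_comm _ _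
      have h5 := (abs_le.1 (abs_real_inner_le_norm (x' - x) (ν - p.2))).1
      have h6 : ‖x' - x‖ * ‖ν - p.2‖ ≤ ‖x' - x‖ * c :=
        mul_le_mul_of_nonneg_left hνc (norm_nonneg _)
      linarith
    have hlip : ∀ x ∈ P p, ∀ x' ∈ P p,
        |⟪p.2, x⟫ - ⟪p.2, x'⟫| ≤ 4 * c * dist (hyperProj hpe x) (hyperProj hpe x') := by
      intro x hx x' hx'
      have h1 : |⟪p.2, x - x'⟫| ≤ 2 * c * ‖x - x'‖ := by
        refine abs_le.2 ⟨?_, hone x' hx' x hx⟩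
        have := hone x hx x' hx'
        rw [← neg_sub x x', inner_neg_right, norm_neg] at this
        linarith
      have h2 := norm_sub_le_of_inner_le hpe hc hc' h1
      rw [← inner_sub_right]
      refine h2.trans (le_of_eq ?_)
      rw [Subtype.dist_eq, dist_eq_norm]
      congr 2
      simp only [hyperProj, inner_sub_right, sub_smul]
      abel
    refine ⟨(hZc.inter_right Metric.isClosed_closedBall).image continuous_fst,
      fun x hx => (hnormal x hx).2.1, hpe, fun x hx => (hnormal x hx).2.2, ?_⟩
    -- The height of a chosen preimage. By `hlip`, points with the same projection have the same
    -- height, so the choice is immaterial; the function is Lipschitz on the projection and extends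
    -- to the hyperplane.
    set f : Hyper p.2 → ℝ := fun y => ⟪p.2, Function.invFunOn (hyperProj hpe) (P p) y⟫ with hf
    have hinv : ∀ x ∈ P p, Function.invFunOn (hyperProj hpe) (P p) (hyperProj hpe x) ∈ P p ∧
        hyperProj hpe (Function.invFunOn (hyperProj hpe) (P p) (hyperProj hpe x)) = hyperProj hpe x :=
      fun x hx => ⟨Function.invFunOn_mem ⟨x, hx, rfl⟩, Function.invFunOn_eq ⟨x, hx, rfl⟩⟩
    have hfl : LipschitzOnWith (4 * c).toNNReal f (hyperProj hpe '' P p) := by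
      refine LipschitzOnWith.of_dist_le_mul ?_
      rintro _ ⟨x, hx, rfl⟩ _ ⟨x', hx', rfl⟩
      rw [Real.coe_toNNReal _ (by positivity), Real.dist_eq]
      have := hlip _ (hinv x hx).1 _ (hinv x' hx').1
      rwa [(hinv x hx).2, (hinv x' hx').2] at this
    obtain ⟨ψ, hψ, hψf⟩ := hfl.extend_real
    refine ⟨ψ, hψ, fun x hx => ?_⟩
    rw [← hψf ⟨x, hx, rfl⟩, hf]
    have := hlip _ (hinv x hx).1 x hx
    rw [(hinv x hx).2, dist_self, mul_zero] at this
    exact sub_eq_zero.1 (abs_eq_zero.1 (le_antisymm this (abs_nonneg _)))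
  refine ⟨l.length, fun i => P (l.getD i 0), fun i => (l.getD i 0).2, fun i hi => ?_, ?_⟩
  · refine hpiece _ (htZ ((hl _).1 ?_))
    rw [List.getD_eq_getElem _ _ hi]
    exact List.getElem_mem hi
  · refine Subset.antisymm (fun x hx => ?_) (iUnion₂_subset fun i hi => ?_)
    · obtain ⟨z, hz, hzΩ⟩ := hsph x hx
      have hxZ : (x, R⁻¹ • (z - x)) ∈ Z := by
        refine ⟨⟨hx, ?_⟩, ?_⟩
        · rw [mem_sphere_zero_iff_norm, norm_smul, ← dist_eq_norm, dist_comm, hz,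
            Real.norm_of_nonneg (inv_pos.2 hR).le, inv_mul_cancel₀ hR.ne']
        · change x + R • R⁻¹ • (z - x) ∈ centers Ω R
          rw [smul_inv_smul₀ hR.ne', add_sub_cancel]
          exact hzΩ
      obtain ⟨p, hp, hxp⟩ := mem_iUnion₂.1 (ht hxZ)
      obtain ⟨i, hi, hip⟩ := List.getElem_of_mem ((hl p).2 hp)
      refine mem_iUnion₂.2 ⟨i, hi, ?_⟩
      simp only [List.getD_eq_getElem _ _ hi, hip]
      exact ⟨_, ⟨hxZ, Metric.ball_subset_closedBall hxp⟩, rfl⟩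
    · rintro x ⟨q, hq, rfl⟩
      exact hq.1.1.1

/-- A Lipschitz parametrisation distorts surface measure by at most its constant to the power `n -
1`. For flat pieces this factor tends to one as `c → 0`, which preserves sharpness. -/
lemma IsFlatPiece.lintegral_le {c : ℝ} {A : Set (𝔼 n)} {e : 𝔼 n} (he : ‖e‖ = 1) {ψ : Hyper e → ℝ}
    (hψ : LipschitzWith (4 * c).toNNReal ψ) (hA : ∀ x ∈ A, ψ (hyperProj he x) = ⟪e, x⟫)
    {F : (𝔼 n) → ℝ≥0∞} (hF : Measurable F) :
    ∫⁻ x in A, F x ∂(μHE[n - 1]) ≤ ((1 + (4 * c).toNNReal : ℝ≥0) : ℝ≥0∞) ^ (n - 1) *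
      ∫⁻ y in (fun y : Hyper e => graphHomeo he hψ.continuous (y, 0)) ⁻¹' A,
        F (graphHomeo he hψ.continuous (y, 0)) := by
  set G : Hyper e → 𝔼 n := fun y => graphHomeo he hψ.continuous (y, 0) with hG
  have hGm : Measurable G := ((graphHomeo he hψ.continuous).continuous.comp (by fun_prop)).measurable
  have hGA : ∀ x ∈ A, G (hyperProj he x) = x := by
    intro x hx
    simp only [hG, graphHomeo_apply, hA x hx, add_zero]
    simp [hyperProj]
  have hle : (μHE[n - 1]).restrict A ≤ ((1 + (4 * c).toNNReal : ℝ≥0) : ℝ≥0∞) ^ (n - 1) •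
      (volume.restrict (G ⁻¹' A)).map G := by
    refine Measure.le_iff.2 fun B hB => ?_
    rw [Measure.restrict_apply hB, Measure.smul_apply, Measure.map_apply hGm hB,
      Measure.restrict_apply (hGm hB), smul_eq_mul, ← preimage_inter]
    refine le_trans (measure_mono fun x hx => ?_)
      (euclideanHausdorffMeasure_graph_le he hψ.continuous hψ (G ⁻¹' (B ∩ A)))
    exact ⟨hyperProj he x, by rw [mem_preimage, hGA x hx.2]; exact hx, hGA x hx.2⟩
  refine (lintegral_mono' hle le_rfl).trans (le_of_eq ?_)
  rw [lintegral_smul_measure, lintegral_map hF hGm, smul_eq_mul]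

/-- Finitely many flat pieces cover the boundary, and each is controlled by the measure of a compact
projection. -/
lemma isFiniteMeasure_surfaceMeasure (hΩ : IsOpen Ω) (hb : Bornology.IsBounded Ω) (hR : 0 < R)
    (hsph : InteriorSphereCondition Ω R) : IsFiniteMeasure (surfaceMeasure Ω) := by
  obtain ⟨N, A, e, hA, hcov⟩ := exists_flatPieces hΩ hb hR hsph (c := 1 / 100) (by norm_num) le_rfl
  refine ⟨?_⟩
  rw [surfaceMeasure, Measure.restrict_apply MeasurableSet.univ, univ_inter, hcov]
  have hfin : ∀ i < N, μHE[n - 1] (A i) < ∞ := by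
    intro i hi
    obtain ⟨ψ, hψ, hψA⟩ := (hA i hi).exists_graph
    have h := IsFlatPiece.lintegral_le (hA i hi).norm_eq_one hψ hψA
      (F := fun _ => 1) measurable_const
    rw [setLIntegral_one, setLIntegral_one] at h
    refine h.trans_lt (ENNReal.mul_lt_top (by finiteness) ?_)
    refine (measure_mono fun y hy => ?_).trans_lt
      ((hA i hi).isCompact.image (continuous_hyperProj (hA i hi).norm_eq_one)).measure_lt_top
    refine ⟨_, hy, ?_⟩
    simp only [graphHomeo_apply, add_zero]
    exact hyperProj_add_smul _ _ _
  exact measure_biUnion_lt_top (finite_lt_nat N) hfin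

end pieces

/-! ### Averages above the boundary. -/

section layerAvg

variable {Ω : Set (𝔼 n)} {R : ℝ}

/-- The box of parameters `(h, t)` with `|h| < c s` and `s / 2 < t < s`. -/
def layerBox (n : ℕ) (c s : ℝ) : Set ((𝔼 n) × ℝ) := Metric.ball 0 (c * s) ×ˢ Ioo (s / 2) s

lemma volume_layerBox {c s : ℝ} : (volume.prod volume) (layerBox n c s)
    = volume (Metric.ball (0 : 𝔼 n) (c * s)) * ENNReal.ofReal (s / 2) := by
  rw [layerBox, Measure.prod_prod, Real.volume_Ioo]
  congr 2
  ring

lemma volume_layerBox_ne_zero {c s : ℝ} (hc : 0 < c) (hs : 0 < s) :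
    (volume.prod volume) (layerBox n c s) ≠ 0 := by
  rw [volume_layerBox]
  refine mul_ne_zero (Metric.measure_ball_pos _ _ (mul_pos hc hs)).ne' ?_
  simpa using half_pos hs

lemma volume_layerBox_ne_top {c s : ℝ} : (volume.prod volume) (layerBox n c s) ≠ ∞ := by
  rw [volume_layerBox]
  exact ENNReal.mul_ne_top measure_ball_lt_top.ne ENNReal.ofReal_ne_top

/-- The average of `|w|` over the box at height about `s` above `x` in the direction `e`. -/
def layerAvg (c s : ℝ) (e : 𝔼 n) (w : (𝔼 n) → ℝ) (x : 𝔼 n) : ℝ≥0∞ :=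
  ((volume.prod volume) (layerBox n c s))⁻¹ *
    ∫⁻ p in layerBox n c s, ‖w (x + p.2 • e + p.1)‖ₑ ∂(volume.prod volume)

lemma measurable_layerAvg {c s : ℝ} {e : 𝔼 n} {w : (𝔼 n) → ℝ} (hw : Measurable w) :
    Measurable (layerAvg c s e w) := by
  refine Measurable.const_mul ?_ _
  have h : Measurable fun q : (𝔼 n) × ((𝔼 n) × ℝ) => ‖w (q.1 + q.2.2 • e + q.2.1)‖ₑ :=
    (hw.comp (by fun_prop)).enorm
  exact h.lintegral_prod_right'

/-- The points averaged over lie in `Ω ∩ B_{2s}(x)`, and at each height they fill a ball whose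
volume is a fixed fraction of that of `B_{2s}`. The vanishing mean oscillation in the definition of
the trace therefore forces the averages to come close to the trace. -/
lemma IsFlatPiece.enorm_le_liminf_layerAvg (hΩ : IsOpen Ω) (hR : 0 < R)
    (hsph : InteriorSphereCondition Ω R) {c : ℝ} (hc : 0 < c) (hc' : c ≤ 1 / 100)
    {A : Set (𝔼 n)} {e : 𝔼 n} (hA : IsFlatPiece Ω R c A e) {w : (𝔼 n) → ℝ} (hw : Measurable w)
    {x : 𝔼 n} (hx : x ∈ A) {T : ℝ} (hT : HasTrace Ω w x T) {s : ℕ → ℝ} (hs0 : ∀ k, 0 < s k)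
    (hs : Tendsto s atTop (𝓝 0)) :
    ‖T‖ₑ ≤ liminf (fun k => layerAvg c (s k) e w x) atTop := by
  refine ENNReal.le_of_forall_pos_le_add fun a ha _ => ?_
  rw [← tsub_le_iff_right]
  set V := volume (Metric.ball (0 : 𝔼 n) 1) with hV
  have hV0 : 0 < V.toReal := ENNReal.toReal_pos (Metric.measure_ball_pos _ _ one_pos).ne'
    measure_ball_lt_top.ne
  have hs2 : Tendsto (fun k => 2 * s k) atTop (𝓝[>] 0) :=
    tendsto_nhdsWithin_iff.2 ⟨by simpa using hs.const_mul 2,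
      Eventually.of_forall fun k => mul_pos two_pos (hs0 k)⟩
  refine le_liminf_of_le (by isBoundedDefault) ?_
  -- The tolerance is calibrated so that, at radius `2 s`, the oscillation bound equals `a` times
  -- the volume of a ball of radius `c s`.
  filter_upwards [hs2.eventually (hT (a * c ^ n * V.toReal / 2 ^ n) (by positivity)),
    hs.eventually (gt_mem_nhds (mul_pos hc hR))] with k hk hkR
  rw [tsub_le_iff_right]
  set D := (volume.prod volume) (layerBox n c (s k)) with hD
  have hD0 : D ≠ 0 := volume_layerBox_ne_zero hc (hs0 k)
  have hDt : D ≠ ∞ := volume_layerBox_ne_top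
  have hball : ENNReal.ofReal (a * c ^ n * V.toReal / 2 ^ n * (2 * s k) ^ n)
      = a * volume (Metric.ball (0 : 𝔼 n) (c * s k)) := by
    rw [Measure.addHaar_ball_of_pos _ _ (mul_pos hc (hs0 k)), finrank_euclideanSpace_fin,
      ← ENNReal.ofReal_toReal (measure_ball_lt_top.ne : V ≠ ∞),
      ← ENNReal.ofReal_mul (by have := hs0 k; positivity), ← ENNReal.ofReal_coe_nnreal (p := a),
      ← ENNReal.ofReal_mul a.coe_nonneg, hV]
    congr 1
    field_simp
    ring
  have hmeas : Measurable fun p : (𝔼 n) × ℝ => ‖w (x + p.2 • e + p.1)‖ₑ :=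
    (hw.comp (by fun_prop)).enorm
  have hmeas' : Measurable fun p : (𝔼 n) × ℝ => ‖w (x + p.2 • e + p.1) - T‖ₑ :=
    ((hw.comp (by fun_prop)).sub_const T).enorm
  have herr : ∫⁻ p in layerBox n c (s k), ‖w (x + p.2 • e + p.1) - T‖ₑ ∂(volume.prod volume)
      ≤ a * D := by
    rw [layerBox, setLIntegral_prod_symm _ hmeas'.aemeasurable]
    calc ∫⁻ t in Ioo (s k / 2) (s k), ∫⁻ h in Metric.ball (0 : 𝔼 n) (c * s k), ‖w (x + t • e + h) - T‖ₑ
        ≤ ∫⁻ t in Ioo (s k / 2) (s k), a * volume (Metric.ball (0 : 𝔼 n) (c * s k)) := by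
          refine setLIntegral_mono' measurableSet_Ioo fun t ht => ?_
          rw [← hball]
          refine le_trans ?_ hk
          rw [(measurePreserving_add_left volume (x + t • e)).setLIntegral_comp_emb
            (measurableEmbedding_addLeft _) (fun y => ‖w y - T‖ₑ)]
          refine lintegral_mono_set ?_
          rintro _ ⟨h, hh, rfl⟩
          have H : IsLayerPoint Ω R c (s k) x e t h := ⟨hA.subset_frontier hx, hA.norm_eq_one,
            hA.exists_normal x hx, ht.1, ht.2, by simpa using hh⟩
          exact ⟨H.mem hΩ hR hsph hc' hkR.le, H.dist_lt hc'⟩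
      _ = a * D := by
          rw [setLIntegral_const, Real.volume_Ioo, hD, volume_layerBox, mul_assoc]
          congr 3
          ring
  have hsum : ‖T‖ₑ * D ≤ ∫⁻ p in layerBox n c (s k), ‖w (x + p.2 • e + p.1)‖ₑ ∂(volume.prod volume)
      + a * D := by
    refine le_trans ?_ (add_le_add le_rfl herr)
    rw [← lintegral_add_left hmeas, hD, ← setLIntegral_const]
    refine lintegral_mono fun p => ?_
    have := enorm_sub_le (a := w (x + p.2 • e + p.1)) (b := w (x + p.2 • e + p.1) - T)
    rwa [sub_sub_cancel] at this
  rw [layerAvg, ← ENNReal.mul_le_mul_iff_left hD0 hDt, add_mul]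
  refine hsum.trans (le_of_eq ?_)
  rw [← hD, mul_right_comm, ENNReal.inv_mul_cancel hD0 hDt, one_mul]

/-- The slab at heights between `s / 2` and `s` over `K` in direction `e`, translated by `h`. -/
def layerSlab (K : Set (𝔼 n)) (e : 𝔼 n) (s : ℝ) (h : 𝔼 n) : Set (𝔼 n) :=
  (fun p : (𝔼 n) × ℝ => p.1 + p.2 • e + h) '' (K ×ˢ Ioo (s / 2) s)

/-- Fubini: for fixed `h`, the points `x + t • e + h` with `x ∈ K` sweep out a slab exactly once,
because graph coordinates are injective and measure preserving. The surface integral of the averages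
becomes an average over `h` of integrals over slabs. -/
lemma IsFlatPiece.lintegral_layerAvg_le {c s : ℝ} (hc : 0 < c) (hs : 0 < s) {A K : Set (𝔼 n)} {e : 𝔼 n}
    (hA : IsFlatPiece Ω R c A e) (hK : MeasurableSet K) (hKA : K ⊆ A) {w : (𝔼 n) → ℝ}
    (hw : Measurable w) :
    (∀ h, MeasurableSet (layerSlab K e s h)) ∧
    Measurable (fun h => ∫⁻ y in layerSlab K e s h, ‖w y‖ₑ) ∧
    ∫⁻ x in K, layerAvg c s e w x ∂(μHE[n - 1]) ≤
      ((1 + (4 * c).toNNReal : ℝ≥0) : ℝ≥0∞) ^ (n - 1) *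
        (((volume.prod volume) (layerBox n c s))⁻¹ *
          ∫⁻ h in Metric.ball (0 : 𝔼 n) (c * s), ∫⁻ y in layerSlab K e s h, ‖w y‖ₑ) := by
  obtain ⟨ψ, hψ, hψA⟩ := hA.exists_graph
  have he := hA.norm_eq_one
  set Φ := graphHomeo he hψ.continuous with hΦ
  set G : Hyper e → 𝔼 n := fun y => Φ (y, 0) with hG
  have hGc : Continuous G := Φ.continuous.comp (by fun_prop)
  set Q : Set (Hyper e) := G ⁻¹' K with hQ
  have hGK : ∀ x ∈ K, G (hyperProj he x) = x := by
    intro x hx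
    simp only [hG, hΦ, graphHomeo_apply, hψA x (hKA hx), add_zero]
    simp [hyperProj]
  have hslab : ∀ h, layerSlab K e s h
      = (fun p => Φ p + h) '' (Q ×ˢ Ioo (s / 2) s) := by
    intro h
    ext z
    constructor
    · rintro ⟨⟨x, t⟩, ⟨hx, ht⟩, rfl⟩
      refine ⟨(hyperProj he x, t), ⟨by rw [hQ, mem_preimage, hGK x hx]; exact hx, ht⟩, ?_⟩
      simp only [hΦ]
      rw [graphHomeo_eq_add]
      have := hGK x hx
      simp only [hG, hΦ] at this
      rw [this]
    · rintro ⟨⟨y, t⟩, ⟨hy, ht⟩, rfl⟩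
      exact ⟨(G y, t), ⟨hy, ht⟩, by simp only [hG, hΦ]; rw [← graphHomeo_eq_add]⟩
  have hemb : ∀ h : 𝔼 n, MeasurableEmbedding fun p => Φ p + h := fun h =>
    (measurableEmbedding_addRight h).comp (measurableEmbedding_graphHomeo he hψ.continuous)
  have hQm : MeasurableSet Q := hGc.measurable hK
  have hint : ∀ h, ∫⁻ y in layerSlab K e s h, ‖w y‖ₑ
      = ∫⁻ y in Q, ∫⁻ t in Ioo (s / 2) s, ‖w (G y + t • e + h)‖ₑ := by
    intro h
    have hmp : MeasurePreserving (fun p => Φ p + h) (volume.prod volume) volume :=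
      (measurePreserving_add_right volume h).comp (measurePreserving_graphHomeo he hψ.continuous)
    rw [hslab h, ← hmp.setLIntegral_comp_emb (hemb h) (fun y => ‖w y‖ₑ), setLIntegral_prod]
    · simp only [hG, hΦ]
      simp_rw [← graphHomeo_eq_add]
    · exact ((hw.comp (hemb h).measurable).enorm).aemeasurable
  have hm3 : Measurable fun q : ((Hyper e) × (𝔼 n)) × ℝ => ‖w (G q.1.1 + q.2 • e + q.1.2)‖ₑ :=
    (hw.comp (by fun_prop)).enorm
  have hm2 : Measurable fun q : (Hyper e) × (𝔼 n) =>
      ∫⁻ t in Ioo (s / 2) s, ‖w (G q.1 + t • e + q.2)‖ₑ := hm3.lintegral_prod_right'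
  refine ⟨fun h => ?_, ?_, ?_⟩
  · rw [hslab h]
    exact (hemb h).measurableSet_image' (hQm.prod measurableSet_Ioo)
  · simp_rw [hint]
    exact (hm2.comp measurable_swap).lintegral_prod_right'
  · refine (IsFlatPiece.lintegral_le he hψ (fun x hx => hψA x (hKA hx))
      (measurable_layerAvg hw)).trans ?_
    gcongr
    simp only [layerAvg]
    rw [lintegral_const_mul']
    · gcongr
      simp_rw [hint]
      rw [lintegral_lintegral_swap
        (f := fun h y => ∫⁻ t in Ioo (s / 2) s, ‖w (G y + t • e + h)‖ₑ)
        (hm2.comp measurable_swap).aemeasurable]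
      refine le_of_eq (lintegral_congr fun y => ?_)
      rw [layerBox, setLIntegral_prod]
      exact ((hw.comp (by fun_prop)).enorm).aemeasurable
    · exact ENNReal.inv_ne_top.2 (volume_layerBox_ne_zero hc hs)

end layerAvg

/-! ### The sharp trace inequality. -/

section sharp

variable {Ω : Set (𝔼 n)} {R : ℝ}

lemma disjoint_layerSlab {K K' : Set (𝔼 n)} {e e' : 𝔼 n} (he : ‖e‖ = 1) (he' : ‖e'‖ = 1) {r s : ℝ}
    (hr : Disjoint (Metric.thickening r K) (Metric.thickening r K')) (hs : 0 < s) (hsr : s < r) (h : 𝔼 n) :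
    Disjoint (layerSlab K e s h) (layerSlab K' e' s h) := by
  rw [Set.disjoint_left]
  rintro _ ⟨⟨x, t⟩, ⟨hx, ht⟩, rfl⟩ ⟨⟨x', t'⟩, ⟨hx', ht'⟩, heq⟩
  simp only [add_left_inj] at heq ht ht'
  have hd : ∀ (x e : 𝔼 n) (t : ℝ), ‖e‖ = 1 → t ∈ Ioo (s / 2) s → dist (x + t • e) x < r := by
    intro x e t he ht
    rw [dist_eq_norm, add_sub_cancel_left, norm_smul, he, Real.norm_of_nonneg (by linarith [ht.1])]
    linarith [ht.2]
  have h1 : x + t • e ∈ Metric.thickening r K :=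
    Metric.mem_thickening_iff.2 ⟨x, hx, hd x e t he ht⟩
  have h2 : x + t • e ∈ Metric.thickening r K' :=
    Metric.mem_thickening_iff.2 ⟨x', hx', by rw [← heq]; exact hd x' e' t' he' ht'⟩
  exact Set.disjoint_left.1 hr h1 h2

/-- Disjoint compact pieces have positive distance, so for small `s` their slabs, shifted by a
common `h`, are disjoint. The band estimate then applies once to the union, and `B` is not
multiplied by the number of pieces. Averaging over `h` and Fatou as `s → 0` finish the argument. -/
lemma lintegral_compact_pieces_le (hΩ : IsOpen Ω) (hR : 0 < R)
    (hsph : InteriorSphereCondition Ω R) {c : ℝ} (hc : 0 < c) (hc' : c ≤ 1 / 100) {N : ℕ}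
    {A K : ℕ → Set (𝔼 n)} {e : ℕ → 𝔼 n} (hA : ∀ i < N, IsFlatPiece Ω R c (A i) (e i))
    (hK : ∀ i < N, IsCompact (K i)) (hKA : ∀ i < N, K i ⊆ A i)
    (hdisj : ∀ i < N, ∀ j < N, i ≠ j → Disjoint (K i) (K j))
    {w : (𝔼 n) → ℝ} (hw : Measurable w) {B : ℝ≥0∞} {m s₀ : ℝ} (hm : 0 ≤ m) (hs₀ : 0 < s₀)
    (hband : ∀ s, 0 < s → s < s₀ → ∀ S : Set (𝔼 n), MeasurableSet S →
      (∀ y ∈ S, ∃ x e t h, IsLayerPoint Ω R c s x e t h ∧ y = x + t • e + h) →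
        ENNReal.ofReal (m * (2 / s)) * ∫⁻ y in S, ‖w y‖ₑ ≤ B)
    {T : (𝔼 n) → ℝ} (hT : ∀ᵐ x ∂(surfaceMeasure Ω), HasTrace Ω w x (T x)) :
    ENNReal.ofReal m * ∫⁻ x in ⋃ i < N, K i, ‖T x‖ₑ ∂(μHE[n - 1]) ≤
      ((1 + (4 * c).toNNReal : ℝ≥0) : ℝ≥0∞) ^ (n - 1) * B := by
  set Γ : ℝ≥0∞ := ((1 + (4 * c).toNNReal : ℝ≥0) : ℝ≥0∞) ^ (n - 1) with hΓ
  have hKm : ∀ i < N, MeasurableSet (K i) := fun i hi => (hK i hi).measurableSet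
  have hunion : ⋃ i < N, K i = ⋃ i ∈ Finset.range N, K i := by simp
  obtain ⟨r, hr, hrd⟩ : ∃ r > 0, ∀ i < N, ∀ j < N, i ≠ j →
      Disjoint (Metric.thickening r (K i)) (Metric.thickening r (K j)) := by
    have h1 : ∀ p : ℕ × ℕ, p.1 < N ∧ p.2 < N ∧ p.1 ≠ p.2 → ∃ r > 0,
        Disjoint (Metric.thickening r (K p.1)) (Metric.thickening r (K p.2)) := fun p hp =>
      (hdisj _ hp.1 _ hp.2.1 hp.2.2).exists_thickenings (hK _ hp.1) (hK _ hp.2.1).isClosed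
    choose! ρ hρ0 hρ using h1
    set I := ((Finset.range N ×ˢ Finset.range N).filter fun p => p.1 ≠ p.2) with hI
    have hmem : ∀ p ∈ I, p.1 < N ∧ p.2 < N ∧ p.1 ≠ p.2 := by
      intro p hp
      simp only [hI, Finset.mem_filter, Finset.mem_product, Finset.mem_range] at hp
      exact ⟨hp.1.1, hp.1.2, hp.2⟩
    obtain ⟨r, hr0, hr⟩ : ∃ r > 0, ∀ p ∈ I, r ≤ ρ p := by
      have h := (Finset.eventually_all I).2 fun p hp => (Ioc_mem_nhdsGT (hρ0 p (hmem p hp)))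
      obtain ⟨r, hr1, hr2⟩ := (h.and self_mem_nhdsWithin).exists
      exact ⟨r, hr2, fun p hp => (hr1 p hp).2⟩
    refine ⟨r, hr0, fun i hi j hj hij => ?_⟩
    have hp : (i, j) ∈ I := by simp [hI, hi, hj, hij]
    exact (hρ (i, j) (hmem _ hp)).mono (Metric.thickening_mono (hr _ hp) _)
      (Metric.thickening_mono (hr _ hp) _)
  have hscale : ∀ s, 0 < s → s < min s₀ r → ENNReal.ofReal m *
      ∑ i ∈ Finset.range N, ∫⁻ x in K i, layerAvg c s (e i) w x ∂(μHE[n - 1]) ≤ Γ * B := by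
    intro s hs hss
    set D := (volume.prod volume) (layerBox n c s) with hD
    have hD0 : D ≠ 0 := volume_layerBox_ne_zero hc hs
    have hDt : D ≠ ∞ := volume_layerBox_ne_top
    have hslab := fun i (hi : i < N) =>
      (hA i hi).lintegral_layerAvg_le (s := s) hc hs (hKm i hi) (hKA i hi) hw
    have hsum : ∀ h ∈ Metric.ball (0 : 𝔼 n) (c * s), ENNReal.ofReal m *
        ∑ i ∈ Finset.range N, ∫⁻ y in layerSlab (K i) (e i) s h, ‖w y‖ₑ
          ≤ ENNReal.ofReal (s / 2) * B := by
      intro h hh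
      rw [← lintegral_biUnion_finset]
      -- The factor `2 / s` of the band estimate cancels the thickness `s / 2` of the slabs.
      · have e1 : ENNReal.ofReal m = ENNReal.ofReal (s / 2) * ENNReal.ofReal (m * (2 / s)) := by
          rw [← ENNReal.ofReal_mul (by positivity)]
          congr 1
          field_simp
        rw [e1, mul_assoc]
        gcongr
        refine hband s hs (hss.trans_le (min_le_left _ _)) _ ?_ ?_
        · exact Finset.measurableSet_biUnion _ fun i hi => (hslab i (Finset.mem_range.1 hi)).1 h
        · intro y hy
          obtain ⟨i, hi, ⟨x, t⟩, ⟨hx, ht⟩, rfl⟩ := mem_iUnion₂.1 hy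
          have hi' := Finset.mem_range.1 hi
          have hxA := hKA i hi' hx
          exact ⟨x, e i, t, h, ⟨(hA i hi').subset_frontier hxA, (hA i hi').norm_eq_one,
            (hA i hi').exists_normal x hxA, ht.1, ht.2, by simpa using hh⟩, rfl⟩
      · intro i hi j hj hij
        have hi' : i < N := by simpa using hi
        have hj' : j < N := by simpa using hj
        exact disjoint_layerSlab (hA i hi').norm_eq_one (hA j hj').norm_eq_one
          (hrd i hi' j hj' hij) hs (hss.trans_le (min_le_right _ _)) h
      · exact fun i hi => (hslab i (Finset.mem_range.1 hi)).1 h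
    have hint : ENNReal.ofReal m * ∑ i ∈ Finset.range N, ∫⁻ h in Metric.ball (0 : 𝔼 n) (c * s),
        ∫⁻ y in layerSlab (K i) (e i) s h, ‖w y‖ₑ ≤ D * B := by
      rw [← lintegral_finsetSum', ← lintegral_const_mul' _ _ ENNReal.ofReal_ne_top]
      · refine (setLIntegral_mono' measurableSet_ball hsum).trans (le_of_eq ?_)
        rw [setLIntegral_const, hD, volume_layerBox]
        ring
      · exact fun i hi => (hslab i (Finset.mem_range.1 hi)).2.1.aemeasurable
    calc ENNReal.ofReal m * ∑ i ∈ Finset.range N, ∫⁻ x in K i, layerAvg c s (e i) w x ∂(μHE[n - 1])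
        ≤ ENNReal.ofReal m * ∑ i ∈ Finset.range N, Γ * (D⁻¹ *
          ∫⁻ h in Metric.ball (0 : 𝔼 n) (c * s), ∫⁻ y in layerSlab (K i) (e i) s h, ‖w y‖ₑ) := by
          gcongr with i hi
          exact (hslab i (Finset.mem_range.1 hi)).2.2
      _ = Γ * (D⁻¹ * (ENNReal.ofReal m * ∑ i ∈ Finset.range N,
          ∫⁻ h in Metric.ball (0 : 𝔼 n) (c * s), ∫⁻ y in layerSlab (K i) (e i) s h, ‖w y‖ₑ)) := by
          rw [← Finset.mul_sum, ← Finset.mul_sum]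
          ring
      _ ≤ Γ * (D⁻¹ * (D * B)) := by gcongr
      _ = Γ * B := by rw [← mul_assoc D⁻¹, ENNReal.inv_mul_cancel hD0 hDt, one_mul]
  set σ : ℕ → ℝ := fun k => 1 / ((k : ℝ) + 1) with hσ
  have hσ0 : ∀ k, 0 < σ k := fun k => by positivity
  have hσt : Tendsto σ atTop (𝓝 0) := tendsto_one_div_add_atTop_nhds_zero_nat
  set F : ℕ → (𝔼 n) → ℝ≥0∞ := fun k x =>
    ∑ i ∈ Finset.range N, (K i).indicator (layerAvg c (σ k) (e i) w) x with hF
  have hFm : ∀ k, Measurable (F k) := fun k => Finset.measurable_fun_sum _ fun i hi =>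
    (measurable_layerAvg hw).indicator (hKm i (Finset.mem_range.1 hi))
  have hsub : ⋃ i < N, K i ⊆ frontier Ω :=
    iUnion₂_subset fun i hi => (hKA i hi).trans (hA i hi).subset_frontier
  have hTF : ∀ᵐ x ∂(μHE[n - 1]).restrict (⋃ i < N, K i), ‖T x‖ₑ ≤ liminf (fun k => F k x) atTop := by
    have hUm : MeasurableSet (⋃ i < N, K i) := by
      rw [hunion]
      exact Finset.measurableSet_biUnion _ fun i hi => hKm i (Finset.mem_range.1 hi)
    filter_upwards [ae_mono (Measure.restrict_mono hsub le_rfl) hT, ae_restrict_mem hUm] with x hx hxU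
    obtain ⟨i, hi, hxi⟩ := mem_iUnion₂.1 hxU
    refine ((hA i hi).enorm_le_liminf_layerAvg hΩ hR hsph hc hc' hw (hKA i hi hxi) hx hσ0 hσt).trans
      (liminf_le_liminf (Eventually.of_forall fun k => ?_))
    simp only [hF]
    refine le_trans (le_of_eq ?_) (Finset.single_le_sum (fun _ _ => zero_le)
      (Finset.mem_range.2 hi))
    rw [indicator_of_mem hxi]
  have hFint : ∀ k, ∫⁻ x in ⋃ i < N, K i, F k x ∂(μHE[n - 1]) ≤
      ∑ i ∈ Finset.range N, ∫⁻ x in K i, layerAvg c (σ k) (e i) w x ∂(μHE[n - 1]) := by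
    intro k
    refine (setLIntegral_le_lintegral _ _).trans (le_of_eq ?_)
    simp only [hF]
    rw [lintegral_finsetSum _ fun i hi => (measurable_layerAvg hw).indicator
      (hKm i (Finset.mem_range.1 hi))]
    exact Finset.sum_congr rfl fun i hi => lintegral_indicator (hKm i (Finset.mem_range.1 hi)) _
  have hfatou : ∫⁻ x in ⋃ i < N, K i, ‖T x‖ₑ ∂(μHE[n - 1]) ≤
      liminf (fun k => ∑ i ∈ Finset.range N,
        ∫⁻ x in K i, layerAvg c (σ k) (e i) w x ∂(μHE[n - 1])) atTop :=
    (lintegral_mono_ae hTF).trans ((lintegral_liminf_le hFm).trans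
      (liminf_le_liminf (Eventually.of_forall hFint)))
  have hev : ∀ᶠ k in atTop, σ k < min s₀ r := hσt.eventually (gt_mem_nhds (lt_min hs₀ hr))
  rcases hm.eq_or_lt with rfl | hm
  · simp
  have hm' : ENNReal.ofReal m ≠ 0 := by simpa using hm
  rw [mul_comm, ← ENNReal.le_div_iff_mul_le (Or.inl hm') (Or.inl ENNReal.ofReal_ne_top)]
  refine hfatou.trans ((liminf_le_liminf (hev.mono fun k hk => ?_)).trans_eq
    (liminf_const (Γ * B / ENNReal.ofReal m)))
  rw [ENNReal.le_div_iff_mul_le (Or.inl hm') (Or.inl ENNReal.ofReal_ne_top), mul_comm]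
  exact hscale (σ k) (hσ0 k) hk

/-- The pieces of the cover may overlap, and making them disjoint destroys compactness. Inner
regularity of the finite surface measure exhausts the disjoint parts by compact sets, and monotone
convergence passes to the whole boundary. -/
lemma lintegral_trace_le (hΩ : IsOpen Ω) (hb : Bornology.IsBounded Ω) (hR : 0 < R)
    (hsph : InteriorSphereCondition Ω R) {c : ℝ} (hc : 0 < c) (hc' : c ≤ 1 / 100)
    {w : (𝔼 n) → ℝ} (hw : Measurable w) {B : ℝ≥0∞} {m s₀ : ℝ} (hm : 0 ≤ m) (hs₀ : 0 < s₀)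
    (hband : ∀ s, 0 < s → s < s₀ → ∀ S : Set (𝔼 n), MeasurableSet S →
      (∀ y ∈ S, ∃ x e t h, IsLayerPoint Ω R c s x e t h ∧ y = x + t • e + h) →
        ENNReal.ofReal (m * (2 / s)) * ∫⁻ y in S, ‖w y‖ₑ ≤ B)
    {T : (𝔼 n) → ℝ} (hT : ∀ᵐ x ∂(surfaceMeasure Ω), HasTrace Ω w x (T x)) :
    ENNReal.ofReal m * ∫⁻ x, ‖T x‖ₑ ∂(surfaceMeasure Ω) ≤
      ((1 + (4 * c).toNNReal : ℝ≥0) : ℝ≥0∞) ^ (n - 1) * B := by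
  obtain ⟨N, A, e, hA, hcov⟩ := exists_flatPieces hΩ hb hR hsph hc hc'
  have := isFiniteMeasure_surfaceMeasure hΩ hb hR hsph
  set A' : ℕ → Set (𝔼 n) := disjointed fun i => if i < N then A i else ∅ with hA'
  have hA'm : ∀ i, MeasurableSet (A' i) := MeasurableSet.disjointed fun i => by
    split_ifs with hi
    · exact (hA i hi).isCompact.measurableSet
    · exact MeasurableSet.empty
  have hA'A : ∀ i < N, A' i ⊆ A i := fun i hi => by
    have := disjointed_subset (fun i => if i < N then A i else ∅) i
    simpa only [if_pos hi] using this
  have hA'U : frontier Ω = ⋃ i < N, A' i := by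
    refine Subset.antisymm (fun x hx => ?_) (iUnion₂_subset fun i hi => ?_)
    · rw [hcov] at hx
      obtain ⟨i, hi, hxi⟩ := mem_iUnion₂.1 hx
      have h1 : x ∈ ⋃ i, A' i := by
        rw [hA', iUnion_disjointed]
        exact mem_iUnion.2 ⟨i, by rwa [if_pos hi]⟩
      obtain ⟨j, hj⟩ := mem_iUnion.1 h1
      have hjN : j < N := by
        by_contra hjN
        have := disjointed_subset _ j hj
        simp [hjN] at this
      exact mem_iUnion₂.2 ⟨j, hjN, hj⟩
    · exact (hA'A i hi).trans (hA i hi).subset_frontier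
  have hex : ∀ i k : ℕ, ∃ K ⊆ A' i, IsCompact K ∧ surfaceMeasure Ω (A' i \ K) < (k : ℝ≥0∞)⁻¹ :=
    fun i k => (hA'm i).exists_isCompact_sdiff_lt (measure_ne_top _ _)
      (ENNReal.inv_ne_zero.2 (ENNReal.natCast_ne_top k))
  choose K hKA hKc hKd using hex
  set Kk : ℕ → ℕ → Set (𝔼 n) := fun i => accumulate (K i) with hKk
  have hKkA : ∀ i k, Kk i k ⊆ A' i := fun i k => iUnion₂_subset fun j _ => hKA i j
  set U : ℕ → Set (𝔼 n) := fun k => ⋃ i < N, Kk i k with hU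
  have hUmono : Monotone U := fun k l hkl => iUnion₂_mono fun i _ => monotone_accumulate hkl
  have hnull : ∀ i, surfaceMeasure Ω (A' i \ ⋃ k, Kk i k) = 0 := by
    intro i
    refine le_antisymm (ge_of_tendsto' (x := atTop) ENNReal.tendsto_inv_nat_nhds_zero fun k => ?_) zero_le
    refine (measure_mono (sdiff_subset_sdiff_right ?_)).trans (hKd i k).le
    exact (subset_accumulate (s := K i) (x := k)).trans (subset_iUnion (Kk i) k)
  have hae : ∀ᵐ x ∂(surfaceMeasure Ω), x ∈ ⋃ k, U k := by
    have h1 : ∀ᵐ x ∂(surfaceMeasure Ω), ∀ i, x ∉ A' i \ ⋃ k, Kk i k :=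
      ae_all_iff.2 fun i => measure_eq_zero_iff_ae_notMem.1 (hnull i)
    filter_upwards [h1, ae_restrict_mem isClosed_frontier.measurableSet] with x hx hxf
    rw [hA'U] at hxf
    obtain ⟨i, hi, hxi⟩ := mem_iUnion₂.1 hxf
    have : x ∈ ⋃ k, Kk i k := by
      by_contra h
      exact hx i ⟨hxi, h⟩
    obtain ⟨k, hk⟩ := mem_iUnion.1 this
    exact mem_iUnion.2 ⟨k, mem_iUnion₂.2 ⟨i, hi, hk⟩⟩
  have heq : ∫⁻ x, ‖T x‖ₑ ∂(surfaceMeasure Ω) = ⨆ k, ∫⁻ x in U k, ‖T x‖ₑ ∂(surfaceMeasure Ω) := by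
    rw [← setLIntegral_iUnion_of_directed _ hUmono.directed_le, Measure.restrict_eq_self_of_ae_mem hae]
  rw [heq, ENNReal.mul_iSup]
  refine iSup_le fun k => ?_
  have hle : ∫⁻ x in U k, ‖T x‖ₑ ∂(surfaceMeasure Ω) ≤ ∫⁻ x in U k, ‖T x‖ₑ ∂(μHE[n - 1]) :=
    lintegral_mono' (Measure.restrict_mono le_rfl Measure.restrict_le_self) le_rfl
  refine (mul_le_mul_right hle _).trans ?_
  exact lintegral_compact_pieces_le hΩ hR hsph hc hc' hA
    (fun i _ => isCompact_accumulate (hKc i) k) (fun i hi => (hKkA i k).trans (hA'A i hi))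
    (fun i _ j _ hij => (disjoint_disjointed _ hij).mono (hKkA i k) (hKkA j k))
    hw hm hs₀ hband hT

lemma hasTrace_congr {w w' : (𝔼 n) → ℝ} (h : w =ᵐ[volume] w') {x : 𝔼 n} {T : ℝ}
    (hT : HasTrace Ω w x T) : HasTrace Ω w' x T := by
  intro a ha
  filter_upwards [hT a ha] with ρ hρ
  rwa [lintegral_congr_ae (g := fun y => ‖w' y - T‖ₑ)
    (ae_restrict_of_ae (h.mono fun y hy => by simp only [hy]))] at hρ

/-- The sharp trace inequality on domains with the interior sphere condition. -/
theorem exists_sharp_trace_inequality (hΩ : IsOpen Ω) (hb : Bornology.IsBounded Ω) (hR : 0 < R)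
    (hsph : InteriorSphereCondition Ω R) {a δ : ℝ} (ha : 0 < a) (hδ : 0 < δ) :
    ∃ C : ℝ, 0 ≤ C ∧ ∀ w T : (𝔼 n) → ℝ, Integrable w →
      (∀ᵐ x ∂(surfaceMeasure Ω), HasTrace Ω w x (T x)) →
      ENNReal.ofReal (1 - a) * ∫⁻ x, ‖T x‖ₑ ∂(surfaceMeasure Ω) ≤
        variation w (Ω ∩ Metric.thickening δ (frontier Ω)) + ENNReal.ofReal (C * ∫ x, |w x|) := by
  rcases (frontier Ω).eq_empty_or_nonempty with hne | hne
  · refine ⟨0, le_rfl, fun w T _ _ => ?_⟩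
    simp [surfaceMeasure, hne]
  -- Both losses, the area distortion `(1 + 4 c) ^ (n - 1)` and the band constant, tend to one as `c
  -- → 0`, so a small `c` costs less than the margin `a`.
  obtain ⟨c, hc, hc', hca⟩ : ∃ c : ℝ, 0 < c ∧ c ≤ 1 / 100 ∧
      (1 - a) * (1 + 4 * c) ^ (n - 1) ≤ (1 - 40 * c) / ((1 + 48 * c) * (1 + 2 * c)) := by
    have h1 : Tendsto (fun c : ℝ => (1 - a) * (1 + 4 * c) ^ (n - 1)) (𝓝[>] 0) (𝓝 (1 - a)) := by
      refine Tendsto.mono_left ?_ nhdsWithin_le_nhds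
      have : Continuous fun c : ℝ => (1 - a) * (1 + 4 * c) ^ (n - 1) := by fun_prop
      simpa using this.tendsto 0
    have h2 : Tendsto (fun c : ℝ => (1 - 40 * c) / ((1 + 48 * c) * (1 + 2 * c))) (𝓝[>] 0) (𝓝 1) := by
      refine Tendsto.mono_left ?_ nhdsWithin_le_nhds
      have : ContinuousAt (fun c : ℝ => (1 - 40 * c) / ((1 + 48 * c) * (1 + 2 * c))) 0 := by
        refine ContinuousAt.div (by fun_prop) (by fun_prop) (by norm_num)
      simpa [ContinuousAt] using this
    have h3 := (h1.eventually_lt h2 (by linarith)).and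
      (Ioc_mem_nhdsGT (show (0 : ℝ) < 1 / 100 by norm_num))
    obtain ⟨c, hc1, hc2⟩ := h3.exists
    exact ⟨c, hc2.1, hc2.2, hc1.le⟩
  obtain ⟨C, s₀, hC, hs₀, -, hband⟩ := exists_band_estimate hΩ hb hR hsph hne hc hc' hδ
  refine ⟨C, hC, fun w T hw hT => ?_⟩
  -- A measurable representative is needed for Tonelli; variation, traces and integrals do not see
  -- the change on a null set.
  set w' := hw.1.mk w with hw'
  have hww : w =ᵐ[volume] w' := hw.1.ae_eq_mk
  have hwm : Measurable w' := hw.1.stronglyMeasurable_mk.measurable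
  have hwi : Integrable w' := hw.congr hww
  set m := (1 - 40 * c) / ((1 + 48 * c) * (1 + 2 * c)) with hm
  have hm0 : 0 ≤ m := div_nonneg (by linarith) (by positivity)
  set B := variation w (Ω ∩ Metric.thickening δ (frontier Ω)) + ENNReal.ofReal (C * ∫ x, |w x|) with hB
  have hBeq : variation w' (Ω ∩ Metric.thickening δ (frontier Ω))
      + ENNReal.ofReal (C * ∫ x, |w' x|) = B := by
    rw [hB, variation_congr (hΩ.inter Metric.isOpen_thickening).measurableSet
      (ae_restrict_of_ae hww), integral_congr_ae (f := fun y => |w y|) (g := fun y => |w' y|)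
        (hww.mono fun y hy => by simp only [hy])]
  have key := lintegral_trace_le hΩ hb hR hsph hc hc' hwm (B := B) hm0 hs₀
    (fun s hs hss S hS hSl => by
      have := hband s hs hss S hS hSl w' hwi
      rw [hBeq] at this
      refine le_trans (le_of_eq ?_) this
      congr 2
      rw [hm]
      ring) (hT.mono fun x hx => hasTrace_congr hww hx)
  set Γ : ℝ≥0∞ := ((1 + (4 * c).toNNReal : ℝ≥0) : ℝ≥0∞) ^ (n - 1) with hΓ
  have hΓ' : Γ = ENNReal.ofReal ((1 + 4 * c) ^ (n - 1)) := by
    rw [hΓ, ENNReal.ofReal_pow (by positivity)]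
    congr 1
    rw [ENNReal.ofReal_add zero_le_one (by positivity), ENNReal.ofReal_one]
    push_cast
    rfl
  have hΓ0 : Γ ≠ 0 := by
    rw [hΓ']
    simp only [ne_eq, ENNReal.ofReal_eq_zero, not_le]
    positivity
  have hΓt : Γ ≠ ∞ := by rw [hΓ']; exact ENNReal.ofReal_ne_top
  rw [← ENNReal.mul_le_mul_iff_right hΓ0 hΓt, ← mul_assoc]
  refine le_trans ?_ key
  gcongr
  rw [hΓ', ← ENNReal.ofReal_mul (by positivity)]
  exact ENNReal.ofReal_le_ofReal (by linarith)

end sharp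

/-! ### Consistency, linearity and measurability of traces. -/

section traceFacts

variable {Ω : Set (𝔼 n)} {R : ℝ}

/-- The ball of radius `ρ / 2` centred on the segment from `x` to the centre of the touching ball,
at distance `ρ / 2` from `x`, lies in both sets. This lower density bound turns the normalisation by
`ρ ^ n` in `HasTrace` into genuine averages. -/
lemma volume_inter_ball_ge (hsph : InteriorSphereCondition Ω R) (hR : 0 < R) {x : 𝔼 n}
    (hx : x ∈ frontier Ω) {ρ : ℝ} (hρ : 0 < ρ) (hρR : ρ ≤ R) :
    volume (Metric.ball (0 : 𝔼 n) (ρ / 2)) ≤ volume (Ω ∩ Metric.ball x ρ) := by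
  obtain ⟨z, hz, hzΩ⟩ := hsph x hx
  set p := x + (ρ / 2 / R) • (z - x) with hp
  have h1 : dist p x = ρ / 2 := by
    rw [dist_eq_norm, hp, add_sub_cancel_left, norm_smul, ← dist_eq_norm, dist_comm z x, hz,
      Real.norm_of_nonneg (by positivity), div_mul_cancel₀ _ hR.ne']
  have h2 : dist p z = R - ρ / 2 := by
    have : p - z = (ρ / 2 / R - 1) • (z - x) := by rw [hp]; module
    have hle : ρ / 2 / R ≤ 1 := by rw [div_le_one hR]; linarith
    rw [dist_eq_norm p z, this, norm_smul, ← dist_eq_norm z x, dist_comm z x, hz, Real.norm_eq_abs,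
      abs_of_nonpos (by linarith)]
    field_simp
    ring
  rw [← Measure.addHaar_ball_center volume p]
  refine measure_mono fun y hy => ⟨hzΩ ?_, ?_⟩
  · rw [Metric.mem_ball] at hy ⊢
    have := dist_triangle y p z
    linarith
  · rw [Metric.mem_ball] at hy ⊢
    have := dist_triangle y p x
    linarith

lemma HasTrace.tendsto_average (hsph : InteriorSphereCondition Ω R) (hR : 0 < R) {x : 𝔼 n}
    (hx : x ∈ frontier Ω) {v : (𝔼 n) → ℝ} (hv : IntegrableOn v Ω) {T : ℝ} (hT : HasTrace Ω v x T) :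
    Tendsto (fun r => ⨍ y in Ω ∩ Metric.ball x r, v y) (𝓝[>] 0) (𝓝 T) := by
  rw [Metric.tendsto_nhds]
  intro ε hε
  set V := volume (Metric.ball (0 : 𝔼 n) 1) with hV
  have hVt : V ≠ ∞ := measure_ball_lt_top.ne
  have hV0 : 0 < V.toReal := ENNReal.toReal_pos (Metric.measure_ball_pos _ _ one_pos).ne' hVt
  filter_upwards [hT (ε / 2 * V.toReal / 2 ^ n) (by positivity), Ioc_mem_nhdsGT hR] with ρ hρ hρR
  have hρ0 := hρR.1
  set S := Ω ∩ Metric.ball x ρ with hS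
  have hSt : volume S ≠ ∞ := (measure_mono inter_subset_right).trans_lt measure_ball_lt_top |>.ne
  have hlow : ENNReal.ofReal ((ρ / 2) ^ n * V.toReal) ≤ volume S := by
    refine le_trans (le_of_eq ?_) (volume_inter_ball_ge hsph hR hx hρ0 hρR.2)
    rw [Measure.addHaar_ball_of_pos _ _ (half_pos hρ0), finrank_euclideanSpace_fin,
      ENNReal.ofReal_mul (by positivity), ENNReal.ofReal_toReal hVt]
  have hlow' : (ρ / 2) ^ n * V.toReal ≤ volume.real S :=
    (ENNReal.ofReal_le_iff_le_toReal hSt).1 hlow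
  have hS0 : 0 < volume.real S := lt_of_lt_of_le (by positivity) hlow'
  have hvS : IntegrableOn v S := hv.mono_set inter_subset_left
  have hsub : ∫ y in S, (v y - T) = (∫ y in S, v y) - volume.real S * T := by
    rw [integral_sub hvS (integrableOn_const hSt), setIntegral_const, smul_eq_mul]
  have hbd : |∫ y in S, (v y - T)| ≤ ε / 2 * V.toReal / 2 ^ n * ρ ^ n := by
    rw [← Real.norm_eq_abs, ← ENNReal.ofReal_le_ofReal_iff (by positivity), ofReal_norm]
    exact (enorm_integral_le_lintegral_enorm _).trans hρ
  rw [setAverage_eq, Real.dist_eq, smul_eq_mul]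
  have e1 : (volume.real S)⁻¹ * (∫ y in S, v y) - T = (volume.real S)⁻¹ * ∫ y in S, (v y - T) := by
    rw [hsub]; field_simp
  rw [e1, abs_mul, abs_of_pos (inv_pos.2 hS0), inv_mul_lt_iff₀ hS0]
  calc |∫ y in S, (v y - T)| ≤ ε / 2 * V.toReal / 2 ^ n * ρ ^ n := hbd
    _ = ε / 2 * ((ρ / 2) ^ n * V.toReal) := by rw [div_pow]; ring
    _ ≤ ε / 2 * volume.real S := by gcongr
    _ < volume.real S * ε := by nlinarith

lemma HasTrace.linear {v u : (𝔼 n) → ℝ} (hv : AEStronglyMeasurable v (volume.restrict Ω))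
    {x : 𝔼 n} {T S : ℝ} (hT : HasTrace Ω v x T) (hS : HasTrace Ω u x S) (α β : ℝ) :
    HasTrace Ω (fun y => α * v y + β * u y) x (α * T + β * S) := by
  intro a ha
  filter_upwards [hT (a / (2 * (|α| + 1))) (by positivity), hS (a / (2 * (|β| + 1))) (by positivity),
    self_mem_nhdsWithin] with ρ h1 h2 hρ
  have hρ : 0 < ρ := hρ
  have hvS : AEStronglyMeasurable v (volume.restrict (Ω ∩ Metric.ball x ρ)) :=
    hv.mono_measure (Measure.restrict_mono inter_subset_left le_rfl)
  calc ∫⁻ y in Ω ∩ Metric.ball x ρ, ‖α * v y + β * u y - (α * T + β * S)‖ₑ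
      ≤ ∫⁻ y in Ω ∩ Metric.ball x ρ, (‖α‖ₑ * ‖v y - T‖ₑ + ‖β‖ₑ * ‖u y - S‖ₑ) := by
        refine lintegral_mono fun y => ?_
        have : α * v y + β * u y - (α * T + β * S) = α * (v y - T) + β * (u y - S) := by ring
        rw [this, ← enorm_mul, ← enorm_mul]
        exact enorm_add_le _ _
    _ = ‖α‖ₑ * (∫⁻ y in Ω ∩ Metric.ball x ρ, ‖v y - T‖ₑ)
        + ‖β‖ₑ * (∫⁻ y in Ω ∩ Metric.ball x ρ, ‖u y - S‖ₑ) := by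
        have hm : AEMeasurable (fun y => ‖α‖ₑ * ‖v y - T‖ₑ)
            (volume.restrict (Ω ∩ Metric.ball x ρ)) :=
          (hvS.sub aestronglyMeasurable_const).enorm.const_mul _
        rw [lintegral_add_left' hm, lintegral_const_mul' _ _ enorm_ne_top,
          lintegral_const_mul' _ _ enorm_ne_top]
    _ ≤ ‖α‖ₑ * ENNReal.ofReal (a / (2 * (|α| + 1)) * ρ ^ n)
        + ‖β‖ₑ * ENNReal.ofReal (a / (2 * (|β| + 1)) * ρ ^ n) := by gcongr
    _ ≤ ENNReal.ofReal (a * ρ ^ n) := by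
        rw [Real.enorm_eq_ofReal_abs, Real.enorm_eq_ofReal_abs, ← ENNReal.ofReal_mul (abs_nonneg _),
          ← ENNReal.ofReal_mul (abs_nonneg _), ← ENNReal.ofReal_add (by positivity) (by positivity)]
        refine ENNReal.ofReal_le_ofReal ?_
        have key : ∀ γ : ℝ, |γ| * (a / (2 * (|γ| + 1)) * ρ ^ n) ≤ a * ρ ^ n / 2 := by
          intro γ
          have : |γ| / (|γ| + 1) ≤ 1 := by
            rw [div_le_one (by positivity)]; linarith
          have e : |γ| * (a / (2 * (|γ| + 1)) * ρ ^ n) = |γ| / (|γ| + 1) * (a * ρ ^ n / 2) := by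
            field_simp
          rw [e]
          exact mul_le_of_le_one_left (by positivity) this
        linarith [key α, key β]

lemma hasTrace_indicator_iff (hΩ : IsOpen Ω) {v : (𝔼 n) → ℝ} {x : 𝔼 n} {T : ℝ} :
    HasTrace Ω (Ω.indicator v) x T ↔ HasTrace Ω v x T := by
  have h : ∀ ρ, ∫⁻ y in Ω ∩ Metric.ball x ρ, ‖Ω.indicator v y - T‖ₑ
      = ∫⁻ y in Ω ∩ Metric.ball x ρ, ‖v y - T‖ₑ := fun ρ =>
    setLIntegral_congr_fun (hΩ.measurableSet.inter measurableSet_ball) fun y hy => by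
      simp only [indicator_of_mem hy.1]
  simp only [HasTrace, h]

lemma stronglyMeasurable_setIntegral_ball (hΩ : IsOpen Ω) {v : (𝔼 n) → ℝ} (hv : StronglyMeasurable v)
    (r : ℝ) : StronglyMeasurable fun x => ∫ y in Ω ∩ Metric.ball x r, v y := by
  have hset : MeasurableSet {p : (𝔼 n) × (𝔼 n) | p.2 ∈ Ω ∧ dist p.2 p.1 < r} :=
    (measurable_snd hΩ.measurableSet).inter
      (measurableSet_lt (measurable_snd.dist measurable_fst) measurable_const)
  have h1 : StronglyMeasurable fun p : (𝔼 n) × (𝔼 n) =>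
      {p : (𝔼 n) × (𝔼 n) | p.2 ∈ Ω ∧ dist p.2 p.1 < r}.indicator (fun p => v p.2) p :=
    (hv.comp_measurable measurable_snd).indicator hset
  have h2 := h1.integral_prod_right' (ν := volume)
  refine (congrArg StronglyMeasurable (funext fun x => ?_)).mp h2
  rw [← integral_indicator (hΩ.measurableSet.inter measurableSet_ball)]
  rfl

/-- The trace of a function which has a trace in the strong sense almost everywhere. -/
lemma ae_trace_eq (hsph : InteriorSphereCondition Ω R) (hR : 0 < R) {v : (𝔼 n) → ℝ}
    (hv : IntegrableOn v Ω) (hT : ∀ᵐ x ∂(surfaceMeasure Ω), ∃ c, HasTrace Ω v x c) :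
    ∀ᵐ x ∂(surfaceMeasure Ω), HasTrace Ω v x (trace Ω v x) := by
  filter_upwards [hT, ae_restrict_mem isClosed_frontier.measurableSet] with x ⟨c, hc⟩ hx
  rwa [trace, (hc.tendsto_average hsph hR hx hv).limUnder_eq]

lemma trace_eq_of_hasTrace (hsph : InteriorSphereCondition Ω R) (hR : 0 < R) {v : (𝔼 n) → ℝ}
    (hv : IntegrableOn v Ω) {x : 𝔼 n} (hx : x ∈ frontier Ω) {c : ℝ} (hc : HasTrace Ω v x c) :
    trace Ω v x = c := (hc.tendsto_average hsph hR hx hv).limUnder_eq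

/-- Along radii `1 / (k + 1)` the trace is an almost everywhere limit of averages, each measurable
in the centre by Fubini. -/
lemma aestronglyMeasurable_trace (hΩ : IsOpen Ω) (hsph : InteriorSphereCondition Ω R) (hR : 0 < R)
    {v : (𝔼 n) → ℝ} (hv : IntegrableOn v Ω)
    (hT : ∀ᵐ x ∂(surfaceMeasure Ω), HasTrace Ω v x (trace Ω v x)) :
    AEStronglyMeasurable (trace Ω v) (surfaceMeasure Ω) := by
  set v' := hv.1.mk v with hv'
  have hvv : v =ᵐ[volume.restrict Ω] v' := hv.1.ae_eq_mk
  set ρ : ℕ → ℝ := fun k => 1 / ((k : ℝ) + 1) with hρ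
  have hρt : Tendsto ρ atTop (𝓝[>] 0) := tendsto_nhdsWithin_iff.2
    ⟨tendsto_one_div_add_atTop_nhds_zero_nat, Eventually.of_forall fun k => by
      change 0 < 1 / ((k : ℝ) + 1); positivity⟩
  refine aestronglyMeasurable_of_tendsto_ae atTop (f := fun k x =>
    ⨍ y in Ω ∩ Metric.ball x (ρ k), v y) (fun k => ?_) ?_
  · have h1 := stronglyMeasurable_setIntegral_ball hΩ (hv.1.stronglyMeasurable_mk) (ρ k)
    have h2 := stronglyMeasurable_setIntegral_ball hΩ (stronglyMeasurable_const (α := 𝔼 n) (b := (1 : ℝ))) (ρ k)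
    refine StronglyMeasurable.aestronglyMeasurable ?_
    refine (congrArg StronglyMeasurable (funext fun x => ?_)).mp ((h2.measurable.inv.mul h1.measurable).stronglyMeasurable)
    simp only [Pi.mul_apply, Pi.inv_apply]
    rw [setAverage_eq, smul_eq_mul, setIntegral_const, smul_eq_mul, mul_one]
    congr 1
    exact (integral_congr_ae (ae_restrict_of_ae_restrict_of_subset inter_subset_left hvv)).symm
  · filter_upwards [hT, ae_restrict_mem isClosed_frontier.measurableSet] with x hx hxf
    exact (hx.tendsto_average hsph hR hxf hv).comp hρt

end traceFacts

/-! ### The entropy. -/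

/-- The integrand of the potential energy. -/
def entropy (x : ℝ) : ℝ := ∫ h in (1 : ℝ)..x, Real.log h

lemma entropy_eq (x : ℝ) : entropy x = x * Real.log x - x + 1 := by
  rw [entropy, integral_log, Real.log_one]
  ring

lemma continuous_entropy : Continuous entropy := by
  have : entropy = fun x => x * Real.log x - x + 1 := funext entropy_eq
  rw [this]
  have := Real.continuous_mul_log
  fun_prop

/-- Relative entropy dominates the squared difference of square roots, a consequence of `log r ≤ r -
1` at `r = √m / √a`. Taking `m = 1`, `m = exp l` and `m` the midpoint gives positivity, superlinear
growth and strong convexity of the entropy. -/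
lemma sq_sqrt_sub_sqrt_le {a m : ℝ} (ha : 0 ≤ a) (hm : 0 < m) :
    (√a - √m) ^ 2 ≤ a * Real.log a - a * Real.log m - a + m := by
  have hma := Real.sq_sqrt ha
  have hmm := Real.sq_sqrt hm.le
  rcases ha.eq_or_lt with rfl | ha
  · simp [hmm]
  have h1 : Real.log (√m / √a) ≤ √m / √a - 1 :=
    Real.log_le_sub_one_of_pos (div_pos (Real.sqrt_pos.2 hm) (Real.sqrt_pos.2 ha))
  rw [Real.log_div (Real.sqrt_pos.2 hm).ne' (Real.sqrt_pos.2 ha).ne', Real.log_sqrt hm.le,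
    Real.log_sqrt ha.le] at h1
  have h2 := mul_le_mul_of_nonneg_left h1 ha.le
  have h3 : a * (√m / √a - 1) = √a * √m - a := by
    have := (Real.sqrt_pos.2 ha).ne'
    field_simp
    linear_combination (-√m) * hma
  nlinarith

lemma entropy_nonneg {x : ℝ} (hx : 0 ≤ x) : 0 ≤ entropy x := by
  have := sq_sqrt_sub_sqrt_le hx one_pos
  rw [Real.log_one] at this
  rw [entropy_eq]
  nlinarith [sq_nonneg (√x - √1)]

lemma le_entropy (l : ℝ) {x : ℝ} (hx : 0 ≤ x) : l * x - Real.exp l ≤ entropy x := by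
  have := sq_sqrt_sub_sqrt_le hx (Real.exp_pos l)
  rw [Real.log_exp] at this
  rw [entropy_eq]
  nlinarith [sq_nonneg (√x - √(Real.exp l))]

/-- Strong midpoint convexity of the entropy. -/
lemma entropy_midpoint {a b : ℝ} (ha : 0 ≤ a) (hb : 0 ≤ b) :
    2 * entropy (2⁻¹ * a + 2⁻¹ * b) + (√a - √b) ^ 2 / 2 ≤ entropy a + entropy b := by
  rcases (show 0 ≤ 2⁻¹ * a + 2⁻¹ * b by positivity).eq_or_lt with h | h
  · obtain rfl : a = 0 := by linarith
    obtain rfl : b = 0 := by linarith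
    simp [two_mul]
  · have h1 := sq_sqrt_sub_sqrt_le ha h
    have h2 := sq_sqrt_sub_sqrt_le hb h
    set m := 2⁻¹ * a + 2⁻¹ * b with hm
    rw [entropy_eq, entropy_eq, entropy_eq]
    have h3 : 2 * (m * Real.log m) = a * Real.log m + b * Real.log m := by rw [hm]; ring
    -- Parallelogram law: `(√a - √m)² + (√b - √m)² ≥ (√a - √b)² / 2`.
    nlinarith [sq_nonneg (√a + √b - 2 * √m)]

/-- Factor `a - b = (√a - √b)(√a + √b)` and apply Young's inequality with weight `τ`. This converts
the convexity gain into closeness in `L¹`. -/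
lemma abs_sub_le_sq_sqrt {a b τ : ℝ} (ha : 0 ≤ a) (hb : 0 ≤ b) (hτ : 0 < τ) :
    |a - b| ≤ (√a - √b) ^ 2 / (2 * τ) + τ * (a + b) := by
  have h1 : a - b = (√a - √b) * (√a + √b) := by
    nlinarith [Real.sq_sqrt ha, Real.sq_sqrt hb]
  have h2 : (√a + √b) ^ 2 ≤ 2 * (a + b) := by
    nlinarith [Real.sq_sqrt ha, Real.sq_sqrt hb, sq_nonneg (√a - √b)]
  rw [h1, abs_mul, abs_of_nonneg (a := √a + √b) (by positivity), ← sq_abs (√a - √b)]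
  set p := |√a - √b|
  set q := √a + √b
  have h3 : p * q ≤ p ^ 2 / (2 * τ) + τ / 2 * q ^ 2 := by
    have : p ^ 2 / (2 * τ) + τ / 2 * q ^ 2 - p * q = (p - τ * q) ^ 2 / (2 * τ) := by
      field_simp
      ring
    have h4 : 0 ≤ (p - τ * q) ^ 2 / (2 * τ) := by positivity
    linarith
  nlinarith

/-! ### The functionals on functions of bounded variation. -/

/-- Bounded Lipschitz domains with the interior sphere condition. -/
structure IsSphereDomain (Ω : Set (𝔼 n)) (R : ℝ) : Prop where
  isOpen : IsOpen Ω
  isBounded : Bornology.IsBounded Ω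
  hasLipschitzBoundary : HasLipschitzBoundary Ω
  pos : 0 < R
  interiorSphere : InteriorSphereCondition Ω R

section functionals

variable {Ω : Set (𝔼 n)} {R : ℝ}

lemma integral_testField (hΩ : IsOpen Ω) {u : (𝔼 n) → ℝ} (hu : IntegrableOn u Ω) {g : (𝔼 n) → 𝔼 n}
    {h : (𝔼 n) → ℝ} (H : IsTestField Ω g h) :
    ∫ x in Ω, u x * (h x + divergence g x)
      = (∫ x in Ω, u x * h x) + ∫ x, Ω.indicator u x * divergence g x := by
  have hw : Integrable (Ω.indicator u) := (integrable_indicator_iff hΩ.measurableSet).2 hu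
  have e1 : ∀ f : (𝔼 n) → ℝ, ∫ x in Ω, u x * f x = ∫ x, Ω.indicator u x * f x := fun f => by
    rw [← integral_indicator hΩ.measurableSet]
    exact integral_congr_ae (Eventually.of_forall fun x => indicator_mul_left Ω u f)
  rw [e1, e1, ← integral_add]
  · simp_rw [mul_add]
  · exact hw.mul_bdd (c := 1) H.contDiff_snd.continuous.aestronglyMeasurable
      (Eventually.of_forall fun x => abs_le_one_iff_mul_self_le_one.2 (by
        nlinarith [H.sq_add_sq_le_one x, sq_nonneg ‖g x‖]))
  · exact integrable_mul_divergence hw.locallyIntegrable H.contDiff_fst H.hasCompactSupport_fst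

lemma integral_mul_le_of_isTestField {u : (𝔼 n) → ℝ} (hu : IntegrableOn u Ω) {g : (𝔼 n) → 𝔼 n}
    {h : (𝔼 n) → ℝ} (H : IsTestField Ω g h) : ∫ x in Ω, u x * h x ≤ ∫ x in Ω, |u x| := by
  have hb : ∀ x, |h x| ≤ 1 := fun x => abs_le_one_iff_mul_self_le_one.2 (by
    nlinarith [H.sq_add_sq_le_one x, sq_nonneg ‖g x‖])
  refine integral_mono (hu.mul_bdd (c := 1) H.contDiff_snd.continuous.aestronglyMeasurable
    (Eventually.of_forall hb)) hu.abs fun x => (le_abs_self _).trans ?_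
  simp only [abs_mul]
  exact mul_le_of_le_one_right (abs_nonneg _) (hb x)

lemma variation_ne_top_of_mem_BV (hΩ : IsOpen Ω) {u : (𝔼 n) → ℝ} (hu : u ∈ BV Ω) :
    variation (Ω.indicator u) Ω ≠ ∞ := by
  obtain ⟨hui, huA⟩ := hu
  have hle : ∀ g, IsUnitField Ω g → ((∫ x, Ω.indicator u x * divergence g x : ℝ) : EReal)
      ≤ areaEnergy Ω u := by
    intro g hg
    have H := isUnitField_iff_isTestField.1 hg
    refine le_trans (le_of_eq ?_) (le_iSup₂_of_le g 0 (le_iSup_of_le H le_rfl))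
    have h1 := integral_testField hΩ hui H
    simp only [Pi.zero_apply, zero_add, mul_zero, integral_zero] at h1 ⊢
    rw [h1]
  have h0 : (0 : EReal) ≤ areaEnergy Ω u := by
    have := hle 0 (isUnitField_zero Ω)
    simpa [divergence_zero] using this
  lift areaEnergy Ω u to ℝ using ⟨huA.ne, (lt_of_lt_of_le EReal.bot_lt_zero h0).ne'⟩ with M
  refine ne_top_of_le_ne_top (ENNReal.ofReal_ne_top (r := M)) (iSup₂_le fun g hg => ?_)
  exact ENNReal.ofReal_le_ofReal (EReal.coe_le_coe_iff.1 (hle g hg))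

lemma mem_BV (hΩ : IsOpen Ω) (hfin : volume Ω ≠ ∞) {u : (𝔼 n) → ℝ} (hu : IntegrableOn u Ω)
    (hV : variation (Ω.indicator u) Ω ≠ ∞) : u ∈ BV Ω := by
  refine ⟨hu, lt_of_le_of_lt (b := ((volume.real Ω + (variation (Ω.indicator u) Ω).toReal : ℝ) : EReal))
    (iSup₂_le fun g h => iSup_le fun H => EReal.coe_le_coe_iff.2 ?_) (EReal.coe_lt_top _)⟩
  have hw : Integrable (Ω.indicator u) := (integrable_indicator_iff hΩ.measurableSet).2 hu
  have hb : ∀ x, |h x| ≤ 1 := fun x => abs_le_one_iff_mul_self_le_one.2 (by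
    nlinarith [H.sq_add_sq_le_one x, sq_nonneg ‖g x‖])
  have e1 : ∫ x in Ω, u x * divergence g x = ∫ x, Ω.indicator u x * divergence g x := by
    rw [← integral_indicator hΩ.measurableSet]
    exact integral_congr_ae (Eventually.of_forall fun x => indicator_mul_left Ω u (divergence g))
  have hi : IntegrableOn (fun x => u x * divergence g x) Ω := by
    refine (integrable_mul_divergence hw.locallyIntegrable H.contDiff_fst
      H.hasCompactSupport_fst).integrableOn.congr_fun (fun x hx => ?_) hΩ.measurableSet
    simp only [indicator_of_mem hx]
  have hh : IntegrableOn h Ω := (H.contDiff_snd.continuous.integrable_of_hasCompactSupport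
    H.hasCompactSupport_snd).integrableOn
  rw [integral_add hh hi, e1]
  refine add_le_add ?_ (integral_le_variation hV H.fst)
  calc ∫ x in Ω, h x ≤ ∫ x in Ω, (1 : ℝ) :=
        integral_mono hh (integrableOn_const hfin) fun x => (abs_le.1 (hb x)).2
    _ = volume.real Ω := by simp

/-- The surface energy as a real number. -/
def realSurfaceEnergy (Ω : Set (𝔼 n)) (u : (𝔼 n) → ℝ) : ℝ := (surfaceEnergy Ω u).toReal

lemma coe_realSurfaceEnergy (hΩ : IsOpen Ω) {u : (𝔼 n) → ℝ} (hu : u ∈ BV Ω) :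
    ((realSurfaceEnergy Ω u : ℝ) : EReal) = surfaceEnergy Ω u := by
  refine EReal.coe_toReal (ne_top_of_le_ne_top (EReal.coe_ne_top
    ((∫ x in Ω, |u x|) + (variation (Ω.indicator u) Ω).toReal)) ?_) ?_
  · refine iSup₂_le fun g h => iSup_le fun H => EReal.coe_le_coe_iff.2 ?_
    rw [integral_testField hΩ hu.1 H]
    exact add_le_add (integral_mul_le_of_isTestField hu.1 H)
      (integral_le_variation (variation_ne_top_of_mem_BV hΩ hu) H.fst)
  · have h0 : ((∫ x in Ω, u x * ((0 : (𝔼 n) → ℝ) x + divergence 0 x) : ℝ) : EReal)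
        ≤ surfaceEnergy Ω u :=
      le_iSup₂_of_le 0 0 (le_iSup_of_le (isUnitField_iff_isTestField.1 (isUnitField_zero Ω)) le_rfl)
    intro h
    rw [h] at h0
    exact EReal.coe_ne_bot _ (le_bot_iff.1 h0)

lemma integral_testField_le (hΩ : IsOpen Ω) {u : (𝔼 n) → ℝ} (hu : u ∈ BV Ω) {g : (𝔼 n) → 𝔼 n}
    {h : (𝔼 n) → ℝ} (H : IsTestField Ω g h) :
    ∫ x in Ω, u x * (h x + divergence g x) ≤ realSurfaceEnergy Ω u := by
  rw [← EReal.coe_le_coe_iff, coe_realSurfaceEnergy hΩ hu]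
  exact le_iSup₂_of_le g h (le_iSup_of_le H le_rfl)

lemma realSurfaceEnergy_le (hΩ : IsOpen Ω) {u : (𝔼 n) → ℝ} (hu : u ∈ BV Ω) {M : ℝ}
    (hM : ∀ g h, IsTestField Ω g h → ∫ x in Ω, u x * (h x + divergence g x) ≤ M) :
    realSurfaceEnergy Ω u ≤ M := by
  rw [← EReal.coe_le_coe_iff, coe_realSurfaceEnergy hΩ hu]
  exact iSup₂_le fun g h => iSup_le fun H => EReal.coe_le_coe_iff.2 (hM g h H)

lemma variation_le_realSurfaceEnergy (hΩ : IsOpen Ω) {u : (𝔼 n) → ℝ} (hu : u ∈ BV Ω) :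
    (variation (Ω.indicator u) Ω).toReal ≤ realSurfaceEnergy Ω u := by
  have hle : ∀ g, IsUnitField Ω g → ∫ x, Ω.indicator u x * divergence g x ≤ realSurfaceEnergy Ω u := by
    intro g hg
    have H := isUnitField_iff_isTestField.1 hg
    have h1 := integral_testField_le hΩ hu H
    rw [integral_testField hΩ hu.1 H] at h1
    simpa using h1
  have h0 : 0 ≤ realSurfaceEnergy Ω u := by
    have := hle 0 (isUnitField_zero Ω)
    simpa [divergence_zero] using this
  rw [← ENNReal.le_ofReal_iff_toReal_le (variation_ne_top_of_mem_BV hΩ hu) h0]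
  exact iSup₂_le fun g hg => ENNReal.ofReal_le_ofReal (hle g hg)

end functionals

/-! ### Traces and energy on sphere domains. -/

section capillary

variable {Ω : Set (𝔼 n)} {R : ℝ}

lemma IsSphereDomain.volume_ne_top (hD : IsSphereDomain Ω R) : volume Ω ≠ ∞ :=
  hD.isBounded.measure_lt_top.ne

lemma integrable_indicator_of_mem_BV (hΩ : IsOpen Ω) {u : (𝔼 n) → ℝ} (hu : u ∈ BV Ω) :
    Integrable (Ω.indicator u) := (integrable_indicator_iff hΩ.measurableSet).2 hu.1

lemma IsSphereDomain.ae_hasTrace (hD : IsSphereDomain Ω R) {u : (𝔼 n) → ℝ} (hu : u ∈ BV Ω) :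
    ∀ᵐ x ∂(surfaceMeasure Ω), HasTrace Ω u x (trace Ω u x) := by
  refine ae_trace_eq hD.interiorSphere hD.pos hu.1 ?_
  filter_upwards [ae_exists_hasTrace hD.isOpen hD.hasLipschitzBoundary
    (integrable_indicator_of_mem_BV hD.isOpen hu) (variation_ne_top_of_mem_BV hD.isOpen hu)]
    with x ⟨c, hc⟩
  exact ⟨c, (hasTrace_indicator_iff hD.isOpen).1 hc⟩

lemma integral_abs_indicator (hΩ : IsOpen Ω) (u : (𝔼 n) → ℝ) :
    ∫ x, |Ω.indicator u x| = ∫ x in Ω, |u x| := by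
  rw [← integral_indicator hΩ.measurableSet]
  refine integral_congr_ae (Eventually.of_forall fun x => ?_)
  by_cases hx : x ∈ Ω <;> simp [hx]

lemma IsSphereDomain.integrable_trace (hD : IsSphereDomain Ω R) {u : (𝔼 n) → ℝ} (hu : u ∈ BV Ω) :
    Integrable (trace Ω u) (surfaceMeasure Ω) := by
  have hT := hD.ae_hasTrace hu
  refine ⟨aestronglyMeasurable_trace hD.isOpen hD.interiorSphere hD.pos hu.1 hT, ?_⟩
  obtain ⟨C, -, hC⟩ := exists_sharp_trace_inequality hD.isOpen hD.isBounded hD.pos hD.interiorSphere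
    (a := 1 / 2) (δ := 1) (by norm_num) one_pos
  have h := hC (Ω.indicator u) (trace Ω u) (integrable_indicator_of_mem_BV hD.isOpen hu)
    (hT.mono fun x hx => (hasTrace_indicator_iff hD.isOpen).2 hx)
  have hfin : ENNReal.ofReal (1 - 1 / 2) * ∫⁻ x, ‖trace Ω u x‖ₑ ∂(surfaceMeasure Ω) < ∞ :=
    h.trans_lt (ENNReal.add_lt_top.2 ⟨(variation_mono inter_subset_left).trans_lt
      (variation_ne_top_of_mem_BV hD.isOpen hu).lt_top, ENNReal.ofReal_lt_top⟩)
  exact ENNReal.lt_top_of_mul_ne_top_right hfin.ne (by simp; norm_num)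

lemma IsSphereDomain.trace_linear (hD : IsSphereDomain Ω R) {u v : (𝔼 n) → ℝ} (hu : u ∈ BV Ω)
    (hv : v ∈ BV Ω) (α β : ℝ) : ∀ᵐ x ∂(surfaceMeasure Ω),
      HasTrace Ω (fun y => α * u y + β * v y) x (α * trace Ω u x + β * trace Ω v x) ∧
      trace Ω (fun y => α * u y + β * v y) x = α * trace Ω u x + β * trace Ω v x := by
  filter_upwards [hD.ae_hasTrace hu, hD.ae_hasTrace hv,
    ae_restrict_mem isClosed_frontier.measurableSet] with x hx hx' hxf
  have h := hx.linear hu.1.1 hx' α β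
  exact ⟨h, trace_eq_of_hasTrace hD.interiorSphere hD.pos
    ((hu.1.const_mul α).add (hv.1.const_mul β)) hxf h⟩

/-- The sharp trace inequality for the difference of two functions of bounded variation. -/
lemma IsSphereDomain.exists_integral_trace_sub_le (hD : IsSphereDomain Ω R) {a δ : ℝ} (ha : 0 < a)
    (ha' : a ≤ 1) (hδ : 0 < δ) : ∃ C : ℝ, 0 ≤ C ∧ ∀ u ∈ BV Ω, ∀ v ∈ BV Ω,
      (1 - a) * ∫ x, |trace Ω u x - trace Ω v x| ∂(surfaceMeasure Ω) ≤
        (variation (Ω.indicator u) (Ω ∩ Metric.thickening δ (frontier Ω))).toReal +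
        (variation (Ω.indicator v) (Ω ∩ Metric.thickening δ (frontier Ω))).toReal +
        C * ∫ x in Ω, |u x - v x| := by
  obtain ⟨C, hC, h⟩ := exists_sharp_trace_inequality hD.isOpen hD.isBounded hD.pos hD.interiorSphere
    ha hδ
  refine ⟨C, hC, fun u hu v hv => ?_⟩
  have hwu := integrable_indicator_of_mem_BV hD.isOpen hu
  have hwv := integrable_indicator_of_mem_BV hD.isOpen hv
  set U := Ω ∩ Metric.thickening δ (frontier Ω)
  have hVu : variation (Ω.indicator u) U ≠ ∞ := ne_top_of_le_ne_top
    (variation_ne_top_of_mem_BV hD.isOpen hu) (variation_mono inter_subset_left)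
  have hVv : variation (Ω.indicator v) U ≠ ∞ := ne_top_of_le_ne_top
    (variation_ne_top_of_mem_BV hD.isOpen hv) (variation_mono inter_subset_left)
  have hT : ∀ᵐ x ∂(surfaceMeasure Ω),
      HasTrace Ω (Ω.indicator u - Ω.indicator v) x (trace Ω u x - trace Ω v x) := by
    filter_upwards [hD.trace_linear hu hv 1 (-1)] with x hx
    have h1 := (hasTrace_indicator_iff hD.isOpen).2 hx.1
    have e1 : Ω.indicator (fun y => 1 * u y + -1 * v y) = Ω.indicator u - Ω.indicator v := by
      rw [← indicator_sub']
      congr 1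
      ext y
      simp [sub_eq_add_neg]
    have e2 : 1 * trace Ω u x + -1 * trace Ω v x = trace Ω u x - trace Ω v x := by ring
    rwa [e1, e2] at h1
  have key := h _ _ (hwu.sub hwv) hT
  have hdiff : Integrable (fun x => trace Ω u x - trace Ω v x) (surfaceMeasure Ω) :=
    (hD.integrable_trace hu).sub (hD.integrable_trace hv)
  have e3 : ∫ x, |(Ω.indicator u - Ω.indicator v) x| = ∫ x in Ω, |u x - v x| := by
    rw [← indicator_sub', integral_abs_indicator hD.isOpen]
    rfl
  have h0 : 0 ≤ ∫ x in Ω, |u x - v x| := integral_nonneg fun x => abs_nonneg _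
  have ha0 : 0 ≤ 1 - a := by linarith
  rw [← ofReal_integral_norm_eq_lintegral_enorm hdiff, e3, ← ENNReal.ofReal_mul ha0] at key
  have key2 := key.trans (add_le_add_left (variation_sub_le hwu.locallyIntegrable
    hwv.locallyIntegrable U) _)
  rw [← ENNReal.ofReal_toReal hVu, ← ENNReal.ofReal_toReal hVv,
    ← ENNReal.ofReal_add ENNReal.toReal_nonneg ENNReal.toReal_nonneg,
    ← ENNReal.ofReal_add (by positivity) (by positivity),
    ENNReal.ofReal_le_ofReal_iff (by positivity)] at key2
  exact key2

lemma zero_mem_BV (hD : IsSphereDomain Ω R) : (0 : (𝔼 n) → ℝ) ∈ BV Ω := by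
  refine mem_BV hD.isOpen hD.volume_ne_top integrableOn_zero ?_
  simp [variation]

lemma IsSphereDomain.ae_trace_zero (hD : IsSphereDomain Ω R) :
    ∀ᵐ x ∂(surfaceMeasure Ω), trace Ω 0 x = 0 := by
  filter_upwards [ae_restrict_mem isClosed_frontier.measurableSet] with x hx
  refine trace_eq_of_hasTrace hD.interiorSphere hD.pos integrableOn_zero hx fun a _ => ?_
  simp

lemma IsSphereDomain.exists_integral_trace_le (hD : IsSphereDomain Ω R) {a : ℝ} (ha : 0 < a)
    (ha' : a ≤ 1) : ∃ C : ℝ, 0 ≤ C ∧ ∀ u ∈ BV Ω,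
      (1 - a) * ∫ x, |trace Ω u x| ∂(surfaceMeasure Ω) ≤
        realSurfaceEnergy Ω u + C * ∫ x in Ω, |u x| := by
  obtain ⟨C, hC, h⟩ := hD.exists_integral_trace_sub_le ha ha' one_pos
  refine ⟨C, hC, fun u hu => ?_⟩
  have h1 := h u hu 0 (zero_mem_BV hD)
  have e1 : ∫ x, |trace Ω u x - trace Ω 0 x| ∂(surfaceMeasure Ω)
      = ∫ x, |trace Ω u x| ∂(surfaceMeasure Ω) :=
    integral_congr_ae (hD.ae_trace_zero.mono fun x hx => by simp only [hx, sub_zero])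
  have e2 : variation (Ω.indicator (0 : (𝔼 n) → ℝ)) (Ω ∩ Metric.thickening 1 (frontier Ω)) = 0 := by
    simp [variation]
  rw [e1, e2, ENNReal.toReal_zero, add_zero] at h1
  simp only [Pi.zero_apply, sub_zero] at h1
  refine h1.trans (add_le_add_left ?_ _)
  refine le_trans ?_ (variation_le_realSurfaceEnergy hD.isOpen hu)
  exact ENNReal.toReal_mono (variation_ne_top_of_mem_BV hD.isOpen hu) (variation_mono inter_subset_left)

/-- Functions of finite energy. -/
structure HasFiniteEnergy (Ω : Set (𝔼 n)) (u : (𝔼 n) → ℝ) : Prop where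
  mem : u ∈ BV Ω
  nonneg : ∀ᵐ x ∂(volume.restrict Ω), 0 ≤ u x
  integrable : IntegrableOn (fun x => entropy (u x)) Ω

/-- The energy as a real number. -/
def realEnergy (Ω : Set (𝔼 n)) (β u : (𝔼 n) → ℝ) : ℝ :=
  realSurfaceEnergy Ω u + (∫ x in Ω, entropy (u x)) - boundaryTerm Ω β u

lemma HasFiniteEnergy.energy_eq (hΩ : IsOpen Ω) {u : (𝔼 n) → ℝ} (hu : HasFiniteEnergy Ω u)
    (β : (𝔼 n) → ℝ) : energy Ω β u = (realEnergy Ω β u : EReal) := by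
  have h0 : 0 ≤ᵐ[volume.restrict Ω] fun x => entropy (u x) := hu.nonneg.mono fun x hx => entropy_nonneg hx
  have hP : potentialEnergy Ω u = ENNReal.ofReal (∫ x in Ω, entropy (u x)) :=
    (ofReal_integral_eq_lintegral_ofReal hu.integrable h0).symm
  rw [energy, ← coe_realSurfaceEnergy hΩ hu.mem, hP, EReal.coe_ennreal_ofReal,
    max_eq_left (integral_nonneg_of_ae h0), realEnergy]
  push_cast
  rfl

/-- On `BV⁺` the surface energy and the boundary term are real, so only an infinite potential energy
can violate finiteness. -/
lemma energy_eq_top (hΩ : IsOpen Ω) {u : (𝔼 n) → ℝ} (hu : u ∈ BVPlus Ω)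
    (h : ¬ HasFiniteEnergy Ω u) (β : (𝔼 n) → ℝ) : energy Ω β u = ⊤ := by
  have hP : potentialEnergy Ω u = ∞ := by
    by_contra hne
    refine h ⟨hu.1, hu.2, continuous_entropy.comp_aestronglyMeasurable hu.1.1.1, ?_⟩
    rw [hasFiniteIntegral_iff_ofReal (hu.2.mono fun x hx => entropy_nonneg hx)]
    exact lt_top_iff_ne_top.2 hne
  rw [energy, ← coe_realSurfaceEnergy hΩ hu.1, hP]
  simp

lemma hasFiniteEnergy_zero (hD : IsSphereDomain Ω R) : HasFiniteEnergy Ω (0 : (𝔼 n) → ℝ) :=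
  ⟨zero_mem_BV hD, Eventually.of_forall fun _ => le_rfl, 
    (integrableOn_const (C := entropy 0) hD.volume_ne_top : IntegrableOn (fun _ => entropy 0) Ω)⟩

/-! ### Control of the boundary term and coercivity. -/

section adhesion

variable {β : (𝔼 n) → ℝ} {a : ℝ}

lemma IsSphereDomain.integrable_boundaryTerm (hD : IsSphereDomain Ω R)
    (hβm : AEStronglyMeasurable β (surfaceMeasure Ω))
    (hβ : ∀ᵐ x ∂(surfaceMeasure Ω), |β x| ≤ 1 - a) {u : (𝔼 n) → ℝ} (hu : u ∈ BV Ω) :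
    Integrable (fun x => β x * (1 - trace Ω u x)) (surfaceMeasure Ω) := by
  have := isFiniteMeasure_surfaceMeasure hD.isOpen hD.isBounded hD.pos hD.interiorSphere
  exact ((integrable_const (1 : ℝ)).sub (hD.integrable_trace hu)).bdd_mul hβm hβ

lemma IsSphereDomain.abs_boundaryTerm_sub_le (hD : IsSphereDomain Ω R)
    (hβm : AEStronglyMeasurable β (surfaceMeasure Ω))
    (hβ : ∀ᵐ x ∂(surfaceMeasure Ω), |β x| ≤ 1 - a) {u v : (𝔼 n) → ℝ} (hu : u ∈ BV Ω)
    (hv : v ∈ BV Ω) : |boundaryTerm Ω β u - boundaryTerm Ω β v| ≤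
      (1 - a) * ∫ x, |trace Ω u x - trace Ω v x| ∂(surfaceMeasure Ω) := by
  rw [boundaryTerm, boundaryTerm, ← integral_sub (hD.integrable_boundaryTerm hβm hβ hu)
    (hD.integrable_boundaryTerm hβm hβ hv), ← integral_const_mul]
  refine abs_integral_le_integral_abs.trans (integral_mono_ae
    ((hD.integrable_boundaryTerm hβm hβ hu).sub (hD.integrable_boundaryTerm hβm hβ hv)).abs
    (((hD.integrable_trace hu).sub (hD.integrable_trace hv)).abs.const_mul _) ?_)
  filter_upwards [hβ] with x hx
  have : β x * (1 - trace Ω u x) - β x * (1 - trace Ω v x)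
      = -(β x * (trace Ω u x - trace Ω v x)) := by ring
  simp only [this, abs_neg, abs_mul]
  exact mul_le_mul_of_nonneg_right hx (abs_nonneg _)

/-- Coercivity of the energy. -/
lemma IsSphereDomain.exists_coercive (hD : IsSphereDomain Ω R) (ha : 0 < a) (ha' : a ≤ 1)
    (hβm : AEStronglyMeasurable β (surfaceMeasure Ω))
    (hβ : ∀ᵐ x ∂(surfaceMeasure Ω), |β x| ≤ 1 - a) :
    ∃ K : ℝ, ∀ u, HasFiniteEnergy Ω u →
      a / 2 * realSurfaceEnergy Ω u + (∫ x in Ω, |u x|) ≤ realEnergy Ω β u + K := by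
  -- The margin `a` is split: since `1 - a ≤ (1 - a / 2)²`, the boundary term uses the fraction `1 -
  -- a / 2` of the surface energy and leaves `a / 2`.
  obtain ⟨C, hC, h⟩ := hD.exists_integral_trace_le (a := a / 2) (by linarith) (by linarith)
  -- The entropy dominates every linear function up to a constant. Slope `C + 1` absorbs the
  -- lower-order term of the trace inequality and leaves one copy of the `L¹` norm.
  set l := C + 1 with hl
  refine ⟨volume.real Ω * Real.exp l + boundaryTerm Ω β 0, fun u hu => ?_⟩
  have h1 := h u hu.mem
  have h2 := (abs_le.1 (hD.abs_boundaryTerm_sub_le hβm hβ hu.mem (zero_mem_BV hD))).2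
  have e1 : ∫ x, |trace Ω u x - trace Ω 0 x| ∂(surfaceMeasure Ω)
      = ∫ x, |trace Ω u x| ∂(surfaceMeasure Ω) :=
    integral_congr_ae (hD.ae_trace_zero.mono fun x hx => by simp only [hx, sub_zero])
  rw [e1] at h2
  set I := ∫ x, |trace Ω u x| ∂(surfaceMeasure Ω)
  set N := ∫ x in Ω, |u x|
  have hI : 0 ≤ I := integral_nonneg fun x => abs_nonneg _
  have hN : 0 ≤ N := integral_nonneg fun x => abs_nonneg _
  have h3 : (1 - a) * I ≤ (1 - a / 2) * (realSurfaceEnergy Ω u + C * N) := by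
    have : (1 - a) * I ≤ (1 - a / 2) * ((1 - a / 2) * I) := by nlinarith [sq_nonneg a]
    exact this.trans (mul_le_mul_of_nonneg_left h1 (by linarith))
  have h4 : l * N - volume.real Ω * Real.exp l ≤ ∫ x in Ω, entropy (u x) := by
    have hi : IntegrableOn (fun _ : 𝔼 n => Real.exp l) Ω := integrableOn_const hD.volume_ne_top
    have e2 : l * N - volume.real Ω * Real.exp l = ∫ x in Ω, (l * |u x| - Real.exp l) := by
      rw [integral_sub (hu.mem.1.abs.const_mul l) hi, integral_const_mul, setIntegral_const, smul_eq_mul]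
    rw [e2]
    refine integral_mono_ae ((hu.mem.1.abs.const_mul l).sub hi) hu.integrable ?_
    filter_upwards [hu.nonneg] with x hx
    simp only [abs_of_nonneg hx]
    exact le_entropy l hx
  have h5 : 0 ≤ a / 2 * (C * N) := by positivity
  rw [realEnergy]
  nlinarith

end adhesion

end capillary

/-! ### Localisation of the surface energy and midpoint convexity. -/

section minimiser

variable {Ω : Set (𝔼 n)} {R : ℝ}

lemma integrableOn_mul_testField {u : (𝔼 n) → ℝ} (hu : IntegrableOn u Ω) {g : (𝔼 n) → 𝔼 n}
    {h : (𝔼 n) → ℝ} (H : IsTestField Ω g h) :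
    ∃ B : ℝ, 0 ≤ B ∧ (∀ x, |h x + divergence g x| ≤ B) ∧
      IntegrableOn (fun x => u x * (h x + divergence g x)) Ω := by
  have hc : Continuous fun x => h x + divergence g x :=
    H.contDiff_snd.continuous.add (continuous_divergence H.contDiff_fst)
  obtain ⟨B, hB⟩ := hc.bounded_above_of_compact_support
    (H.hasCompactSupport_snd.add (hasCompactSupport_divergence H.hasCompactSupport_fst))
  exact ⟨B, (norm_nonneg _).trans (hB 0), hB,
    hu.mul_bdd hc.aestronglyMeasurable (Eventually.of_forall hB)⟩

lemma tendsto_integral_testField {u : ℕ → (𝔼 n) → ℝ} {v : (𝔼 n) → ℝ} (hu : ∀ k, IntegrableOn (u k) Ω)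
    (hv : IntegrableOn v Ω) (huv : Tendsto (fun k => ∫ x in Ω, |u k x - v x|) atTop (𝓝 0))
    {g : (𝔼 n) → 𝔼 n} {h : (𝔼 n) → ℝ} (H : IsTestField Ω g h) :
    Tendsto (fun k => ∫ x in Ω, u k x * (h x + divergence g x)) atTop
      (𝓝 (∫ x in Ω, v x * (h x + divergence g x))) := by
  obtain ⟨B, hB0, hB, hvi⟩ := integrableOn_mul_testField hv H
  rw [tendsto_iff_dist_tendsto_zero]
  refine squeeze_zero (fun _ => dist_nonneg) (fun k => ?_) (by simpa using huv.const_mul B)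
  obtain ⟨-, -, -, hui⟩ := integrableOn_mul_testField (hu k) H
  rw [Real.dist_eq, ← integral_sub hui hvi, ← integral_const_mul]
  refine abs_integral_le_integral_abs.trans (integral_mono (hui.sub hvi).abs
    (((hu k).sub hv).abs.const_mul B) fun x => ?_)
  simp only [← sub_mul, abs_mul]
  rw [mul_comm]
  exact mul_le_mul_of_nonneg_right (hB x) (abs_nonneg _)

lemma isTestField_add {U : Set (𝔼 n)} (hU : U ⊆ Ω) {g g' : (𝔼 n) → 𝔼 n} {h : (𝔼 n) → ℝ}
    (H : IsTestField Ω g h) (hg' : IsUnitField U g') (hd : Disjoint U (tsupport g ∪ tsupport h)) :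
    IsTestField Ω (g + g') h := by
  refine ⟨H.contDiff_fst.add hg'.contDiff, H.contDiff_snd,
    H.hasCompactSupport_fst.add hg'.hasCompactSupport, H.hasCompactSupport_snd,
    (tsupport_add _ _).trans (union_subset H.tsupport_fst_subset (hg'.tsupport_subset.trans hU)),
    H.tsupport_snd_subset, fun x => ?_⟩
  by_cases hx : x ∈ U
  · have hx' := Set.disjoint_left.1 hd hx
    rw [mem_union, not_or] at hx'
    have h1 : g x = 0 := image_eq_zero_of_notMem_tsupport hx'.1
    have h2 : h x = 0 := image_eq_zero_of_notMem_tsupport hx'.2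
    have := hg'.norm_le_one x
    simp only [Pi.add_apply, h1, h2, zero_add]
    nlinarith [norm_nonneg (g' x)]
  · have h1 : g' x = 0 := image_eq_zero_of_notMem_tsupport fun hx' => hx (hg'.tsupport_subset hx')
    simpa [h1] using H.sq_add_sq_le_one x

/-- Any unit field supported in `U` may be added to `g`, since the supports do not meet. The
supremum over such fields shows that the surface energy contains the tested integral and the
variation in `U` simultaneously. -/
lemma integral_testField_add_variation_le (hΩ : IsOpen Ω) {U : Set (𝔼 n)} (hU : U ⊆ Ω)
    {u : (𝔼 n) → ℝ} (hu : u ∈ BV Ω) {g : (𝔼 n) → 𝔼 n} {h : (𝔼 n) → ℝ} (H : IsTestField Ω g h)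
    (hd : Disjoint U (tsupport g ∪ tsupport h)) :
    (∫ x in Ω, u x * (h x + divergence g x)) + (variation (Ω.indicator u) U).toReal
      ≤ realSurfaceEnergy Ω u := by
  have hw := integrable_indicator_of_mem_BV hΩ hu
  have hle : ∀ g', IsUnitField U g' → ∫ x, Ω.indicator u x * divergence g' x
      ≤ realSurfaceEnergy Ω u - ∫ x in Ω, u x * (h x + divergence g x) := by
    intro g' hg'
    have H' := isTestField_add hU H hg' hd
    have h1 := integral_testField_le hΩ hu H'
    rw [integral_testField hΩ hu.1 H'] at h1
    rw [integral_testField hΩ hu.1 H]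
    have e1 : ∫ x, Ω.indicator u x * divergence (g + g') x
        = (∫ x, Ω.indicator u x * divergence g x) + ∫ x, Ω.indicator u x * divergence g' x := by
      rw [← integral_add (integrable_mul_divergence hw.locallyIntegrable H.contDiff_fst
        H.hasCompactSupport_fst) (integrable_mul_divergence hw.locallyIntegrable hg'.contDiff
        hg'.hasCompactSupport)]
      refine integral_congr_ae (Eventually.of_forall fun x => ?_)
      simp only
      rw [divergence_add (H.contDiff_fst.differentiable one_ne_zero x)
        (hg'.contDiff.differentiable one_ne_zero x)]
      ring
    rw [e1] at h1
    linarith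
  have h0 := integral_testField_le hΩ hu H
  have hV : variation (Ω.indicator u) U
      ≤ ENNReal.ofReal (realSurfaceEnergy Ω u - ∫ x in Ω, u x * (h x + divergence g x)) :=
    iSup₂_le fun g' hg' => ENNReal.ofReal_le_ofReal (hle g' hg')
  have := ENNReal.toReal_le_of_le_ofReal (by linarith) hV
  linarith

lemma realSurfaceEnergy_nonneg (hΩ : IsOpen Ω) {u : (𝔼 n) → ℝ} (hu : u ∈ BV Ω) :
    0 ≤ realSurfaceEnergy Ω u :=
  ENNReal.toReal_nonneg.trans (variation_le_realSurfaceEnergy hΩ hu)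

lemma mem_BV_midpoint (hD : IsSphereDomain Ω R) {u v : (𝔼 n) → ℝ} (hu : u ∈ BV Ω) (hv : v ∈ BV Ω) :
    (fun y => 2⁻¹ * u y + 2⁻¹ * v y) ∈ BV Ω := by
  refine mem_BV hD.isOpen hD.volume_ne_top ((hu.1.const_mul _).add (hv.1.const_mul _)) ?_
  have hwu := integrable_indicator_of_mem_BV hD.isOpen hu
  have hwv := integrable_indicator_of_mem_BV hD.isOpen hv
  refine ne_top_of_le_ne_top (ENNReal.ofReal_ne_top (r := 2⁻¹ * (variation (Ω.indicator u) Ω).toReal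
    + 2⁻¹ * (variation (Ω.indicator v) Ω).toReal)) (iSup₂_le fun g hg => ENNReal.ofReal_le_ofReal ?_)
  have h1 := integral_le_variation (variation_ne_top_of_mem_BV hD.isOpen hu) hg
  have h2 := integral_le_variation (variation_ne_top_of_mem_BV hD.isOpen hv) hg
  have e1 : ∫ x, Ω.indicator (fun y => 2⁻¹ * u y + 2⁻¹ * v y) x * divergence g x
      = 2⁻¹ * (∫ x, Ω.indicator u x * divergence g x) + 2⁻¹ * ∫ x, Ω.indicator v x * divergence g x := by
    rw [← integral_const_mul, ← integral_const_mul, ← integral_add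
      ((integrable_mul_divergence hwu.locallyIntegrable hg.contDiff hg.hasCompactSupport).const_mul _)
      ((integrable_mul_divergence hwv.locallyIntegrable hg.contDiff hg.hasCompactSupport).const_mul _)]
    refine integral_congr_ae (Eventually.of_forall fun x => ?_)
    by_cases hx : x ∈ Ω
    · simp only [indicator_of_mem hx]; ring
    · simp [hx]
  rw [e1]
  linarith

lemma integrableOn_sq_sqrt_sub {u v : (𝔼 n) → ℝ} (hu : IntegrableOn u Ω) (hv : IntegrableOn v Ω)
    (hu0 : ∀ᵐ x ∂(volume.restrict Ω), 0 ≤ u x) (hv0 : ∀ᵐ x ∂(volume.restrict Ω), 0 ≤ v x) :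
    IntegrableOn (fun x => (√(u x) - √(v x)) ^ 2) Ω := by
  refine Integrable.mono' ((hu.add hv).const_mul 2)
    (((Real.continuous_sqrt.comp_aestronglyMeasurable hu.1).sub
      (Real.continuous_sqrt.comp_aestronglyMeasurable hv.1)).pow 2) ?_
  filter_upwards [hu0, hv0] with x hx hx'
  rw [Real.norm_of_nonneg (sq_nonneg _)]
  simp only [Pi.add_apply]
  nlinarith [Real.sq_sqrt hx, Real.sq_sqrt hx', sq_nonneg (√(u x) + √(v x))]

/-- Strong midpoint convexity of the energy. -/
lemma HasFiniteEnergy.midpoint (hD : IsSphereDomain Ω R) {β : (𝔼 n) → ℝ} {a : ℝ}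
    (hβm : AEStronglyMeasurable β (surfaceMeasure Ω))
    (hβ : ∀ᵐ x ∂(surfaceMeasure Ω), |β x| ≤ 1 - a) {u v : (𝔼 n) → ℝ}
    (hu : HasFiniteEnergy Ω u) (hv : HasFiniteEnergy Ω v) :
    HasFiniteEnergy Ω (fun y => 2⁻¹ * u y + 2⁻¹ * v y) ∧
    2 * realEnergy Ω β (fun y => 2⁻¹ * u y + 2⁻¹ * v y) + (∫ x in Ω, (√(u x) - √(v x)) ^ 2) / 2
      ≤ realEnergy Ω β u + realEnergy Ω β v := by
  set m : (𝔼 n) → ℝ := fun y => 2⁻¹ * u y + 2⁻¹ * v y with hm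
  have hmBV : m ∈ BV Ω := mem_BV_midpoint hD hu.mem hv.mem
  have hm0 : ∀ᵐ x ∂(volume.restrict Ω), 0 ≤ m x := by
    filter_upwards [hu.nonneg, hv.nonneg] with x hx hx'
    simp only [hm]
    positivity
  have hent : ∀ᵐ x ∂(volume.restrict Ω), 2 * entropy (m x) + (√(u x) - √(v x)) ^ 2 / 2
      ≤ entropy (u x) + entropy (v x) := by
    filter_upwards [hu.nonneg, hv.nonneg] with x hx hx'
    exact entropy_midpoint hx hx'
  have hmi : IntegrableOn (fun x => entropy (m x)) Ω := by
    refine Integrable.mono' (hu.integrable.add hv.integrable)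
      (continuous_entropy.comp_aestronglyMeasurable hmBV.1.1) ?_
    filter_upwards [hent, hm0] with x hx hx'
    rw [Real.norm_of_nonneg (entropy_nonneg hx')]
    simp only [Pi.add_apply]
    nlinarith [entropy_nonneg hx', sq_nonneg (√(u x) - √(v x))]
  have hsq := integrableOn_sq_sqrt_sub hu.mem.1 hv.mem.1 hu.nonneg hv.nonneg
  have hP : 2 * (∫ x in Ω, entropy (m x)) + (∫ x in Ω, (√(u x) - √(v x)) ^ 2) / 2
      ≤ (∫ x in Ω, entropy (u x)) + ∫ x in Ω, entropy (v x) := by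
    rw [← integral_add hu.integrable hv.integrable, ← integral_const_mul, ← integral_div,
      ← integral_add (hmi.const_mul 2) (hsq.div_const 2)]
    exact integral_mono_ae ((hmi.const_mul 2).add (hsq.div_const 2))
      (hu.integrable.add hv.integrable) hent
  have hS : realSurfaceEnergy Ω m ≤ 2⁻¹ * realSurfaceEnergy Ω u + 2⁻¹ * realSurfaceEnergy Ω v := by
    refine realSurfaceEnergy_le hD.isOpen hmBV fun g h H => ?_
    obtain ⟨-, -, -, hui⟩ := integrableOn_mul_testField hu.mem.1 H
    obtain ⟨-, -, -, hvi⟩ := integrableOn_mul_testField hv.mem.1 H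
    have e1 : ∫ x in Ω, m x * (h x + divergence g x)
        = 2⁻¹ * (∫ x in Ω, u x * (h x + divergence g x))
          + 2⁻¹ * ∫ x in Ω, v x * (h x + divergence g x) := by
      rw [← integral_const_mul, ← integral_const_mul, ← integral_add (hui.const_mul _) (hvi.const_mul _)]
      refine integral_congr_ae (Eventually.of_forall fun x => ?_)
      simp only [hm]
      ring
    rw [e1]
    linarith [integral_testField_le hD.isOpen hu.mem H, integral_testField_le hD.isOpen hv.mem H]
  have hB : boundaryTerm Ω β m = 2⁻¹ * boundaryTerm Ω β u + 2⁻¹ * boundaryTerm Ω β v := by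
    rw [boundaryTerm, boundaryTerm, boundaryTerm, ← integral_const_mul, ← integral_const_mul,
      ← integral_add ((hD.integrable_boundaryTerm hβm hβ hu.mem).const_mul _)
        ((hD.integrable_boundaryTerm hβm hβ hv.mem).const_mul _)]
    refine integral_congr_ae ?_
    filter_upwards [hD.trace_linear hu.mem hv.mem 2⁻¹ 2⁻¹] with x hx
    simp only [hm, hx.2]
    ring
  refine ⟨⟨hmBV, hm0, hmi⟩, ?_⟩
  simp only [realEnergy]
  linarith

end minimiser

/-! ### Lower semicontinuity and existence. -/

section existence

variable {Ω : Set (𝔼 n)} {R : ℝ} {β : (𝔼 n) → ℝ} {a : ℝ}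

/-- Lower semicontinuity of the energy. -/
lemma HasFiniteEnergy.of_tendsto (hD : IsSphereDomain Ω R) (ha : 0 < a) (ha' : a ≤ 1)
    (hβm : AEStronglyMeasurable β (surfaceMeasure Ω))
    (hβ : ∀ᵐ x ∂(surfaceMeasure Ω), |β x| ≤ 1 - a) {u : ℕ → (𝔼 n) → ℝ} {v : (𝔼 n) → ℝ}
    (hu : ∀ k, HasFiniteEnergy Ω (u k)) (hv : IntegrableOn v Ω)
    (huv : Tendsto (fun k => ∫ x in Ω, |u k x - v x|) atTop (𝓝 0))
    (hae : ∀ᵐ x ∂(volume.restrict Ω), Tendsto (fun k => u k x) atTop (𝓝 (v x)))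
    {I : ℝ} {e : ℕ → ℝ} (he : Tendsto e atTop (𝓝 I)) (hE : ∀ k, realEnergy Ω β (u k) ≤ e k) :
    HasFiniteEnergy Ω v ∧ realEnergy Ω β v ≤ I := by
  have hΩ := hD.isOpen
  have hv0 : ∀ᵐ x ∂(volume.restrict Ω), 0 ≤ v x := by
    filter_upwards [hae, ae_all_iff.2 fun k => (hu k).nonneg] with x hx hx'
    exact ge_of_tendsto' hx hx'
  have htest : ∀ g h, IsTestField Ω g h →
      Tendsto (fun k => ∫ x in Ω, u k x * (h x + divergence g x)) atTop
        (𝓝 (∫ x in Ω, v x * (h x + divergence g x))) := fun g h H =>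
    tendsto_integral_testField (fun k => (hu k).mem.1) hv huv H
  have hvBV : v ∈ BV Ω := by
    obtain ⟨K, hK⟩ := hD.exists_coercive ha ha' hβm hβ
    obtain ⟨M, hM⟩ := he.bddAbove_range
    have hS : ∀ k, realSurfaceEnergy Ω (u k) ≤ (M + K) / (a / 2) := fun k => by
      rw [le_div_iff₀ (by positivity)]
      have h1 := hK (u k) (hu k)
      have h2 : 0 ≤ ∫ x in Ω, |u k x| := integral_nonneg fun x => abs_nonneg _
      have h3 : e k ≤ M := hM ⟨k, rfl⟩
      linarith [hE k]
    refine mem_BV hΩ hD.volume_ne_top hv (ne_top_of_le_ne_top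
      (ENNReal.ofReal_ne_top (r := (M + K) / (a / 2)))
      (iSup₂_le fun g hg => ENNReal.ofReal_le_ofReal ?_))
    have H := isUnitField_iff_isTestField.1 hg
    have h1 := integral_testField hΩ hv H
    simp only [Pi.zero_apply, mul_zero, integral_zero, zero_add] at h1
    rw [← h1]
    have h2 := htest g 0 H
    simp only [Pi.zero_apply, zero_add] at h2
    refine le_of_tendsto' h2 fun k => ?_
    have h3 := integral_testField_le hΩ (hu k).mem H
    simp only [Pi.zero_apply, zero_add] at h3
    exact h3.trans (hS k)
  have hwv := integrable_indicator_of_mem_BV hΩ hvBV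
  have key : ∀ g h, IsTestField Ω g h → ∀ ε : ℝ, 0 < ε →
      0 ≤ I + boundaryTerm Ω β v + ε - ∫ x in Ω, v x * (h x + divergence g x) ∧
      ∫⁻ x in Ω, ENNReal.ofReal (entropy (v x)) ≤ ENNReal.ofReal
        (I + boundaryTerm Ω β v + ε - ∫ x in Ω, v x * (h x + divergence g x)) := by
    intro g h H ε hε
    -- `K₁` carries all but `ε` of the variation of `v`. The layer is then chosen to miss both `K₁`
    -- and the supports of the test field.
    obtain ⟨K₁, hK₁, hK₁Ω, hK₁V⟩ := exists_isCompact_variation_le hwv.locallyIntegrable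
      (variation_ne_top_of_mem_BV hΩ hvBV) (ε := ENNReal.ofReal ε) (by simpa using hε)
    have hKc : IsCompact (K₁ ∪ (tsupport g ∪ tsupport h)) :=
      hK₁.union (H.hasCompactSupport_fst.union H.hasCompactSupport_snd)
    have hKΩ : K₁ ∪ (tsupport g ∪ tsupport h) ⊆ Ω :=
      union_subset hK₁Ω (union_subset H.tsupport_fst_subset H.tsupport_snd_subset)
    have hKd : Disjoint (K₁ ∪ (tsupport g ∪ tsupport h)) (frontier Ω) := by
      rw [hΩ.frontier_eq]
      exact disjoint_sdiff_right.mono_left hKΩ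
    obtain ⟨δ, hδ, hdis⟩ := hKd.exists_thickenings hKc isClosed_frontier
    set U := Ω ∩ Metric.thickening δ (frontier Ω) with hU
    have hUd : Disjoint U (K₁ ∪ (tsupport g ∪ tsupport h)) :=
      (hdis.mono (Metric.self_subset_thickening hδ _) inter_subset_right).symm
    have hUV : (variation (Ω.indicator v) U).toReal ≤ ε := ENNReal.toReal_le_of_le_ofReal hε.le
      (hK₁V U inter_subset_left (hUd.mono_right subset_union_left))
    obtain ⟨C, -, hC⟩ := hD.exists_integral_trace_sub_le ha ha' hδ
    set r : ℕ → ℝ := fun k => e k + boundaryTerm Ω β v + ε + C * (∫ x in Ω, |u k x - v x|)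
      - ∫ x in Ω, u k x * (h x + divergence g x) with hr
    have hrt : Tendsto r atTop
        (𝓝 (I + boundaryTerm Ω β v + ε - ∫ x in Ω, v x * (h x + divergence g x))) := by
      have := (((he.add_const (boundaryTerm Ω β v)).add_const ε).add (huv.const_mul C)).sub
        (htest g h H)
      simpa only [mul_zero, add_zero] using this
    -- The variation of `u k` in the layer appears once in the lower bound for the surface energy
    -- and once in the trace inequality, and cancels. This is why the leading constant of the trace
    -- inequality has to be sharp.
    have hrk : ∀ k, ∫ x in Ω, entropy (u k x) ≤ r k := fun k => by
      have h1 := integral_testField_add_variation_le hΩ (inter_subset_left : U ⊆ Ω) (hu k).mem H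
        (hUd.mono_right subset_union_right)
      have h2 := hC (u k) (hu k).mem v hvBV
      have h3 := (abs_le.1 (hD.abs_boundaryTerm_sub_le hβm hβ (hu k).mem hvBV)).2
      have h4 := hE k
      rw [realEnergy] at h4
      simp only [hr]
      linarith
    have hr0 : ∀ k, 0 ≤ r k := fun k => (integral_nonneg_of_ae
      ((hu k).nonneg.mono fun x hx => entropy_nonneg hx)).trans (hrk k)
    refine ⟨ge_of_tendsto' hrt hr0, ?_⟩
    calc ∫⁻ x in Ω, ENNReal.ofReal (entropy (v x))
        ≤ ∫⁻ x in Ω, liminf (fun k => ENNReal.ofReal (entropy (u k x))) atTop := by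
          refine lintegral_mono_ae (hae.mono fun x hx => ?_)
          exact (ENNReal.tendsto_ofReal ((continuous_entropy.tendsto _).comp hx)).liminf_eq.ge
      _ ≤ liminf (fun k => ∫⁻ x in Ω, ENNReal.ofReal (entropy (u k x))) atTop :=
          lintegral_liminf_le' fun k => ((hu k).integrable.1.aemeasurable).ennreal_ofReal
      _ ≤ liminf (fun k => ENNReal.ofReal (r k)) atTop := by
          refine liminf_le_liminf (Eventually.of_forall fun k => ?_)
          rw [← ofReal_integral_eq_lintegral_ofReal (hu k).integrable
            ((hu k).nonneg.mono fun x hx => entropy_nonneg hx)]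
          exact ENNReal.ofReal_le_ofReal (hrk k)
      _ = _ := (ENNReal.tendsto_ofReal hrt).liminf_eq
  have hent0 : 0 ≤ᵐ[volume.restrict Ω] fun x => entropy (v x) := hv0.mono fun x hx => entropy_nonneg hx
  have hvi : IntegrableOn (fun x => entropy (v x)) Ω := by
    refine ⟨continuous_entropy.comp_aestronglyMeasurable hv.1, ?_⟩
    rw [hasFiniteIntegral_iff_ofReal hent0]
    exact (key 0 0 (isUnitField_iff_isTestField.1 (isUnitField_zero Ω)) 1 one_pos).2.trans_lt
      ENNReal.ofReal_lt_top
  refine ⟨⟨hvBV, hv0, hvi⟩, ?_⟩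
  have hS : realSurfaceEnergy Ω v ≤ I + boundaryTerm Ω β v - ∫ x in Ω, entropy (v x) := by
    refine realSurfaceEnergy_le hΩ hvBV fun g h H => le_of_forall_pos_le_add fun ε hε => ?_
    obtain ⟨h0, h1⟩ := key g h H ε hε
    rw [← ofReal_integral_eq_lintegral_ofReal hvi hent0, ENNReal.ofReal_le_ofReal_iff h0] at h1
    linarith
  rw [realEnergy]
  linarith

/-- Functions of almost minimal energy are close to each other in `L¹`. -/
lemma exists_integral_abs_sub_lt (hD : IsSphereDomain Ω R) (ha : 0 < a) (ha' : a ≤ 1)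
    (hβm : AEStronglyMeasurable β (surfaceMeasure Ω))
    (hβ : ∀ᵐ x ∂(surfaceMeasure Ω), |β x| ≤ 1 - a) {I : ℝ}
    (hI : ∀ u, HasFiniteEnergy Ω u → I ≤ realEnergy Ω β u) {ε : ℝ} (hε : 0 < ε) :
    ∃ η > 0, ∀ u v, HasFiniteEnergy Ω u → HasFiniteEnergy Ω v → realEnergy Ω β u ≤ I + η →
      realEnergy Ω β v ≤ I + η → ∫ x in Ω, |u x - v x| < ε := by
  obtain ⟨K, hK⟩ := hD.exists_coercive ha ha' hβm hβ
  set M := |I + 1 + K| with hM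
  -- `M` bounds the `L¹` norms by coercivity, so the term `τ (u + v)` contributes at most `ε / 4`;
  -- then `η ≤ τ ε / 8` makes the square-root term at most `ε / 4`.
  set τ := ε / (8 * (M + 1)) with hτ
  have hM0 : 0 ≤ M := abs_nonneg _
  have hτ0 : 0 < τ := by positivity
  have hτM : τ * (M + 1) = ε / 8 := by rw [hτ]; field_simp
  refine ⟨min 1 (τ * ε / 8), lt_min one_pos (by positivity), fun u v hu hv hEu hEv => ?_⟩
  set η := min 1 (τ * ε / 8)
  have hη1 : η ≤ 1 := min_le_left _ _
  have hη2 : η ≤ τ * ε / 8 := min_le_right _ _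
  have hnorm : ∀ w, HasFiniteEnergy Ω w → realEnergy Ω β w ≤ I + η → ∫ x in Ω, w x ≤ M := by
    intro w hw hEw
    have h1 := hK w hw
    have h2 := mul_nonneg (by positivity : 0 ≤ a / 2) (realSurfaceEnergy_nonneg hD.isOpen hw.mem)
    have h3 : ∫ x in Ω, w x ≤ ∫ x in Ω, |w x| :=
      integral_mono hw.mem.1 hw.mem.1.abs fun x => le_abs_self _
    have h4 := le_abs_self (I + 1 + K)
    linarith
  obtain ⟨hm, hmE⟩ := hu.midpoint hD hβm hβ hv
  -- The midpoint has energy at least `I`, so twice the convexity gain cannot exceed the total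
  -- excess: half the integral is at most `2 η`.
  have hsq : ∫ x in Ω, (√(u x) - √(v x)) ^ 2 ≤ 4 * η := by
    have := hI _ hm
    linarith
  have hsqi := integrableOn_sq_sqrt_sub hu.mem.1 hv.mem.1 hu.nonneg hv.nonneg
  have hadd : IntegrableOn (fun x => τ * (u x + v x)) Ω := (hu.mem.1.add hv.mem.1).const_mul τ
  have h1 : ∫ x in Ω, |u x - v x| ≤ (∫ x in Ω, (√(u x) - √(v x)) ^ 2) / (2 * τ)
      + τ * ((∫ x in Ω, u x) + ∫ x in Ω, v x) := by
    rw [← integral_add hu.mem.1 hv.mem.1, ← integral_const_mul, ← integral_div,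
      ← integral_add (hsqi.div_const _) hadd]
    refine integral_mono_ae (hu.mem.1.sub hv.mem.1).abs
      ((hsqi.div_const _).add hadd) ?_
    filter_upwards [hu.nonneg, hv.nonneg] with x hx hx'
    exact abs_sub_le_sq_sqrt hx hx' hτ0
  have h2 : (∫ x in Ω, (√(u x) - √(v x)) ^ 2) / (2 * τ) ≤ ε / 4 := by
    rw [div_le_iff₀ (by positivity)]
    linarith
  have h3 : τ * ((∫ x in Ω, u x) + ∫ x in Ω, v x) ≤ τ * (2 * M) :=
    mul_le_mul_of_nonneg_left (by linarith [hnorm u hu hEu, hnorm v hv hEv]) hτ0.le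
  linarith

/-- The minimising sequence is chosen fast enough to be Cauchy in `L¹` at a geometric rate, so
completeness of `L¹` supplies the limit. A subsequence converges almost everywhere, as required for
Fatou in the entropy. -/
lemma exists_minimiser (hD : IsSphereDomain Ω R) (ha : 0 < a) (ha' : a ≤ 1)
    (hβm : AEStronglyMeasurable β (surfaceMeasure Ω))
    (hβ : ∀ᵐ x ∂(surfaceMeasure Ω), |β x| ≤ 1 - a) :
    ∃ v, HasFiniteEnergy Ω v ∧ ∀ u, HasFiniteEnergy Ω u → realEnergy Ω β v ≤ realEnergy Ω β u := by
  obtain ⟨K, hK⟩ := hD.exists_coercive ha ha' hβm hβ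
  set E : Set ℝ := {r | ∃ u, HasFiniteEnergy Ω u ∧ realEnergy Ω β u = r} with hEdef
  have hEne : E.Nonempty := ⟨_, 0, hasFiniteEnergy_zero hD, rfl⟩
  have hEbd : BddBelow E := by
    refine ⟨-K, ?_⟩
    rintro _ ⟨u, hu, rfl⟩
    have h1 := hK u hu
    have h2 := mul_nonneg (by positivity : 0 ≤ a / 2) (realSurfaceEnergy_nonneg hD.isOpen hu.mem)
    have h3 : 0 ≤ ∫ x in Ω, |u x| := integral_nonneg fun x => abs_nonneg _
    linarith
  set I := sInf E with hIdef
  have hI : ∀ u, HasFiniteEnergy Ω u → I ≤ realEnergy Ω β u := fun u hu => csInf_le hEbd ⟨u, hu, rfl⟩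
  have hclose : ∀ k : ℕ, ∃ η > 0, ∀ u v, HasFiniteEnergy Ω u → HasFiniteEnergy Ω v →
      realEnergy Ω β u ≤ I + η → realEnergy Ω β v ≤ I + η → ∫ x in Ω, |u x - v x| < 2⁻¹ ^ k :=
    fun k => exists_integral_abs_sub_lt hD ha ha' hβm hβ hI (by positivity)
  choose η hη0 hη using hclose
  -- The tolerances `η j` are not known to decrease in `j`, so the `k`-th term is required to meet
  -- all of them up to `k`.
  have hseq : ∀ k : ℕ, ∃ u, HasFiniteEnergy Ω u ∧ (∀ j ≤ k, realEnergy Ω β u ≤ I + η j) ∧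
      realEnergy Ω β u ≤ I + 1 / ((k : ℝ) + 1) := by
    intro k
    have h := ((Finset.eventually_all (Finset.range (k + 1))).2 fun j _ =>
      Ioc_mem_nhdsGT (hη0 j)).and (Ioc_mem_nhdsGT (show (0 : ℝ) < 1 / ((k : ℝ) + 1) by positivity))
    obtain ⟨r, hr1, hr2⟩ := h.exists
    obtain ⟨_, ⟨u, hu, rfl⟩, hlt⟩ := exists_lt_of_csInf_lt hEne
      (show sInf E < I + r by linarith [hr2.1])
    exact ⟨u, hu, fun j hj => hlt.le.trans (by
      linarith [(hr1 j (Finset.mem_range.2 (Nat.lt_succ_of_le hj))).2]), hlt.le.trans (by linarith [hr2.2])⟩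
  choose u hu huη huE using hseq
  have hmem : ∀ k, MemLp (u k) 1 (volume.restrict Ω) := fun k => memLp_one_iff_integrable.2 (hu k).mem.1
  have hdist : ∀ N k m, N ≤ k → N ≤ m →
      eLpNorm (u k - u m) 1 (volume.restrict Ω) < (2⁻¹ : ℝ≥0∞) ^ N := by
    intro N k m hk hm
    have hi : Integrable (u k - u m) (volume.restrict Ω) := (hu k).mem.1.sub (hu m).mem.1
    rw [eLpNorm_one_eq_lintegral_enorm, ← ofReal_integral_norm_eq_lintegral_enorm hi]
    have h1 := hη N (u k) (u m) (hu k) (hu m) (huη k N hk) (huη m N hm)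
    have e1 : (2⁻¹ : ℝ≥0∞) ^ N = ENNReal.ofReal (2⁻¹ ^ N) := by
      rw [ENNReal.ofReal_pow (by norm_num), ENNReal.ofReal_inv_of_pos two_pos, ENNReal.ofReal_ofNat]
    rw [e1, ENNReal.ofReal_lt_ofReal_iff (by positivity)]
    exact h1
  have hsum : ∑' k, (2⁻¹ : ℝ≥0∞) ^ k ≠ ∞ := by
    rw [ENNReal.tsum_geometric]
    simp
  obtain ⟨v, hv, hlim⟩ := Lp.cauchy_complete_eLpNorm le_rfl hmem hsum hdist
  have hvi : IntegrableOn v Ω := memLp_one_iff_integrable.1 hv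
  obtain ⟨φ, hφ, hφae⟩ := (tendstoInMeasure_of_tendsto_eLpNorm one_ne_zero (fun k => (hmem k).1)
    hv.1 hlim).exists_seq_tendsto_ae
  have hL1 : Tendsto (fun k => ∫ x in Ω, |u k x - v x|) atTop (𝓝 0) := by
    have h1 := (ENNReal.tendsto_toReal ENNReal.zero_ne_top).comp hlim
    rw [ENNReal.toReal_zero] at h1
    refine h1.congr fun k => ?_
    have hi : Integrable (u k - v) (volume.restrict Ω) := (hu k).mem.1.sub hvi
    rw [Function.comp_apply, eLpNorm_one_eq_lintegral_enorm,
      ← ofReal_integral_norm_eq_lintegral_enorm hi, ENNReal.toReal_ofReal (integral_nonneg fun _ => norm_nonneg _)]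
    rfl
  have he : Tendsto (fun k : ℕ => I + 1 / ((k : ℝ) + 1)) atTop (𝓝 I) := by
    simpa using tendsto_one_div_add_atTop_nhds_zero_nat.const_add I
  obtain ⟨h1, h2⟩ := HasFiniteEnergy.of_tendsto hD ha ha' hβm hβ (fun k => hu (φ k)) hvi
    (hL1.comp hφ.tendsto_atTop) hφae (he.comp hφ.tendsto_atTop) fun k => huE (φ k)
  exact ⟨v, h1, fun w hw => h2.trans (hI w hw)⟩

end existence

end Capillary

end

theorem mainTheorem1 {n : ℕ} (hn : 0 < n) (Ω : Set (EuclideanSpace ℝ (Fin n)))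
    (hΩ_open : IsOpen Ω) (hΩ_connected : IsConnected Ω) (hΩ_bounded : Bornology.IsBounded Ω)
    (hΩ_lipschitz : Capillary.HasLipschitzBoundary Ω)
    (R : ℝ) (hR : 0 < R) (hΩ_sphere : Capillary.InteriorSphereCondition Ω R)
    (a : ℝ) (ha : 0 < a) (β : EuclideanSpace ℝ (Fin n) → ℝ)
    (hβ_meas : AEStronglyMeasurable β (Capillary.surfaceMeasure Ω))
    (hβ : ∀ᵐ x ∂(Capillary.surfaceMeasure Ω), |β x| ≤ 1 - a) :
    ∃ v ∈ Capillary.BVPlus Ω,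
      (∃ m : ℝ, Capillary.energy Ω β v = (m : EReal)) ∧
      Capillary.energy Ω β v = ⨅ w ∈ Capillary.BVPlus Ω, Capillary.energy Ω β w := by
  have hD : Capillary.IsSphereDomain Ω R := ⟨hΩ_open, hΩ_bounded, hΩ_lipschitz, hR, hΩ_sphere⟩
  -- Replacing `a` by `min a 1` weakens the bound on `β` and provides the condition `a ≤ 1` used in
  -- the trace estimates.
  have hβ' : ∀ᵐ x ∂(Capillary.surfaceMeasure Ω), |β x| ≤ 1 - min a 1 :=
    hβ.mono fun x hx => hx.trans (sub_le_sub_left (min_le_left _ _) _)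
  obtain ⟨v, hv, hmin⟩ := Capillary.exists_minimiser hD (lt_min ha one_pos) (min_le_right _ _)
    hβ_meas hβ'
  have hvmem : v ∈ Capillary.BVPlus Ω := ⟨hv.mem, hv.nonneg⟩
  refine ⟨v, hvmem, ⟨_, hv.energy_eq hΩ_open β⟩, le_antisymm (le_iInf₂ fun w hw => ?_)
    (iInf₂_le v hvmem)⟩
  by_cases hwf : Capillary.HasFiniteEnergy Ω w
  · rw [hv.energy_eq hΩ_open β, hwf.energy_eq hΩ_open β]
    exact EReal.coe_le_coe_iff.2 (hmin w hwf)
  · rw [Capillary.energy_eq_top hΩ_open hw hwf β]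
    exact le_top
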